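/- Let $\Omega\subseteq\mathbb R^3$ be an open connected set with smooth boundary ($\Omega=\mathbb R^3$ is allowed), let $\varkappa_b,\varkappa_G\in\mathbb R$, and let $E\subseteq\Omega$ be a bounded open set with boundary of class $C^2$ (near each point of $\partial E$, up to an isometry of $\mathbb R^3$, $\partial E$ is the graph and $E$ the strict subgraph of a $C^2$ function of two variables). Put $W(s)=\tfrac14(1-s^2)^2$, $c_0=\int_{-1}^1\sqrt{2W(s)}\,ds$, and $$\mathcal W_{\rm Hel}(E)=\int_{\Omega\cap\partial E}\Big[\frac{\varkappa_b}{2}H_{\partial E}^2+\varkappa_G K_{\partial E}\Big]\,d\mathcal H^2,$$ where $H_{\partial E}$ and $K_{\partial E}$ are the sum and the product of the two principal curvatures of $\partial E$ (this is Helfrich's functional with spontaneous curvature $H_0=0$). For $\varepsilon>0$ and $u\in C^2(\Omega)$ let $\nu_u=\nabla u/|\nabla u|$ where $\nabla u\ne0$ and $\nu_u=\mathbf e_3$ where $\nabla u=0$, let $$\mu^\varepsilon_u=\Big(\frac\varepsilon2|\nabla u|^2+\frac{W(u)}\varepsilon\Big)\mathcal L^3\llcorner\Omega ,$$ and let $$\mathcal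 W_\varepsilon(u)=\frac{\varkappa_b}{2\varepsilon}\int_\Omega\Big(\varepsilon\Delta u-\frac{W'(u)}{\varepsilon}\Big)^2dx+\frac{\varkappa_G}{2\varepsilon}\int_\Omega\Big[\Big(\varepsilon\Delta u-\frac{W'(u)}{\varepsilon}\Big)^2-\Big|\varepsilon\nabla^2u-\frac{W'(u)}{\varepsilon}\,\nu_u\otimes\nu_u\Big|^2\Big]dx,$$ where $|M|^2=\mathrm{tr}(M^TM)$ for a $3\times3$ matrix $M$. Then there exists a family $\{u_\varepsilon\}_{\varepsilon>0}\subset C^2(\Omega)$, such that for every $\varepsilon>0$ the functions $\big(\varepsilon\Delta u_\varepsilon-\frac{W'(u_\varepsilon)}{\varepsilon}\big)^2$ and $\big|\varepsilon\nabla^2u_\varepsilon-\frac{W'(u_\varepsilon)}{\varepsilon}\nu_{u_\varepsilon}\otimes\nu_{u_\varepsilon}\big|^2$ are integrable on $\Omega$, with $$\lim_{\varepsilon\to0^+}u_\varepsilon=2\chi_E-1\ \text{ in }L^1(\Omega)\quad\text{(that is, }\|u_\varepsilon-(2\chi_E-1)\|_{L^1(\Omega)}\to0\text{)},$$ $$\lim_{\varepsilon\to0^+}\mu^\varepsilon_{u_\varepsilon}=c_0\,\mathcal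 H^2\llcorner\partial E\ \text{ as Radon measures in }\Omega\quad\text{(that is, tested against }C_c(\Omega)\text{)},$$ $$\lim_{\varepsilon\to0^+}\mathcal W_\varepsilon(u_\varepsilon)=c_0\,\mathcal W_{\rm Hel}(E).$$ -/

import Mathlib

open MeasureTheory Filter Topology
open scoped ContDiff Gradient

noncomputable section

namespace Helfrich

/-- Three-dimensional Euclidean space. -/
abbrev R3 : Type := EuclideanSpace ℝ (Fin 3)

/-! ### Sets with `C^k` boundary -/

/-- The boundary of the set `E ⊆ ℝ³` is of class `C^k`: near each of its points, after a linear
isometric change of coordinates, `E` is the strict subgraph and `∂E` the graph of a `C^k`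
function of the first two coordinates. -/
def HasBoundaryOfClass (k : WithTop ℕ∞) (E : Set R3) : Prop :=
  ∀ x ∈ frontier E, ∃ (r : R3 ≃ₗᵢ[ℝ] R3) (f : EuclideanSpace ℝ (Fin 2) → ℝ),
    ContDiff ℝ k f ∧ ∀ᶠ y in 𝓝 x,
      (y ∈ E ↔ r y 2 < f !₂[r y 0, r y 1]) ∧ (y ∈ frontier E ↔ r y 2 = f !₂[r y 0, r y 1])

/-! ### Curvatures of a `C²` boundary -/

/-- The Hessian `∇²v(x)`, as a linear operator of `ℝ³`. -/
def hessian (v : R3 → ℝ) (x : R3) : R3 →L[ℝ] R3 := fderiv ℝ (∇ v) x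

/-- `v` is a `C²` function near the point `x`, with non-zero gradient at `x`, such that near `x`
the set `E` is `{v > 0}` and its boundary is `{v = 0}`. -/
structure IsLocalDefiningFunction (E : Set R3) (x : R3) (v : R3 → ℝ) : Prop where
  contDiffAt : ContDiffAt ℝ 2 v x
  gradient_ne_zero : ∇ v x ≠ 0
  eventually_mem_iff : ∀ᶠ y in 𝓝 x, (y ∈ E ↔ 0 < v y) ∧ (y ∈ frontier E ↔ v y = 0)

/-- The tangent plane at `x` to the level surface of `v` through `x`. -/
abbrev tangentPlane (v : R3 → ℝ) (x : R3) : Submodule ℝ R3 := (ℝ ∙ ∇ v x)ᗮ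

/-- The shape operator at `x` of the level surface of `v` through `x`, that is the compression of
`-∇²v(x) / |∇v(x)|` to the tangent plane. Its eigenvalues are the principal curvatures. With this
sign they are non-negative if `{v > v(x)}` is convex. -/
def shapeOperator (v : R3 → ℝ) (x : R3) : tangentPlane v x →ₗ[ℝ] tangentPlane v x :=
  (-‖∇ v x‖⁻¹) • ((tangentPlane v x).orthogonalProjectionOnto ∘L hessian v x ∘L
    (tangentPlane v x).subtypeL).toLinearMap

open Classical in
/-- The mean curvature `H_{∂E}(x)`: the sum of the two principal curvatures of `∂E` at `x`,
positive for convex `E`. It does not depend on the local defining function; the value `0` is used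
only where `∂E` is not of class `C²` near `x`. -/
def meanCurvature (E : Set R3) (x : R3) : ℝ :=
  if h : ∃ v, IsLocalDefiningFunction E x v then LinearMap.trace ℝ _ (shapeOperator h.choose x)
  else 0

open Classical in
/-- The Gaussian curvature `K_{∂E}(x)`: the product of the two principal curvatures of `∂E`
at `x`. -/
def gaussCurvature (E : Set R3) (x : R3) : ℝ :=
  if h : ∃ v, IsLocalDefiningFunction E x v then LinearMap.det (shapeOperator h.choose x)
  else 0

/-- Helfrich's functional
`∫_{Ω ∩ ∂E} [κ_b / 2 (H_{∂E} - H₀)² + κ_G K_{∂E}] dℋ²`. -/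
def helfrichEnergy (κb κG H₀ : ℝ) (Ω E : Set R3) : ℝ :=
  ∫ x in Ω ∩ frontier E,
    (κb / 2 * (meanCurvature E x - H₀) ^ 2 + κG * gaussCurvature E x) ∂(μHE[2] : Measure R3)

/-! ### Diffuse interface energies -/

/-- The double-well potential `W(s) = (1 - s²)² / 4`. -/
def doubleWell (s : ℝ) : ℝ := (1 - s ^ 2) ^ 2 / 4

/-- The constant `c₀ = ∫_{-1}^{1} √(2 W(s)) ds`. -/
def c₀ : ℝ := ∫ s in (-1 : ℝ)..1, √(2 * doubleWell s)

/-- The measure `μ^ε_u = (ε / 2 |∇u|² + W(u) / ε) ℒ³ ⌞ Ω`. -/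
def energyMeasure (Ω : Set R3) (ε : ℝ) (u : R3 → ℝ) : Measure R3 :=
  (volume.restrict Ω).withDensity
    fun x => ENNReal.ofReal (ε / 2 * ‖∇ u x‖ ^ 2 + doubleWell (u x) / ε)

open Classical in
/-- The unit vector field `ν_u`, equal to `∇u / |∇u|` where `∇u ≠ 0`, and to the third vector of
the canonical basis where `∇u = 0`. -/
def unitNormal (u : R3 → ℝ) (x : R3) : R3 :=
  if ∇ u x = 0 then EuclideanSpace.single 2 1 else ‖∇ u x‖⁻¹ • ∇ u x

/-- The matrix `ε ∇²u - (W'(u) / ε) ν_u ⊗ ν_u` at the point `x`. -/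
def diffuseMatrix (ε : ℝ) (u : R3 → ℝ) (x : R3) : Matrix (Fin 3) (Fin 3) ℝ :=
  Matrix.of fun i j => ε * hessian u x (EuclideanSpace.single j 1) i
    - deriv doubleWell (u x) / ε * (unitNormal u x i * unitNormal u x j)

/-- The square of the Frobenius norm, `|M|² = tr (Mᵀ M)`. -/
def normSq (M : Matrix (Fin 3) (Fin 3) ℝ) : ℝ := (M.transpose * M).trace

/-- `ε Δu - W'(u) / ε - ε |∇u| H₀` at the point `x`. -/
def chemicalPotential (H₀ ε : ℝ) (u : R3 → ℝ) (x : R3) : ℝ :=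
  ε * Laplacian.laplacian u x - deriv doubleWell (u x) / ε - ε * ‖∇ u x‖ * H₀

/-- `ℋ_ε(u) = (1 / ε) ∫_Ω (ε Δu - W'(u) / ε - ε |∇u| H₀)² dx`. -/
def diffuseBending (Ω : Set R3) (H₀ ε : ℝ) (u : R3 → ℝ) : ℝ :=
  1 / ε * ∫ x in Ω, chemicalPotential H₀ ε u x ^ 2

/-- `𝒦_ε(u) = (1 / 2ε) ∫_Ω [(ε Δu - W'(u) / ε)² - |ε ∇²u - (W'(u) / ε) ν_u ⊗ ν_u|²] dx`. -/
def diffuseGauss (Ω : Set R3) (ε : ℝ) (u : R3 → ℝ) : ℝ :=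
  1 / (2 * ε) * ∫ x in Ω, (chemicalPotential 0 ε u x ^ 2 - normSq (diffuseMatrix ε u x))

/-- `𝒲_ε(u) = (κ_b / 2) ℋ_ε(u) + κ_G 𝒦_ε(u)`, with `H₀ = 0`. -/
def diffuseHelfrich (κb κG : ℝ) (Ω : Set R3) (ε : ℝ) (u : R3 → ℝ) : ℝ :=
  κb / 2 * diffuseBending Ω 0 ε u + κG * diffuseGauss Ω ε u

/-- The integrals over `Ω` that define `ℋ_ε(u)` (for `H₀ = 0`) and `𝒦_ε(u)` are those of
integrable functions. -/
def HasFiniteEnergy (Ω : Set R3) (ε : ℝ) (u : R3 → ℝ) : Prop :=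
  IntegrableOn (fun x => chemicalPotential 0 ε u x ^ 2) Ω ∧
    IntegrableOn (fun x => normSq (diffuseMatrix ε u x)) Ω

/-- Convergence, as Radon measures in the open set `Ω` (that is, tested against continuous
functions with compact support in `Ω`), of the measures `μ ε` to `ν` as `ε → 0⁺`. -/
def TendstoAsRadonMeasures (Ω : Set R3) (μ : ℝ → Measure R3) (ν : Measure R3) : Prop :=
  ∀ φ : R3 → ℝ, Continuous φ → HasCompactSupport φ → tsupport φ ⊆ Ω →
    Tendsto (fun ε => ∫ x, φ x ∂(μ ε)) (𝓝[>] 0) (𝓝 (∫ x, φ x ∂ν))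

end Helfrich

end

open Helfrich

/-! Let $d$ be the signed distance to $\partial E$, positive in $E$, and let $p_R$ be the profile
$q(s)=\tanh(s/\sqrt2)$ modified so as to equal $\pm1$ for $\pm s\ge 2R$. The recovery functions are
$u_\varepsilon=p_R((d+3\sqrt\varepsilon)/\varepsilon)$ with $R=\varepsilon^{-1/2}$. They vary only
in the layer $-5\sqrt\varepsilon<d<-\sqrt\varepsilon$, strictly outside $E$. This outward shift
handles contact of $\partial E$ with $\partial\Omega$: since $E\subseteq\Omega$, the normals agree
at a contact point, so the exterior normal of $E$ leaves $\Omega$ there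
(`eventually_normalMap_mem_iff`). Contact points thus contribute nothing, as they must, since the
limits only see $\Omega\cap\partial E$.

By compactness there is a tube $|d|<r$ on which $d$ is $C^2$ with $|\nabla d|=1$ (`exists_isTube`),
so that $\nabla^2d\,\nabla d=0$. Writing $D=p_R''-W'(p_R)$, one finds $\varepsilon\Delta
u-W'(u)/\varepsilon=p_R'\Delta d+D/\varepsilon$, while the matrix in the Gauss term is
$p_R'\nabla^2d+(D/\varepsilon)\nabla d\otimes\nabla d$, of squared norm
$p_R'^2|\nabla^2d|^2+D^2/\varepsilon^2$. On $\partial E$, $H=-\Delta d$ and $2K=(\Delta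
d)^2-|\nabla^2d|^2$ (`meanCurvature_eq`, `gaussCurvature_eq`).

Every energy is therefore an integral of a kernel in $d$ against a function continuous near
$\partial E$. Because $q''=W'(q)$, the defect $D$ vanishes for $|s|<R$; as it is $O(e^{-|s|})$, it
beats every power of $1/\varepsilon$. The surviving kernels have mass tending to $\int q'^2=c_0$.

Such layer integrals converge to surface integrals (`tendsto_layer`). No Jacobian is computed: near
a boundary point a straightening map with differential the identity is nearly isometric, and
compares volume with area times normal length up to a factor close to 1 (`exists_patch`,
`exists_comparison`). -/

noncomputable section

namespace Helfrich

/-! ### Gradients of functions with nested positivity sets, and local defining functions. -/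

section Gradient

variable {F : Type*} [NormedAddCommGroup F] [InnerProductSpace ℝ F] [CompleteSpace F]

theorem _root_.HasGradientAt.hasDerivAt_comp_line {f : F → ℝ} {f' x : F}
    (hf : HasGradientAt f f' x) (h : F) :
    HasDerivAt (fun s : ℝ => f (x + s • h)) (inner ℝ f' h) 0 := by
  have h1 : HasDerivAt (fun s : ℝ => x + s • h) h 0 := by
    simpa using ((hasDerivAt_id (0 : ℝ)).smul_const h).const_add x
  have h2 : HasFDerivAt f (InnerProductSpace.toDual ℝ F f') (x + (0 : ℝ) • h) := by
    simpa using hf.hasFDerivAt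
  have h3 := h2.comp_hasDerivAt (0 : ℝ) h1
  rw [InnerProductSpace.toDual_apply_apply] at h3
  exact h3

theorem eventually_pos_of_hasDerivAt_pos {f : ℝ → ℝ} {f' : ℝ} (hf : HasDerivAt f f' 0)
    (h0 : f 0 = 0) (hpos : 0 < f') : ∀ᶠ s in 𝓝[>] (0 : ℝ), 0 < f s := by
  have := (hasDerivWithinAt_iff_tendsto_slope' Set.self_notMem_Ioi).1
    (hf.hasDerivWithinAt (s := Set.Ioi 0))
  filter_upwards [this.eventually_const_lt hpos, self_mem_nhdsWithin] with s hs hs0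
  rw [slope_def_field, h0, sub_zero, sub_zero] at hs
  exact (div_pos_iff_of_pos_right hs0).1 hs

/-- If, near a common zero `x`, the set where `a` is positive lies in the set where `b` is
positive, then the gradient of `b` is a non-negative multiple of that of `a`. -/
theorem exists_gradient_eq_smul {a b : F → ℝ} {ga gb x : F} (ha : HasGradientAt a ga x)
    (hb : HasGradientAt b gb x) (ha0 : a x = 0) (hb0 : b x = 0) (hga : ga ≠ 0)
    (h : ∀ᶠ y in 𝓝 x, 0 < a y → 0 < b y) : ∃ c : ℝ, 0 ≤ c ∧ gb = c • ga := by
  have key : ∀ w : F, 0 < inner ℝ ga w → 0 ≤ inner ℝ gb w := by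
    intro w hw
    by_contra! hneg
    have h1 := eventually_pos_of_hasDerivAt_pos (ha.hasDerivAt_comp_line w) (by simpa) hw
    have h2 := eventually_pos_of_hasDerivAt_pos (hb.hasDerivAt_comp_line w).neg (by simpa)
      (neg_pos.2 hneg)
    have h3 : Tendsto (fun s : ℝ => x + s • w) (𝓝[>] 0) (𝓝 x) := by
      have : Continuous fun s : ℝ => x + s • w := by fun_prop
      simpa using (this.tendsto 0).mono_left nhdsWithin_le_nhds
    obtain ⟨s, hs1, hs2, hs3⟩ := (h1.and (h2.and (h3.eventually h))).exists
    have := hs3 hs1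
    simp only [Pi.neg_apply] at hs2
    linarith
  have hn : 0 < inner ℝ ga ga := real_inner_self_pos.2 hga
  set c : ℝ := inner ℝ gb ga / inner ℝ ga ga with hc
  refine ⟨c, div_nonneg (key ga hn) hn.le, ?_⟩
  set w := gb - c • ga with hw
  have hgw : inner ℝ ga w = 0 := by
    rw [hw, inner_sub_right, inner_smul_right, hc, real_inner_comm]
    field_simp
    ring
  have hbw : inner ℝ gb w = inner ℝ w w := by
    have : gb = w + c • ga := by rw [hw]; abel
    rw [this, inner_add_left, inner_smul_left, hgw]
    simp
  -- `w` is the part of `gb` orthogonal to `ga`. For every `δ > 0` the direction `δ • ga - w`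
  -- strictly increases `a`, so `key` applies; letting `δ → 0` forces `w = 0`.
  have hδ : ∀ δ : ℝ, 0 < δ → inner ℝ w w ≤ δ * inner ℝ gb ga := by
    intro δ hδ
    have h1 := key (δ • ga - w) (by
      rw [inner_sub_right, inner_smul_right, hgw, sub_zero]; positivity)
    rw [inner_sub_right, inner_smul_right, hbw] at h1
    linarith
  have hlim : Tendsto (fun δ : ℝ => δ * inner ℝ gb ga) (𝓝[>] 0) (𝓝 0) := by
    have : Continuous fun δ : ℝ => δ * inner ℝ gb ga := by fun_prop
    simpa using (this.tendsto 0).mono_left nhdsWithin_le_nhds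
  have hw0 : inner ℝ w w ≤ 0 := ge_of_tendsto hlim (by
    filter_upwards [self_mem_nhdsWithin] with δ hδ' using hδ δ hδ')
  have : w = 0 := real_inner_self_nonpos.1 hw0
  rw [hw, sub_eq_zero] at this
  exact this

theorem _root_.ContDiffAt.gradient {f : F → ℝ} {x : F} {m n : WithTop ℕ∞}
    (hf : ContDiffAt ℝ n f x) (hmn : m + 1 ≤ n) : ContDiffAt ℝ m (∇ f) x :=
  (InnerProductSpace.toDual ℝ F).symm.contDiff.contDiffAt.comp x (hf.fderiv_right hmn)

theorem _root_.ContDiffAt.unit_gradient {f : F → ℝ} {x : F}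
    (hf : ContDiffAt ℝ 2 f x) (h0 : ∇ f x ≠ 0) :
    ContDiffAt ℝ 1 (fun y => ‖∇ f y‖⁻¹ • ∇ f y) x := by
  have h1 : ContDiffAt ℝ 1 (∇ f) x := hf.gradient (by norm_num)
  exact ((h1.norm ℝ h0).inv (norm_ne_zero_iff.2 h0)).smul h1

end Gradient

/-- Near a boundary point, a set with `C^k` boundary is the positivity set, and its boundary the
zero set, of a `C^k` function with non-zero gradient. -/
theorem HasBoundaryOfClass.exists_contDiff {k : WithTop ℕ∞} {E : Set R3}
    (hE : HasBoundaryOfClass k E) (hk : k ≠ 0) {x : R3} (hx : x ∈ frontier E) :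
    ∃ v : R3 → ℝ, ContDiff ℝ k v ∧ ∇ v x ≠ 0 ∧
      ∀ᶠ y in 𝓝 x, (y ∈ E ↔ 0 < v y) ∧ (y ∈ frontier E ↔ v y = 0) := by
  obtain ⟨r, f, hf, h⟩ := hE x hx
  have hr : ∀ i : Fin 3, ContDiff ℝ k fun y : R3 => r y i := fun i =>
    (EuclideanSpace.proj (𝕜 := ℝ) i).contDiff.comp r.contDiff
  have hpl : ContDiff ℝ k fun y : R3 => (!₂[r y 0, r y 1] : EuclideanSpace ℝ (Fin 2)) := by
    refine contDiff_piLp' 2 fun i => ?_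
    fin_cases i
    · exact hr 0
    · exact hr 1
  have hv : ContDiff ℝ k fun y : R3 => f !₂[r y 0, r y 1] - r y 2 := (hf.comp hpl).sub (hr 2)
  refine ⟨_, hv, ?_, ?_⟩
  -- Along the preimage of the third basis vector the function decreases at unit rate, so its
  -- gradient is not zero.
  · intro h0
    have h1 := (hv.differentiable hk x).hasGradientAt
    have h2 := h1.hasDerivAt_comp_line (r.symm (EuclideanSpace.single 2 1))
    rw [h0, inner_zero_left] at h2
    have h3 : HasDerivAt (fun s : ℝ => f !₂[r x 0, r x 1] - (r x 2 + s)) (-1) 0 :=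
      ((hasDerivAt_id (0 : ℝ)).const_add _).const_sub _
    have h4 : (fun s : ℝ => f !₂[r x 0, r x 1] - (r x 2 + s)) = fun s : ℝ =>
        f !₂[r (x + s • r.symm (EuclideanSpace.single 2 1)) 0,
          r (x + s • r.symm (EuclideanSpace.single 2 1)) 1] -
          r (x + s • r.symm (EuclideanSpace.single 2 1)) 2 := by
      funext s
      simp
    rw [h4] at h3
    have := h3.unique h2
    norm_num at this
  · filter_upwards [h] with y hy
    rw [hy.1, hy.2, sub_pos, sub_eq_zero, eq_comm (a := r y 2)]
    exact ⟨Iff.rfl, Iff.rfl⟩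

end Helfrich

end

/-! ### Normal coordinates around a regular level surface. -/

noncomputable section

namespace Helfrich

/-- The unit vector field in the direction of the gradient of `v`. -/
def unitGradient (v : R3 → ℝ) (y : R3) : R3 := ‖∇ v y‖⁻¹ • ∇ v y

theorem norm_unitGradient {v : R3 → ℝ} {y : R3} (h : ∇ v y ≠ 0) : ‖unitGradient v y‖ = 1 :=
  norm_smul_inv_norm (𝕜 := ℝ) h

theorem inner_gradient_eq {v : R3 → ℝ} {y : R3} (h : ∇ v y ≠ 0) (w : R3) :
    inner ℝ (∇ v y) w = ‖∇ v y‖ * inner ℝ (unitGradient v y) w := by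
  rw [unitGradient, inner_smul_left, ← mul_assoc]
  simp [h]

/-- Normal coordinates near a non-degenerate zero `p₀` of a `C²` function `v`: the foot point `π`
on `{v = 0}` and the signed distance `l` along the normal. -/
theorem exists_normal_coordinates {v : R3 → ℝ} {p₀ : R3} (hv : ContDiffAt ℝ 2 v p₀)
    (hg : ∇ v p₀ ≠ 0) (h0 : v p₀ = 0) :
    ∃ (π : R3 → R3) (l : R3 → ℝ), ContDiffAt ℝ 1 π p₀ ∧ ContDiffAt ℝ 2 l p₀ ∧ π p₀ = p₀ ∧
      (∀ᶠ x in 𝓝 p₀, v (π x) = 0 ∧ HasGradientAt l (unitGradient v (π x)) x ∧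
        ∇ v (π x) ≠ 0 ∧ π x + l x • unitGradient v (π x) = x) ∧
      ∀ᶠ q : R3 × ℝ in 𝓝 (p₀, 0), v q.1 = 0 →
        π (q.1 + q.2 • unitGradient v q.1) = q.1 ∧ l (q.1 + q.2 • unitGradient v q.1) = q.2 := by
  set n := unitGradient v with hn
  have hnC : ContDiffAt ℝ 1 n p₀ := hv.unit_gradient hg
  have hv1 : ContDiffAt ℝ 1 v p₀ := hv.of_le (by norm_num)
  -- Adding the value `v q.1` as a last component makes the normal map a local diffeomorphism of `R3
  -- × ℝ`, so no chart of the surface is needed. The coordinates of `x` are read off the preimage of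
  -- `(x, 0)`.
  let Ξ : R3 × ℝ → R3 × ℝ := fun q => (q.1 + q.2 • n q.1, v q.1)
  have hΞ : ContDiffAt ℝ 1 Ξ (p₀, 0) :=
    (contDiffAt_fst.add (contDiffAt_snd.smul (hnC.comp (p₀, (0 : ℝ)) contDiffAt_fst))).prodMk
      (hv1.comp (p₀, (0 : ℝ)) contDiffAt_fst)
  have hΞ0 : Ξ (p₀, 0) = (p₀, 0) := by simp [Ξ, h0]
  -- the derivative of `Ξ` at the base point
  let A : R3 × ℝ →L[ℝ] R3 × ℝ :=
    (ContinuousLinearMap.fst ℝ R3 ℝ + (ContinuousLinearMap.snd ℝ R3 ℝ).smulRight (n p₀)).prod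
      ((innerSL ℝ (∇ v p₀)).comp (ContinuousLinearMap.fst ℝ R3 ℝ))
  have hA : HasFDerivAt Ξ A (p₀, 0) := by
    have h1 : HasFDerivAt (fun q : R3 × ℝ => q.1) (ContinuousLinearMap.fst ℝ R3 ℝ) (p₀, (0 : ℝ)) :=
      hasFDerivAt_fst
    have h2 : HasFDerivAt (fun q : R3 × ℝ => q.2) (ContinuousLinearMap.snd ℝ R3 ℝ) (p₀, (0 : ℝ)) :=
      hasFDerivAt_snd
    have h3 : HasFDerivAt (fun q : R3 × ℝ => n q.1)
        ((fderiv ℝ n p₀).comp (ContinuousLinearMap.fst ℝ R3 ℝ)) (p₀, (0 : ℝ)) :=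
      HasFDerivAt.comp (g := n) (p₀, (0 : ℝ)) (hnC.differentiableAt one_ne_zero).hasFDerivAt h1
    have h4 : HasFDerivAt (fun q : R3 × ℝ => v q.1)
        ((innerSL ℝ (∇ v p₀)).comp (ContinuousLinearMap.fst ℝ R3 ℝ)) (p₀, (0 : ℝ)) :=
      (hv1.differentiableAt one_ne_zero).hasGradientAt.hasFDerivAt.comp (p₀, (0 : ℝ)) h1
    refine ((h1.add (h2.smul h3)).prodMk h4).congr_fderiv ?_
    ext <;> simp [A]
  have hinj : Function.Injective A := by
    rw [injective_iff_map_eq_zero]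
    rintro ⟨h, τ⟩ hq
    simp only [A, ContinuousLinearMap.prod_apply, add_apply,
      ContinuousLinearMap.coe_fst', ContinuousLinearMap.smulRight_apply,
      ContinuousLinearMap.coe_snd', ContinuousLinearMap.comp_apply, innerSL_apply_apply,
      Prod.mk_eq_zero] at hq
    obtain ⟨hq1, hq2⟩ := hq
    have hh : h = -(τ • n p₀) := eq_neg_of_add_eq_zero_left hq1
    rw [hh, inner_gradient_eq hg, ← hn, inner_neg_right, inner_smul_right,
      real_inner_self_eq_norm_sq, norm_unitGradient hg] at hq2
    have hτ : τ = 0 := by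
      have := norm_ne_zero_iff.2 hg
      simp_all
    simp [hh, hτ]
  let A' : (R3 × ℝ) ≃L[ℝ] (R3 × ℝ) :=
    (LinearEquiv.ofInjectiveEndo (A : R3 × ℝ →ₗ[ℝ] R3 × ℝ) hinj).toContinuousLinearEquiv
  have hA' : HasFDerivAt Ξ (A' : R3 × ℝ →L[ℝ] R3 × ℝ) (p₀, 0) := by
    exact hA.congr_fderiv (ContinuousLinearMap.ext fun _ => rfl)
  set J := hΞ.localInverse hA' one_ne_zero with hJ
  have hJC : ContDiffAt ℝ 1 J (p₀, 0) := by
    have := hΞ.to_localInverse hA' one_ne_zero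
    rwa [hΞ0] at this
  have hJ0 : J (p₀, 0) = (p₀, 0) := by
    have := hΞ.localInverse_apply_image hA' one_ne_zero
    rwa [hΞ0] at this
  have hR : ∀ᶠ y in 𝓝 (p₀, (0 : ℝ)), Ξ (J y) = y := by
    have := (hΞ.hasStrictFDerivAt' hA' one_ne_zero).eventually_right_inverse
    rwa [hΞ0] at this
  have hL : ∀ᶠ q in 𝓝 (p₀, (0 : ℝ)), J (Ξ q) = q :=
    (hΞ.hasStrictFDerivAt' hA' one_ne_zero).eventually_left_inverse
  let ι : R3 → R3 × ℝ := fun x => (x, 0)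
  have hι : ContDiff ℝ 1 ι := contDiff_id.prodMk contDiff_const
  have hJι : ContDiffAt ℝ 1 (fun x => J (ι x)) p₀ := hJC.comp p₀ hι.contDiffAt
  have hπ : ContDiffAt ℝ 1 (fun x => (J (ι x)).1) p₀ := contDiffAt_fst.comp p₀ hJι
  have hl : ContDiffAt ℝ 1 (fun x => (J (ι x)).2) p₀ := contDiffAt_snd.comp p₀ hJι
  set π : R3 → R3 := fun x => (J (ι x)).1 with hπd
  set l : R3 → ℝ := fun x => (J (ι x)).2 with hld
  have hπ0 : π p₀ = p₀ := by simp [hπd, ι, hJ0]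
  have hR' : ∀ᶠ x in 𝓝 p₀, π x + l x • n (π x) = x ∧ v (π x) = 0 := by
    have : Tendsto ι (𝓝 p₀) (𝓝 (p₀, 0)) := hι.continuous.tendsto p₀
    filter_upwards [this.eventually hR] with x hx
    exact Prod.mk_inj.1 hx
  have hπt : Tendsto π (𝓝 p₀) (𝓝 p₀) := by simpa only [hπ0] using hπ.continuousAt.tendsto
  have hgne : ∀ᶠ y in 𝓝 p₀, ∇ v y ≠ 0 :=
    (hv.gradient (m := 1) (by norm_num)).continuousAt.eventually_ne hg
  have hgrad : ∀ᶠ x in 𝓝 p₀, HasGradientAt l (n (π x)) x := by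
    filter_upwards [hR'.eventually_nhds, (hπ.eventually (by simp)), (hl.eventually (by simp)),
      hπt.eventually (hv1.eventually (by simp)), hπt.eventually (hnC.eventually (by simp)),
      hπt.eventually hgne.eventually_nhds] with x hx hπx hlx hvx hnx hne
    have dπ := (hπx.differentiableAt one_ne_zero).hasFDerivAt
    have dl := (hlx.differentiableAt one_ne_zero).hasFDerivAt
    have dv := (hvx.differentiableAt one_ne_zero).hasGradientAt.hasFDerivAt
    have dn := (hnx.differentiableAt one_ne_zero).hasFDerivAt
    have e1 : ∀ h, inner ℝ (n (π x)) (fderiv ℝ π x h) = 0 := by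
      intro h
      have h1 := dv.comp x dπ
      have h2 : (v ∘ π) =ᶠ[𝓝 x] fun _ => (0 : ℝ) := hx.mono fun y hy => hy.2
      have h3 := congrArg (fun B : R3 →L[ℝ] ℝ => B h)
        (h1.unique ((hasFDerivAt_const (0 : ℝ) x).congr_of_eventuallyEq h2))
      simp only [ContinuousLinearMap.comp_apply, InnerProductSpace.toDual_apply_apply,
        zero_apply] at h3
      rw [inner_gradient_eq hne.self_of_nhds] at h3
      exact (mul_eq_zero.1 h3).resolve_left (norm_ne_zero_iff.2 hne.self_of_nhds)
    have e2 : ∀ h, inner ℝ (n (π x)) (fderiv ℝ n (π x) h) = 0 := by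
      intro h
      have h1 := dn.inner ℝ dn
      have h2 : (fun y => inner ℝ (n y) (n y)) =ᶠ[𝓝 (π x)] fun _ => (1 : ℝ) := by
        filter_upwards [hne] with y hy
        rw [real_inner_self_eq_norm_sq, norm_unitGradient hy, one_pow]
      have h3 := congrArg (fun B : R3 →L[ℝ] ℝ => B h)
        (h1.unique ((hasFDerivAt_const (1 : ℝ) (π x)).congr_of_eventuallyEq h2))
      simp only [ContinuousLinearMap.comp_apply, ContinuousLinearMap.prod_apply,
        fderivInnerCLM_apply, zero_apply] at h3
      rw [real_inner_comm (n (π x))] at h3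
      linarith
    -- Differentiate `π + l • n ∘ π = id` and pair with `n (π x)`: by `e1` and `e2` only the
    -- derivative of `l` survives.
    have e3 : fderiv ℝ l x = InnerProductSpace.toDual ℝ R3 (n (π x)) := by
      ext h
      have h1 := dπ.add (dl.smul (dn.comp x dπ))
      have h2 : (π + fun y => l y • (n ∘ π) y) =ᶠ[𝓝 x] id := hx.mono fun y hy => hy.1
      have h3 := congrArg (fun B : R3 →L[ℝ] R3 => inner ℝ (n (π x)) (B h))
        (h1.unique ((hasFDerivAt_id x).congr_of_eventuallyEq h2))
      simp only [add_apply, smul_apply,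
        ContinuousLinearMap.comp_apply, ContinuousLinearMap.smulRight_apply,
        ContinuousLinearMap.id_apply, inner_add_right, inner_smul_right, e1, e2,
        Function.comp_apply, real_inner_self_eq_norm_sq] at h3
      rw [InnerProductSpace.toDual_apply_apply, ← h3]
      have := norm_unitGradient hne.self_of_nhds
      rw [← hn] at this
      simp [this]
    rw [hasGradientAt_iff_hasFDerivAt, ← e3]
    exact dl
  refine ⟨π, l, hπ, ?_, hπ0, ?_, ?_⟩
  -- The construction gives only a `C¹` function `l`, but its gradient `n ∘ π` is itself `C¹`: this
  -- recovers the lost derivative.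
  · have h1 : ContDiffAt ℝ 1 (fderiv ℝ l) p₀ := by
      have : (fderiv ℝ l) =ᶠ[𝓝 p₀] fun x => InnerProductSpace.toDual ℝ R3 (n (π x)) :=
        hgrad.mono fun x hx => hx.hasFDerivAt.fderiv
      refine ContDiffAt.congr_of_eventuallyEq ?_ this
      have h2 : ContDiffAt ℝ 1 n (π p₀) := by rwa [hπ0]
      exact (InnerProductSpace.toDual ℝ R3).contDiff.contDiffAt.comp p₀ (h2.comp p₀ hπ)
    obtain ⟨u, hu, hu'⟩ := hgrad.exists_mem
    have := (contDiffAt_succ_iff_hasFDerivAt (n := 1)).2 ⟨fderiv ℝ l, ⟨u, hu, fun x hx =>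
      (hu' x hx).hasFDerivAt.differentiableAt.hasFDerivAt⟩, h1⟩
    exact this.of_le (by norm_num [one_add_one_eq_two])
  · filter_upwards [hR', hgrad, hπt.eventually hgne] with x h1 h2 h3
    exact ⟨h1.2, h2, h3, h1.1⟩
  · filter_upwards [hL] with q hq hvq
    have h1 : Ξ q = ι (q.1 + q.2 • n q.1) := by simp [Ξ, ι, hvq]
    rw [h1] at hq
    exact ⟨congrArg Prod.fst hq, congrArg Prod.snd hq⟩

end Helfrich

end

/-! ### The signed distance and its tubular neighbourhood. -/

noncomputable section

namespace Helfrich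

open Classical in
/-- The signed distance to the boundary of `E`, positive in `E`. -/
def sgnDist (E : Set R3) (x : R3) : ℝ :=
  if x ∈ E then Metric.infDist x (frontier E) else -Metric.infDist x (frontier E)

theorem abs_sgnDist (E : Set R3) (x : R3) : |sgnDist E x| = Metric.infDist x (frontier E) := by
  unfold sgnDist
  split_ifs <;> simp [abs_of_nonneg Metric.infDist_nonneg]

theorem sgnDist_eq_zero_iff {E : Set R3} (hne : (frontier E).Nonempty) {x : R3} :
    sgnDist E x = 0 ↔ x ∈ frontier E := by
  rw [← abs_eq_zero, abs_sgnDist, isClosed_frontier.mem_iff_infDist_zero hne]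

theorem sgnDist_pos_iff {E : Set R3} (hE : IsOpen E) (hne : (frontier E).Nonempty) {x : R3} :
    0 < sgnDist E x ↔ x ∈ E := by
  constructor
  · intro h
    by_contra hx
    rw [sgnDist, if_neg hx] at h
    linarith [Metric.infDist_nonneg (x := x) (s := frontier E)]
  · intro hx
    have h0 : sgnDist E x ≠ 0 := fun h => by
      have := (sgnDist_eq_zero_iff hne).1 h
      rw [hE.frontier_eq] at this
      exact this.2 hx
    rw [sgnDist, if_pos hx] at h0 ⊢
    exact lt_of_le_of_ne Metric.infDist_nonneg (Ne.symm h0)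

theorem continuous_sgnDist (E : Set R3) : Continuous (sgnDist E) := by
  classical
  unfold sgnDist
  refine Continuous.if (fun a ha => ?_) (Metric.continuous_infDist_pt _)
    (Metric.continuous_infDist_pt _).neg
  have : Metric.infDist a (frontier E) = 0 := Metric.infDist_zero_of_mem ha
  rw [this, neg_zero]

theorem exists_sgnDist_eq_infDist {E : Set R3} (hK : IsCompact (frontier E))
    (hne : (frontier E).Nonempty) (x : R3) :
    ∃ p ∈ frontier E, dist x p = |sgnDist E x| := by
  obtain ⟨p, hp, h⟩ := hK.exists_infDist_eq_dist hne x
  exact ⟨p, hp, by rw [abs_sgnDist, h]⟩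

/-- Properties of points close to a boundary point hold at the nearest boundary points of all
nearby points. -/
theorem eventually_of_nearest {E : Set R3} {p₀ : R3} (hp₀ : p₀ ∈ frontier E) {P : R3 → Prop}
    (hP : ∀ᶠ p in 𝓝 p₀, P p) :
    ∀ᶠ x in 𝓝 p₀, ∀ p, dist x p = |sgnDist E x| → P p := by
  obtain ⟨δ, hδ, h⟩ := Metric.eventually_nhds_iff.1 hP
  refine Metric.eventually_nhds_iff.2 ⟨δ / 2, by positivity, fun x hx p hp => h ?_⟩
  have h1 : dist x p ≤ dist x p₀ := by
    rw [hp, abs_sgnDist]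
    exact Metric.infDist_le_dist_of_mem hp₀
  calc dist p p₀ ≤ dist x p + dist x p₀ := dist_triangle_left _ _ _
    _ < δ := by linarith

/-- The vector from a nearest point on the regular level set `{v = 0}` to `x` is normal. -/
theorem exists_sub_eq_smul_unitGradient {E : Set R3} {v : R3 → ℝ} {x p : R3}
    (hp : p ∈ frontier E) (hd : dist x p = |sgnDist E x|) (hv : ContDiffAt ℝ 1 v p)
    (hg : ∇ v p ≠ 0) (hfr : ∀ᶠ y in 𝓝 p, (y ∈ frontier E ↔ v y = 0)) :
    ∃ τ : ℝ, x - p = τ • unitGradient v p := by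
  -- The nearest point minimizes the distance to `x` on the level set, which calls for a Lagrange
  -- multiplier.
  have hext : IsLocalExtrOn (fun y => ‖y - x‖ ^ 2) {y | v y = v p} p := by
    refine Or.inl ?_
    have hvp : v p = 0 := hfr.self_of_nhds.1 hp
    filter_upwards [hfr.filter_mono nhdsWithin_le_nhds, self_mem_nhdsWithin] with y hy hy'
    have hyE : y ∈ frontier E := hy.2 (by rw [← hvp]; exact hy')
    have : ‖p - x‖ ≤ ‖y - x‖ := by
      rw [← dist_eq_norm, ← dist_eq_norm, dist_comm p, dist_comm y, hd, abs_sgnDist]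
      exact Metric.infDist_le_dist_of_mem hyE
    gcongr
  have h1 : HasStrictFDerivAt v (InnerProductSpace.toDual ℝ R3 (∇ v p)) p := by
    rw [toDual_gradient]
    exact hv.hasStrictFDerivAt one_ne_zero
  have h2 : HasStrictFDerivAt (fun y : R3 => ‖y - x‖ ^ 2) (2 • innerSL ℝ (p - x)) p := by
    have := (hasStrictFDerivAt_norm_sq (p - x)).comp p ((hasStrictFDerivAt_id p).sub_const x)
    refine this.congr_fderiv ?_
    ext; simp
  obtain ⟨a, b, hab, h⟩ := hext.exists_multipliers_of_hasStrictFDerivAt_1d h1 h2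
  have h3 : a • ∇ v p + (2 * b) • (p - x) = 0 := by
    refine ext_inner_right ℝ fun w => ?_
    have := congrArg (fun B : R3 →L[ℝ] ℝ => B w) h
    simp only [add_apply, smul_apply, InnerProductSpace.toDual_apply_apply, innerSL_apply_apply,
      smul_eq_mul, zero_apply] at this
    rw [inner_add_left, inner_smul_left, inner_smul_left, inner_zero_left]
    simp only [conj_trivial]
    simp only [nsmul_eq_mul, Nat.cast_ofNat] at this
    linarith
  -- With `b = 0` the multiplier relation would read `a • ∇ v p = 0` with `a ≠ 0`.
  have hb : b ≠ 0 := by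
    rintro rfl
    have : a ≠ 0 := fun ha => hab (by simp [ha])
    simp [hg, this] at h3
  refine ⟨(2 * b)⁻¹ * a * ‖∇ v p‖, ?_⟩
  have hn : ‖∇ v p‖ ≠ 0 := norm_ne_zero_iff.2 hg
  have h4 : (2 * b) • (x - p) = a • ∇ v p := by
    rw [eq_neg_of_add_eq_zero_left h3, ← smul_neg, neg_sub]
  rw [unitGradient, smul_smul, mul_assoc, mul_assoc, mul_inv_cancel₀ hn, mul_one, mul_smul, ← h4,
    smul_smul, inv_mul_cancel₀ (by positivity), one_smul]

/-- Near a boundary point, the signed distance is the normal coordinate. -/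
theorem eventually_sgnDist_eq {E : Set R3} (hK : IsCompact (frontier E)) (hEo : IsOpen E)
    {v l : R3 → ℝ} {p₀ : R3} (hp₀ : p₀ ∈ frontier E) (hv : IsLocalDefiningFunction E p₀ v)
    (hl : ∀ᶠ q : R3 × ℝ in 𝓝 (p₀, 0), v q.1 = 0 → l (q.1 + q.2 • unitGradient v q.1) = q.2) :
    sgnDist E =ᶠ[𝓝 p₀] l := by
  have hne : (frontier E).Nonempty := ⟨p₀, hp₀⟩
  have hg := hv.gradient_ne_zero
  have hg' : 0 < ‖∇ v p₀‖ := norm_pos_iff.2 hg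
  have hv1 : ContDiffAt ℝ 1 v p₀ := hv.contDiffAt.of_le (by norm_num)
  have hstrict : HasStrictFDerivAt v (InnerProductSpace.toDual ℝ R3 (∇ v p₀)) p₀ := by
    rw [toDual_gradient]
    exact hv1.hasStrictFDerivAt one_ne_zero
  -- This bound and `hin` fix the sign. With `x = p + τ • n p` and `v p = 0`, the linear term is at
  -- least `‖∇ v p₀‖ / 2` times `|τ|` in size and the error at most half of that, so `v x` has the
  -- sign of `τ`.
  have hs : ∀ᶠ q : R3 × R3 in 𝓝 (p₀, p₀),
      |v q.1 - v q.2 - inner ℝ (∇ v p₀) (q.1 - q.2)| ≤ ‖∇ v p₀‖ / 4 * ‖q.1 - q.2‖ := by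
    have := hstrict.isLittleO.bound (show 0 < ‖∇ v p₀‖ / 4 by positivity)
    simpa only [InnerProductSpace.toDual_apply_apply, Real.norm_eq_abs] using this
  obtain ⟨s, hs, hs2⟩ : ∃ s ∈ 𝓝 p₀, ∀ x ∈ s, ∀ y ∈ s,
      |v x - v y - inner ℝ (∇ v p₀) (x - y)| ≤ ‖∇ v p₀‖ / 4 * ‖x - y‖ := by
    rw [nhds_prod_eq] at hs
    exact eventually_prod_self_iff (r := fun x y =>
      |v x - v y - inner ℝ (∇ v p₀) (x - y)| ≤ ‖∇ v p₀‖ / 4 * ‖x - y‖).1 hs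
  obtain ⟨δ, hδ, hlδ⟩ := Metric.eventually_nhds_iff.1 hl
  have hnC : ContinuousAt (unitGradient v) p₀ := (hv.contDiffAt.unit_gradient hg).continuousAt
  have hin : ∀ᶠ p in 𝓝 p₀, ‖∇ v p₀‖ / 2 < inner ℝ (∇ v p₀) (unitGradient v p) := by
    have : Tendsto (fun p => inner ℝ (∇ v p₀) (unitGradient v p)) (𝓝 p₀)
        (𝓝 (inner ℝ (∇ v p₀) (unitGradient v p₀))) := tendsto_const_nhds.inner hnC
    refine this.eventually_const_lt ?_
    rw [inner_gradient_eq hg, real_inner_self_eq_norm_sq, norm_unitGradient hg]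
    linarith
  have hgne : ∀ᶠ y in 𝓝 p₀, ∇ v y ≠ 0 :=
    (hv.contDiffAt.gradient (m := 1) (by norm_num)).continuousAt.eventually_ne hg
  have hc : ContinuousAt (sgnDist E) p₀ := (continuous_sgnDist E).continuousAt
  have hd0 : sgnDist E p₀ = 0 := (sgnDist_eq_zero_iff hne).2 hp₀
  have hsm : ∀ᶠ x in 𝓝 p₀, |sgnDist E x| < δ := by
    have := hc.abs
    refine this.eventually_lt_const ?_
    simpa [hd0] using hδ
  filter_upwards [hsm, hs, hv.eventually_mem_iff, eventually_of_nearest hp₀ (Metric.ball_mem_nhds p₀ hδ),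
    eventually_of_nearest hp₀ hs, eventually_of_nearest hp₀ hin, eventually_of_nearest hp₀ hgne,
    eventually_of_nearest hp₀ hv.eventually_mem_iff.eventually_nhds,
    eventually_of_nearest hp₀ (hv1.eventually (by simp))]
    with x hx1 hxs hxv hx2 hx3 hx4 hx5 hx6 hx7
  obtain ⟨p, hp, hd⟩ := exists_sgnDist_eq_infDist hK hne x
  obtain ⟨τ, hτ⟩ := exists_sub_eq_smul_unitGradient hp hd (hx7 p hd) (hx5 p hd)
    ((hx6 p hd).mono fun y hy => hy.2)
  have hvp : v p = 0 := (hx6 p hd).self_of_nhds.2.1 hp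
  have hτn : ‖x - p‖ = |τ| := by
    rw [hτ, norm_smul, norm_unitGradient (hx5 p hd), mul_one, Real.norm_eq_abs]
  have hτd : |τ| = |sgnDist E x| := by rw [← hτn, ← dist_eq_norm, hd]
  have hlx : l x = τ := by
    have := hlδ (y := (p, τ)) (by
      rw [Prod.dist_eq]
      refine max_lt (hx2 p hd) ?_
      rw [Real.dist_eq, sub_zero, hτd]
      exact hx1) hvp
    rwa [← hτ, add_sub_cancel] at this
  rw [hlx]
  have hb := hs2 x hxs p (hx3 p hd)
  rw [hτn, hvp, sub_zero, hτ, inner_smul_right, abs_le] at hb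
  have h4 := hx4 p hd
  rcases lt_trichotomy τ 0 with h | h | h
  · have : v x < 0 := by
      rw [abs_of_neg h] at hb
      nlinarith [hb.2]
    have hxE : x ∉ E := fun hxE => by linarith [hxv.1.1 hxE]
    have h5 : ¬ 0 < sgnDist E x := fun h => hxE ((sgnDist_pos_iff hEo hne).1 h)
    rw [abs_of_neg h, abs_of_nonpos (not_lt.1 h5)] at hτd
    linarith
  · rw [h] at hτd ⊢
    simpa using hτd.symm
  · have : 0 < v x := by
      rw [abs_of_pos h] at hb
      nlinarith [hb.1]
    have h5 : 0 < sgnDist E x := (sgnDist_pos_iff hEo hne).2 (hxv.1.2 this)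
    rw [abs_of_pos h, abs_of_pos h5] at hτd
    exact hτd.symm

/-- Near `p₀` the signed distance is the normal coordinate `l` and its gradient is the unit normal
at the foot point `π x`, so everything is inherited from the normal coordinates. -/
theorem exists_tube_at {E : Set R3} (hK : IsCompact (frontier E)) (hEo : IsOpen E)
    (hE : HasBoundaryOfClass 2 E) {p₀ : R3} (hp₀ : p₀ ∈ frontier E) :
    (∀ᶠ x in 𝓝 p₀, ContDiffAt ℝ 2 (sgnDist E) x ∧ ‖∇ (sgnDist E) x‖ = 1 ∧
      x - sgnDist E x • ∇ (sgnDist E) x ∈ frontier E ∧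
      ∇ (sgnDist E) (x - sgnDist E x • ∇ (sgnDist E) x) = ∇ (sgnDist E) x) ∧
    ∀ᶠ q : R3 × ℝ in 𝓝 (p₀, 0), q.1 ∈ frontier E →
      sgnDist E (q.1 + q.2 • ∇ (sgnDist E) q.1) = q.2 ∧
      ∇ (sgnDist E) (q.1 + q.2 • ∇ (sgnDist E) q.1) = ∇ (sgnDist E) q.1 := by
  obtain ⟨v, hvC, hvg, hv⟩ := hE.exists_contDiff two_ne_zero hp₀
  have hne : (frontier E).Nonempty := ⟨p₀, hp₀⟩
  have hloc : IsLocalDefiningFunction E p₀ v := ⟨hvC.contDiffAt, hvg, hv⟩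
  have hv0 : v p₀ = 0 := hv.self_of_nhds.2.1 hp₀
  obtain ⟨π, l, hπ, hl, hπ0, hx, hq⟩ := exists_normal_coordinates hvC.contDiffAt hvg hv0
  have hdl := eventually_sgnDist_eq hK hEo hp₀ hloc (hq.mono fun q h hv => (h hv).2)
  have hπt : Tendsto π (𝓝 p₀) (𝓝 p₀) := by simpa only [hπ0] using hπ.continuousAt.tendsto
  have hgrad : ∀ᶠ x in 𝓝 p₀, ∇ (sgnDist E) x = unitGradient v (π x) := by
    filter_upwards [hx, hdl.eventually_nhds] with x h1 h2
    exact (h1.2.1.congr_of_eventuallyEq h2).gradient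
  have hfix : ∀ᶠ p in 𝓝 p₀, p ∈ frontier E → π p = p := by
    have : Tendsto (fun p : R3 => (p, (0 : ℝ))) (𝓝 p₀) (𝓝 (p₀, 0)) :=
      (Continuous.prodMk_left (0 : ℝ)).tendsto p₀
    filter_upwards [this.eventually hq, hv] with p h1 h2 hp
    simpa using (h1 (h2.2.1 hp)).1
  have hgradp : ∀ᶠ p in 𝓝 p₀, p ∈ frontier E → ∇ (sgnDist E) p = unitGradient v p := by
    filter_upwards [hgrad, hfix] with p h1 h2 hp
    rw [h1, h2 hp]
  constructor
  · filter_upwards [hx, hdl.eventually_nhds, hgrad, hl.eventually (by simp),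
      hπt.eventually hv, hπt.eventually hgradp] with x h1 h2 h3 h4 h5 h6
    have hmem : π x ∈ frontier E := h5.2.2 h1.1
    have hfoot : x - sgnDist E x • ∇ (sgnDist E) x = π x := by
      rw [h3, h2.self_of_nhds, sub_eq_iff_eq_add]
      exact h1.2.2.2.symm
    refine ⟨h4.congr_of_eventuallyEq h2, ?_, ?_, ?_⟩
    · rw [h3, norm_unitGradient h1.2.2.1]
    · rwa [hfoot]
    · rw [hfoot, h6 hmem, h3]
  · have h1 : Tendsto (fun q : R3 × ℝ => q.1) (𝓝 (p₀, 0)) (𝓝 p₀) := continuous_fst.tendsto _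
    have h2 : Tendsto (fun q : R3 × ℝ => q.1 + q.2 • unitGradient v q.1) (𝓝 (p₀, 0)) (𝓝 p₀) := by
      have hnC : ContinuousAt (unitGradient v) p₀ :=
        (hvC.contDiffAt.unit_gradient hvg).continuousAt
      have h3 : Tendsto (fun q : R3 × ℝ => q.2) (𝓝 (p₀, 0)) (𝓝 0) := continuous_snd.tendsto _
      simpa using h1.add (h3.smul (hnC.tendsto.comp h1))
    filter_upwards [hq, h1.eventually hgradp, h1.eventually hv, h2.eventually hgrad,
      h2.eventually hdl] with q a1 a2 a3 a4 a5 hqE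
    rw [a2 hqE, a4, a5]
    exact ⟨(a1 (a3.2.1 hqE)).2, by rw [(a1 (a3.2.1 hqE)).1]⟩

/-- `r` is the radius of a tubular neighbourhood of the boundary of `E`, on which the signed
distance is regular. -/
structure IsTube (E : Set R3) (r : ℝ) : Prop where
  pos : 0 < r
  contDiffAt : ∀ x, |sgnDist E x| < r → ContDiffAt ℝ 2 (sgnDist E) x
  norm_gradient : ∀ x, |sgnDist E x| < r → ‖∇ (sgnDist E) x‖ = 1
  foot_mem : ∀ x, |sgnDist E x| < r → x - sgnDist E x • ∇ (sgnDist E) x ∈ frontier E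
  gradient_foot : ∀ x, |sgnDist E x| < r →
    ∇ (sgnDist E) (x - sgnDist E x • ∇ (sgnDist E) x) = ∇ (sgnDist E) x
  sgnDist_normal : ∀ p ∈ frontier E, ∀ t : ℝ, |t| < r →
    sgnDist E (p + t • ∇ (sgnDist E) p) = t
  gradient_normal : ∀ p ∈ frontier E, ∀ t : ℝ, |t| < r →
    ∇ (sgnDist E) (p + t • ∇ (sgnDist E) p) = ∇ (sgnDist E) p

/-- An open set containing a compact non-empty boundary contains a tube around it. -/
theorem exists_tube_subset {E U : Set R3} (hK : IsCompact (frontier E))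
    (hne : (frontier E).Nonempty) (hU : IsOpen U) (hKU : frontier E ⊆ U) :
    ∃ r > 0, ∀ x, |sgnDist E x| < r → x ∈ U := by
  obtain ⟨δ, hδ, h⟩ := hK.exists_thickening_subset_open hU hKU
  refine ⟨δ, hδ, fun x hx => h ?_⟩
  obtain ⟨p, hp, hd⟩ := exists_sgnDist_eq_infDist hK hne x
  exact Metric.mem_thickening_iff.2 ⟨p, hp, hd ▸ hx⟩

/-- Compactness of the boundary makes the local neighbourhoods uniform, separately for the
properties of points `x` and for those of normal segments. -/
theorem exists_isTube {E : Set R3} (hK : IsCompact (frontier E)) (hne : (frontier E).Nonempty)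
    (hEo : IsOpen E) (hE : HasBoundaryOfClass 2 E) : ∃ r, IsTube E r := by
  have hT := fun p (hp : p ∈ frontier E) => exists_tube_at hK hEo hE hp
  obtain ⟨r₁, hr₁, h₁⟩ := exists_tube_subset hK hne isOpen_interior
    fun p hp => mem_interior_iff_mem_nhds.2 (hT p hp).1
  have h₂ := hK.eventually_forall_of_forall_eventually (x₀ := (0 : ℝ))
    (P := fun t p => p ∈ frontier E → sgnDist E (p + t • ∇ (sgnDist E) p) = t ∧
      ∇ (sgnDist E) (p + t • ∇ (sgnDist E) p) = ∇ (sgnDist E) p)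
    fun p hp => (continuous_swap.tendsto ((0 : ℝ), p)).eventually (hT p hp).2
  obtain ⟨r₂, hr₂, h₂⟩ := Metric.eventually_nhds_iff.1 h₂
  have h₁' := fun x (hx : |sgnDist E x| < min r₁ r₂) =>
    interior_subset (h₁ x (hx.trans_le (min_le_left _ _)))
  have h₂' := fun p (hp : p ∈ frontier E) (t : ℝ) (ht : |t| < min r₁ r₂) =>
    h₂ (y := t) (by simpa using ht.trans_le (min_le_right _ _)) p hp hp
  exact ⟨min r₁ r₂, lt_min hr₁ hr₂, fun x hx => (h₁' x hx).1, fun x hx => (h₁' x hx).2.1,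
    fun x hx => (h₁' x hx).2.2.1, fun x hx => (h₁' x hx).2.2.2,
    fun p hp t ht => (h₂' p hp t ht).1, fun p hp t ht => (h₂' p hp t ht).2⟩

end Helfrich

end

/-! ### The curvatures of the boundary through the Hessian of the signed distance. -/

noncomputable section

namespace Helfrich

theorem hasFDerivAt_gradient {v : R3 → ℝ} {x : R3} (hv : ContDiffAt ℝ 2 v x) :
    HasFDerivAt (∇ v) (hessian v x) x :=
  ((hv.gradient (m := 1) (by norm_num)).differentiableAt one_ne_zero).hasFDerivAt

theorem inner_hessian {v : R3 → ℝ} {x : R3} (hv : ContDiffAt ℝ 2 v x) (a b : R3) :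
    inner ℝ (hessian v x a) b = fderiv ℝ (fderiv ℝ v) x a b := by
  have h1 := (((hv.fderiv_right (m := 1) (by norm_num)).differentiableAt
    one_ne_zero).hasFDerivAt).clm_apply (hasFDerivAt_const b x)
  have h2 := (hasFDerivAt_gradient hv).inner ℝ (hasFDerivAt_const b x)
  simp only [inner_gradient_left] at h2
  have := congrArg (fun B : R3 →L[ℝ] ℝ => B a) (h2.unique h1)
  simpa using this

theorem inner_hessian_comm {v : R3 → ℝ} {x : R3} (hv : ContDiffAt ℝ 2 v x) (a b : R3) :
    inner ℝ (hessian v x a) b = inner ℝ a (hessian v x b) := by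
  rw [real_inner_comm _ a, inner_hessian hv, inner_hessian hv]
  exact (hv.isSymmSndFDerivAt (by simp)) a b

/-- Differentiating `‖∇ v‖ ^ 2 = 1` gives `⟪∇ v, ∇²v h⟫ = 0` for all `h`; the Hessian is symmetric.
-/
theorem hessian_apply_gradient {v : R3 → ℝ} {x : R3} (hv : ContDiffAt ℝ 2 v x)
    (h1 : ∀ᶠ y in 𝓝 x, ‖∇ v y‖ = 1) : hessian v x (∇ v x) = 0 := by
  refine ext_inner_right ℝ fun h => ?_
  have h2 := (hasFDerivAt_gradient hv).inner ℝ (hasFDerivAt_gradient hv)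
  have h3 : (fun y => inner ℝ (∇ v y) (∇ v y)) =ᶠ[𝓝 x] fun _ => (1 : ℝ) := by
    filter_upwards [h1] with y hy
    rw [real_inner_self_eq_norm_sq, hy, one_pow]
  have h4 := congrArg (fun B : R3 →L[ℝ] ℝ => B h)
    (h2.unique ((hasFDerivAt_const (1 : ℝ) x).congr_of_eventuallyEq h3))
  simp only [ContinuousLinearMap.comp_apply, ContinuousLinearMap.prod_apply,
    fderivInnerCLM_apply, zero_apply] at h4
  rw [inner_hessian_comm hv, inner_zero_left]
  rw [real_inner_comm (∇ v x)] at h4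
  linarith

/-- The Hessian at a critical point of a function that is constant along the image of a `C¹` map
vanishes on the directions fixed by that map. -/
theorem inner_hessian_eq_zero {w : R3 → ℝ} {F : R3 → R3} {x τ : R3} (hw : ContDiffAt ℝ 2 w x)
    (hg : ∇ w x = 0) (hF : ContDiffAt ℝ 1 F x) (hFx : F x = x) (hτ : fderiv ℝ F x τ = τ)
    (h0 : ∀ᶠ z in 𝓝 x, w (F z) = 0) : inner ℝ (hessian w x τ) τ = 0 := by
  have hline : Tendsto (fun s : ℝ => x + s • τ) (𝓝 0) (𝓝 x) := by
    have : Continuous fun s : ℝ => x + s • τ := by fun_prop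
    simpa using this.tendsto 0
  have hline' : ∀ s : ℝ, HasDerivAt (fun s : ℝ => x + s • τ) τ s := fun s => by
    simpa using ((hasDerivAt_id s).smul_const τ).const_add x
  have hFt : Tendsto F (𝓝 x) (𝓝 x) := by simpa only [hFx] using hF.continuousAt.tendsto
  -- As `F` is only `C¹`, `w ∘ F` cannot be differentiated twice by the chain rule. Its first-order
  -- relation along the line is instead divided by `s`, with `s → 0`, using that `∇ w` vanishes at
  -- `x`.
  have e1 : ∀ᶠ s in 𝓝 (0 : ℝ),
      inner ℝ (∇ w (F (x + s • τ))) (fderiv ℝ F (x + s • τ) τ) = 0 := by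
    filter_upwards [hline.eventually h0.eventually_nhds,
      hline.eventually (hF.eventually (by simp)),
      (hFt.comp hline).eventually (hw.eventually (by simp))] with s h1 h2 h3
    have h4 := (h3.differentiableAt two_ne_zero).hasGradientAt.hasFDerivAt.comp (x + s • τ)
      (h2.differentiableAt one_ne_zero).hasFDerivAt
    have h5 : (w ∘ F) =ᶠ[𝓝 (x + s • τ)] fun _ => (0 : ℝ) := h1
    have h6 := congrArg (fun B : R3 →L[ℝ] ℝ => B τ)
      (h4.unique ((hasFDerivAt_const (0 : ℝ) _).congr_of_eventuallyEq h5))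
    simp only [ContinuousLinearMap.comp_apply, InnerProductSpace.toDual_apply_apply,
      zero_apply] at h6
    exact h6
  have e2 : HasDerivAt (fun s : ℝ => ∇ w (F (x + s • τ))) (hessian w x τ) 0 := by
    have h1 : HasFDerivAt (∇ w) (hessian w x) (F (x + (0 : ℝ) • τ)) := by
      simpa [hFx] using hasFDerivAt_gradient hw
    have h2 : HasFDerivAt F (fderiv ℝ F x) (x + (0 : ℝ) • τ) := by
      simpa using (hF.differentiableAt one_ne_zero).hasFDerivAt
    have h3 := (h1.comp (x + (0 : ℝ) • τ) h2).comp_hasDerivAt (0 : ℝ) (hline' 0)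
    rw [ContinuousLinearMap.comp_apply, hτ] at h3
    exact h3
  have e3 : Tendsto (fun s : ℝ => s⁻¹ • ∇ w (F (x + s • τ))) (𝓝[≠] 0) (𝓝 (hessian w x τ)) := by
    have := hasDerivAt_iff_tendsto_slope.1 e2
    refine this.congr fun s => ?_
    simp [slope_def_module, hFx, hg]
  have e4 : Tendsto (fun s : ℝ => fderiv ℝ F (x + s • τ) τ) (𝓝[≠] 0) (𝓝 τ) := by
    have h1 : ContinuousAt (fderiv ℝ F) x := (hF.fderiv_right (m := 0) (by simp)).continuousAt
    have h2 : Tendsto (fun s : ℝ => fderiv ℝ F (x + s • τ) τ) (𝓝 0) (𝓝 (fderiv ℝ F x τ)) :=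
      ((ContinuousLinearMap.apply ℝ R3 τ).continuous.tendsto _).comp (h1.tendsto.comp hline)
    rw [hτ] at h2
    exact h2.mono_left nhdsWithin_le_nhds
  refine tendsto_nhds_unique (e3.inner e4) (tendsto_const_nhds.congr' ?_)
  filter_upwards [e1.filter_mono nhdsWithin_le_nhds] with s hs
  rw [inner_smul_left, hs, mul_zero]

section LinearAlgebra

/-- Expresses the Gaussian curvature through traces, which can be computed in the whole space rather
than in the tangent plane. -/
theorem det_eq_of_finrank_eq_two {V : Type*} [AddCommGroup V] [Module ℝ V]
    [FiniteDimensional ℝ V] (h : Module.finrank ℝ V = 2) (A : V →ₗ[ℝ] V) :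
    LinearMap.det A =
      (LinearMap.trace ℝ V A ^ 2 - LinearMap.trace ℝ V (A ∘ₗ A)) / 2 := by
  let b := Module.finBasisOfFinrankEq ℝ V h
  rw [← LinearMap.det_toMatrix b, LinearMap.trace_eq_matrix_trace ℝ b,
    LinearMap.trace_eq_matrix_trace ℝ b, LinearMap.toMatrix_comp b b b, Matrix.det_fin_two,
    Matrix.trace_fin_two, Matrix.trace_fin_two, Matrix.mul_apply, Matrix.mul_apply]
  simp only [Fin.sum_univ_two]
  ring

variable {n : R3}

/-- The compression of `M` to the plane orthogonal to `n`. -/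
def compression (n : R3) (M : R3 →L[ℝ] R3) : (ℝ ∙ n)ᗮ →ₗ[ℝ] (ℝ ∙ n)ᗮ :=
  ((ℝ ∙ n)ᗮ.orthogonalProjectionOnto ∘L M ∘L (ℝ ∙ n)ᗮ.subtypeL).toLinearMap

/-- The component along `n`, removed by the projection, is killed by `M`. Combined with cyclicity of
the trace, this turns traces of compressions into traces of `M` and `M ∘ M`. -/
theorem compression_factor {M : R3 →L[ℝ] R3} (hM : M n = 0) :
    M.toLinearMap ∘ₗ ((ℝ ∙ n)ᗮ.subtypeL).toLinearMap ∘ₗ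
      (ℝ ∙ n)ᗮ.orthogonalProjectionOnto.toLinearMap = M.toLinearMap := by
  ext1 y
  have h1 : y - ((ℝ ∙ n)ᗮ.orthogonalProjectionOnto y : R3) ∈ (ℝ ∙ n) := by
    have := (ℝ ∙ n)ᗮ.sub_starProjection_mem_orthogonal y
    rwa [Submodule.orthogonal_orthogonal] at this
  obtain ⟨c, hc⟩ := Submodule.mem_span_singleton.1 h1
  have h2 : M (y - ((ℝ ∙ n)ᗮ.orthogonalProjectionOnto y : R3)) = 0 := by
    rw [← hc, map_smul, hM, smul_zero]
  rw [map_sub, sub_eq_zero] at h2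
  exact h2.symm

theorem trace_compression {M : R3 →L[ℝ] R3} (hM : M n = 0) :
    LinearMap.trace ℝ _ (compression n M) = LinearMap.trace ℝ _ M.toLinearMap := by
  have h : compression n M = (ℝ ∙ n)ᗮ.orthogonalProjectionOnto.toLinearMap ∘ₗ
    (M.toLinearMap ∘ₗ ((ℝ ∙ n)ᗮ.subtypeL).toLinearMap) := rfl
  rw [h, LinearMap.trace_comp_comm', LinearMap.comp_assoc, compression_factor hM]

theorem trace_compression_comp_self {M : R3 →L[ℝ] R3} (hM : M n = 0) :
    LinearMap.trace ℝ _ (compression n M ∘ₗ compression n M) =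
      LinearMap.trace ℝ _ (M.toLinearMap ∘ₗ M.toLinearMap) := by
  have h : compression n M ∘ₗ compression n M =
      (ℝ ∙ n)ᗮ.orthogonalProjectionOnto.toLinearMap ∘ₗ
      ((M.toLinearMap ∘ₗ ((ℝ ∙ n)ᗮ.subtypeL).toLinearMap ∘ₗ
        (ℝ ∙ n)ᗮ.orthogonalProjectionOnto.toLinearMap) ∘ₗ
        (M.toLinearMap ∘ₗ ((ℝ ∙ n)ᗮ.subtypeL).toLinearMap)) := rfl
  rw [h, compression_factor hM, LinearMap.trace_comp_comm', LinearMap.comp_assoc,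
    LinearMap.comp_assoc, compression_factor hM]

theorem finrank_orthogonal_span_singleton_R3 (hn : n ≠ 0) :
    Module.finrank ℝ ((ℝ ∙ n)ᗮ : Submodule ℝ R3) = 2 := by
  have h1 := (ℝ ∙ n).finrank_add_finrank_orthogonal
  rw [finrank_span_singleton hn, finrank_euclideanSpace_fin] at h1
  omega

end LinearAlgebra

/-- The matrix of second derivatives. -/
def hessianMatrix (v : R3 → ℝ) (x : R3) : Matrix (Fin 3) (Fin 3) ℝ :=
  Matrix.of fun i j => hessian v x (EuclideanSpace.single j 1) i

theorem hessianMatrix_eq_toMatrix (v : R3 → ℝ) (x : R3) :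
    hessianMatrix v x = LinearMap.toMatrix (EuclideanSpace.basisFun (Fin 3) ℝ).toBasis
      (EuclideanSpace.basisFun (Fin 3) ℝ).toBasis (hessian v x).toLinearMap := by
  ext i j
  simp [hessianMatrix, LinearMap.toMatrix_apply]

theorem trace_hessianMatrix (v : R3 → ℝ) (x : R3) :
    (hessianMatrix v x).trace = LinearMap.trace ℝ _ (hessian v x).toLinearMap := by
  rw [hessianMatrix_eq_toMatrix, ← LinearMap.trace_eq_matrix_trace]

theorem hessianMatrix_transpose {v : R3 → ℝ} {x : R3} (hv : ContDiffAt ℝ 2 v x) :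
    (hessianMatrix v x).transpose = hessianMatrix v x := by
  ext i j
  have h := inner_hessian_comm hv (EuclideanSpace.single i 1) (EuclideanSpace.single j 1)
  simpa [hessianMatrix, EuclideanSpace.inner_single_right, EuclideanSpace.inner_single_left]
    using h

theorem normSq_hessianMatrix {v : R3 → ℝ} {x : R3} (hv : ContDiffAt ℝ 2 v x) :
    normSq (hessianMatrix v x) =
      LinearMap.trace ℝ _ ((hessian v x).toLinearMap ∘ₗ (hessian v x).toLinearMap) := by
  rw [normSq, hessianMatrix_transpose hv, hessianMatrix_eq_toMatrix, ← LinearMap.toMatrix_comp,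
    ← LinearMap.trace_eq_matrix_trace]

/-- Ensures that on the boundary the curvatures are given by their first branch and never by the
default value `0`. -/
theorem IsTube.isLocalDefiningFunction {E : Set R3} {r : ℝ} (ht : IsTube E r) (hEo : IsOpen E)
    {x : R3} (hx : x ∈ frontier E) : IsLocalDefiningFunction E x (sgnDist E) := by
  have hne : (frontier E).Nonempty := ⟨x, hx⟩
  have h0 : |sgnDist E x| < r := by
    rw [(sgnDist_eq_zero_iff hne).2 hx, abs_zero]
    exact ht.pos
  refine ⟨ht.contDiffAt x h0, fun h => ?_, Eventually.of_forall fun y =>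
    ⟨(sgnDist_pos_iff hEo hne).symm, (sgnDist_eq_zero_iff hne).symm⟩⟩
  have := ht.norm_gradient x h0
  rw [h, norm_zero] at this
  exact zero_ne_one this

theorem IsTube.eventually_abs_lt {E : Set R3} {r : ℝ} (_ : IsTube E r) {x : R3}
    (hx : |sgnDist E x| < r) : ∀ᶠ y in 𝓝 x, |sgnDist E y| < r :=
  (continuous_sgnDist E).abs.continuousAt.eventually_lt_const hx

theorem IsTube.hessian_apply_gradient {E : Set R3} {r : ℝ} (ht : IsTube E r) {x : R3}
    (hx : |sgnDist E x| < r) : hessian (sgnDist E) x (∇ (sgnDist E) x) = 0 :=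
  Helfrich.hessian_apply_gradient (ht.contDiffAt x hx)
    ((ht.eventually_abs_lt hx).mono fun _ h => ht.norm_gradient _ h)

/-- The shape operator does not depend on the local defining function. -/
theorem IsTube.shapeOperator_eq {E : Set R3} {r : ℝ} (ht : IsTube E r) (hEo : IsOpen E)
    {x : R3} (hx : x ∈ frontier E) {v : R3 → ℝ} (hv : IsLocalDefiningFunction E x v) :
    shapeOperator v x = -compression (∇ v x) (hessian (sgnDist E) x) ∧
      hessian (sgnDist E) x (∇ v x) = 0 := by
  set d := sgnDist E with hd
  have hne : (frontier E).Nonempty := ⟨x, hx⟩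
  have hloc := ht.isLocalDefiningFunction hEo hx
  have hdx : d x = 0 := (sgnDist_eq_zero_iff hne).2 hx
  have h0 : |d x| < r := by rw [hdx, abs_zero]; exact ht.pos
  have hvx : v x = 0 := hv.eventually_mem_iff.self_of_nhds.2.1 hx
  have dd := (hloc.contDiffAt.differentiableAt two_ne_zero).hasGradientAt
  have dv := (hv.contDiffAt.differentiableAt two_ne_zero).hasGradientAt
  obtain ⟨c, hc0, hc⟩ := exists_gradient_eq_smul dd dv hdx hvx hloc.gradient_ne_zero
    (hv.eventually_mem_iff.mono fun y hy h => hy.1.1 ((sgnDist_pos_iff hEo hne).1 h))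
  have hcn : ‖∇ v x‖ = c := by
    rw [hc, norm_smul, ht.norm_gradient x h0, mul_one, Real.norm_of_nonneg hc0]
  have hcpos : c ≠ 0 := by
    rw [← hcn]
    exact norm_ne_zero_iff.2 hv.gradient_ne_zero
  -- `w` vanishes on the boundary and is critical at `x`. The foot map `F` below lands in the
  -- boundary and fixes tangent directions to first order, so the Hessian of `w` vanishes on the
  -- tangent plane, where those of `v` and `c * d` therefore agree.
  set w : R3 → ℝ := fun y => v y - c * d y with hw
  have hcd : ContDiffAt ℝ 2 (fun y => c * d y) x := contDiffAt_const.mul hloc.contDiffAt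
  have hwC : ContDiffAt ℝ 2 w x := hv.contDiffAt.sub hcd
  have hgw : ∀ᶠ y in 𝓝 x, ∇ w y = ∇ v y - c • ∇ d y := by
    filter_upwards [hv.contDiffAt.eventually (by simp), hloc.contDiffAt.eventually (by simp)]
      with y h1 h2
    have h3 := (h1.differentiableAt two_ne_zero).hasGradientAt.hasFDerivAt.sub
      ((h2.differentiableAt two_ne_zero).hasGradientAt.hasFDerivAt.const_mul c)
    refine HasGradientAt.gradient ?_
    rw [hasGradientAt_iff_hasFDerivAt, map_sub, map_smul]
    exact h3
  have hHw : hessian w x = hessian v x - c • hessian d x := by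
    refine HasFDerivAt.fderiv ?_
    refine HasFDerivAt.congr_of_eventuallyEq ?_ hgw
    exact (hasFDerivAt_gradient hv.contDiffAt).sub
      ((hasFDerivAt_gradient hloc.contDiffAt).const_smul c)
  have hgw0 : ∇ w x = 0 := by rw [hgw.self_of_nhds, hc, sub_self]
  let F : R3 → R3 := fun z => z - d z • ∇ d z
  have hF1 : ContDiffAt ℝ 1 F x := contDiffAt_id.sub
    ((hloc.contDiffAt.of_le (by norm_num)).smul (hloc.contDiffAt.gradient (by norm_num)))
  have hFx : F x = x := by simp [F, hdx]
  have hFt : Tendsto F (𝓝 x) (𝓝 x) := by simpa only [hFx] using hF1.continuousAt.tendsto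
  have hwF : ∀ᶠ z in 𝓝 x, w (F z) = 0 := by
    filter_upwards [ht.eventually_abs_lt h0, hFt.eventually hv.eventually_mem_iff] with z h1 h2
    have h3 := ht.foot_mem z h1
    have h4 : d (F z) = 0 := (sgnDist_eq_zero_iff hne).2 h3
    rw [hw]
    simp only [h4, h2.2.1 h3, mul_zero, sub_zero]
  have hquad : ∀ τ ∈ (ℝ ∙ ∇ v x)ᗮ, inner ℝ (hessian w x τ) τ = 0 := by
    intro τ hτ
    refine inner_hessian_eq_zero hwC hgw0 hF1 hFx ?_ hwF
    have h1 : HasFDerivAt F _ x := (hasFDerivAt_id x).sub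
      (dd.hasFDerivAt.smul (hasFDerivAt_gradient hloc.contDiffAt))
    have h2 : inner ℝ (∇ d x) τ = 0 := by
      have := Submodule.mem_orthogonal_singleton_iff_inner_right.1 hτ
      rw [hc, inner_smul_left] at this
      exact (mul_eq_zero.1 this).resolve_left hcpos
    rw [h1.fderiv]
    rw [sub_apply, add_apply, smul_apply, ContinuousLinearMap.smulRight_apply,
      InnerProductSpace.toDual_apply_apply, ← hd, h2, hdx, zero_smul, zero_smul, add_zero,
      sub_zero, ContinuousLinearMap.id_apply]
  have hcomp : compression (∇ v x) (hessian w x) = 0 := by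
    have hsymm : (compression (∇ v x) (hessian w x)).IsSymmetric := by
      intro a b
      have h1 : ∀ a b : (ℝ ∙ ∇ v x)ᗮ, inner ℝ (compression (∇ v x) (hessian w x) a) b =
          inner ℝ (hessian w x a) (b : R3) := fun a b =>
        Submodule.inner_orthogonalProjectionOnto_eq_of_mem_right b _
      rw [h1, inner_hessian_comm hwC, real_inner_comm, ← h1, real_inner_comm]
    refine hsymm.inner_map_self_eq_zero.1 fun a => ?_
    rw [← hquad a a.2]
    exact Submodule.inner_orthogonalProjectionOnto_eq_of_mem_right a _
  constructor
  · have h1 : compression (∇ v x) (hessian v x) = c • compression (∇ v x) (hessian d x) := by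
      rw [hHw] at hcomp
      rw [← sub_eq_zero, ← hcomp]
      ext1 a
      simp [compression]
    have h2 : shapeOperator v x = (-‖∇ v x‖⁻¹) • compression (∇ v x) (hessian v x) := rfl
    rw [h2, h1, hcn, smul_smul, neg_mul, inv_mul_cancel₀ hcpos, neg_one_smul]
  · rw [hc, map_smul, ht.hessian_apply_gradient h0, smul_zero]

theorem IsTube.meanCurvature_eq {E : Set R3} {r : ℝ} (ht : IsTube E r) (hEo : IsOpen E)
    {x : R3} (hx : x ∈ frontier E) :
    meanCurvature E x = -(hessianMatrix (sgnDist E) x).trace := by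
  have hex : ∃ v, IsLocalDefiningFunction E x v := ⟨_, ht.isLocalDefiningFunction hEo hx⟩
  obtain ⟨h1, h2⟩ := ht.shapeOperator_eq hEo hx hex.choose_spec
  rw [meanCurvature, dif_pos hex, h1, map_neg]
  exact congrArg Neg.neg ((trace_compression h2).trans (trace_hessianMatrix _ _).symm)

/-- The determinant on the two-dimensional tangent plane is half of (trace squared minus trace of
the square), and the sign of the shape operator drops out. -/
theorem IsTube.gaussCurvature_eq {E : Set R3} {r : ℝ} (ht : IsTube E r) (hEo : IsOpen E)
    {x : R3} (hx : x ∈ frontier E) :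
    gaussCurvature E x = ((hessianMatrix (sgnDist E) x).trace ^ 2 -
      normSq (hessianMatrix (sgnDist E) x)) / 2 := by
  have hex : ∃ v, IsLocalDefiningFunction E x v := ⟨_, ht.isLocalDefiningFunction hEo hx⟩
  obtain ⟨h1, h2⟩ := ht.shapeOperator_eq hEo hx hex.choose_spec
  have hd : ContDiffAt ℝ 2 (sgnDist E) x := (ht.isLocalDefiningFunction hEo hx).contDiffAt
  rw [gaussCurvature, dif_pos hex, h1,
    det_eq_of_finrank_eq_two
      (finrank_orthogonal_span_singleton_R3 hex.choose_spec.gradient_ne_zero),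
    map_neg, neg_sq, LinearMap.neg_comp, LinearMap.comp_neg, neg_neg, trace_compression h2,
    trace_compression_comp_self h2, trace_hessianMatrix, normSq_hessianMatrix hd]

end Helfrich

end

/-! ### Comparison of area and volume near the boundary by nearly isometric straightening. -/

noncomputable section

namespace Helfrich

open scoped NNReal ENNReal

section BiLipschitz

variable {X Y : Type*} [MetricSpace X] [MeasurableSpace X] [BorelSpace X]
  [MetricSpace Y] [MeasurableSpace Y] [BorelSpace Y]

theorem _root_.LipschitzOnWith.euclideanHausdorffMeasure_image_le {K : ℝ≥0} {f : X → Y}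
    {s : Set X} (h : LipschitzOnWith K f s) (d : ℕ) :
    (μHE[d] : Measure Y) (f '' s) ≤ (K : ℝ≥0∞) ^ d * (μHE[d] : Measure X) s := by
  rw [Measure.euclideanHausdorffMeasure_def, Measure.euclideanHausdorffMeasure_def,
    Measure.smul_apply, Measure.smul_apply, mul_smul_comm]
  gcongr
  simpa using h.hausdorffMeasure_image_le (d := d) (by positivity)

/-- The bound makes `f` injective on `s` with an inverse that is `K`-Lipschitz on the image. -/
theorem euclideanHausdorffMeasure_le_image {K : ℝ≥0} {f : X → Y} {s : Set X}
    (h : ∀ x ∈ s, ∀ y ∈ s, edist x y ≤ K * edist (f x) (f y)) (d : ℕ) :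
    (μHE[d] : Measure X) s ≤ (K : ℝ≥0∞) ^ d * (μHE[d] : Measure Y) (f '' s) := by
  rcases s.eq_empty_or_nonempty with rfl | ⟨x₀, hx₀⟩
  · simp
  have : Nonempty X := ⟨x₀⟩
  have hinj : Set.InjOn f s := fun x hx y hy hxy => by
    have := h x hx y hy
    rwa [hxy, edist_self, mul_zero, nonpos_iff_eq_zero, edist_eq_zero] at this
  have h1 : LipschitzOnWith K (Function.invFunOn f s) (f '' s) := by
    rintro _ ⟨x, hx, rfl⟩ _ ⟨y, hy, rfl⟩
    rw [hinj.leftInvOn_invFunOn hx, hinj.leftInvOn_invFunOn hy]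
    exact h x hx y hy
  have h2 := h1.euclideanHausdorffMeasure_image_le d
  rwa [hinj.leftInvOn_invFunOn.image_image] at h2

end BiLipschitz

/-- Strict differentiability gives `‖f y - f z - (y - z)‖ ≤ (1 - K⁻¹) ‖y - z‖` near `x`, which is
the lower bound; the upper one holds because the identity has norm less than `K`. -/
theorem _root_.HasStrictFDerivAt.exists_biLipschitz {F : Type*} [NormedAddCommGroup F]
    [NormedSpace ℝ F] {f : F → F} {x : F}
    (hf : HasStrictFDerivAt f (ContinuousLinearMap.id ℝ F) x) {K : ℝ≥0} (hK : 1 < K) :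
    ∃ U ∈ 𝓝 x, LipschitzOnWith K f U ∧ ∀ y ∈ U, ∀ z ∈ U, edist y z ≤ K * edist (f y) (f z) := by
  have hn : ‖ContinuousLinearMap.id ℝ F‖₊ < K := by
    refine lt_of_le_of_lt ?_ hK
    exact ContinuousLinearMap.norm_id_le
  obtain ⟨U, hU, hUL⟩ := hf.exists_lipschitzOnWith_of_nnnorm_lt K hn
  have hc : (0 : ℝ) < 1 - (K : ℝ)⁻¹ := by
    have : (1 : ℝ) < K := by exact_mod_cast hK
    rw [sub_pos]
    exact inv_lt_one_of_one_lt₀ this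
  have h1 := hf.isLittleO.bound hc
  rw [nhds_prod_eq] at h1
  obtain ⟨V, hV, hVL⟩ := eventually_prod_self_iff (r := fun y z =>
    ‖f y - f z - (ContinuousLinearMap.id ℝ F) (y - z)‖ ≤ (1 - (K : ℝ)⁻¹) * ‖y - z‖).1 h1
  refine ⟨U ∩ V, inter_mem hU hV, hUL.mono Set.inter_subset_left, fun y hy z hz => ?_⟩
  have h2 := hVL y hy.2 z hz.2
  have hK0 : (0 : ℝ) < K := by exact_mod_cast zero_lt_one.trans hK
  rw [ContinuousLinearMap.id_apply] at h2
  have h3 : ‖y - z‖ ≤ ‖f y - f z‖ + ‖f y - f z - (y - z)‖ := by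
    calc ‖y - z‖ = ‖(f y - f z) - (f y - f z - (y - z))‖ := by congr 1; abel
      _ ≤ _ := norm_sub_le _ _
  have h4 : ‖y - z‖ ≤ K * ‖f y - f z‖ := by
    have : (K : ℝ)⁻¹ * ‖y - z‖ ≤ ‖f y - f z‖ := by linarith
    rwa [inv_mul_le_iff₀ hK0] at this
  rw [edist_nndist, edist_nndist]
  rw [← dist_eq_norm, ← dist_eq_norm] at h4
  exact_mod_cast h4

/-- The normal exponential map of the boundary of `E`. -/
def normalMap (E : Set R3) (q : R3 × ℝ) : R3 := q.1 + q.2 • ∇ (sgnDist E) q.1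

/-- The nearest boundary point. -/
def foot (E : Set R3) (x : R3) : R3 := x - sgnDist E x • ∇ (sgnDist E) x

theorem measurable_gradient (v : R3 → ℝ) : Measurable (∇ v) :=
  (InnerProductSpace.toDual ℝ R3).symm.continuous.measurable.comp (measurable_fderiv ℝ v)

theorem measurable_normalMap (E : Set R3) : Measurable (normalMap E) :=
  measurable_fst.add (measurable_snd.smul ((measurable_gradient _).comp measurable_fst))

namespace IsTube

variable {E : Set R3} {r : ℝ}

theorem sgnDist_normalMap (ht : IsTube E r) {p : R3} (hp : p ∈ frontier E) {t : ℝ} (h : |t| < r) :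
    sgnDist E (normalMap E (p, t)) = t := ht.sgnDist_normal p hp t h

theorem foot_normalMap (ht : IsTube E r) {p : R3} (hp : p ∈ frontier E) {t : ℝ} (h : |t| < r) :
    foot E (normalMap E (p, t)) = p := by
  rw [foot, ht.sgnDist_normalMap hp h, normalMap, ht.gradient_normal p hp t h, add_sub_cancel_right]

theorem normalMap_foot (ht : IsTube E r) {x : R3} (hx : |sgnDist E x| < r) :
    normalMap E (foot E x, sgnDist E x) = x := by
  have := ht.gradient_foot x hx
  simp only [normalMap, foot, this, sub_add_cancel]

theorem abs_lt_of_mem (ht : IsTube E r) {p : R3} (hp : p ∈ frontier E) : |sgnDist E p| < r := by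
  rw [(sgnDist_eq_zero_iff ⟨p, hp⟩).2 hp, abs_zero]
  exact ht.pos

theorem continuousAt_foot (ht : IsTube E r) {x : R3} (hx : |sgnDist E x| < r) :
    ContinuousAt (foot E) x :=
  continuousAt_id.sub ((continuous_sgnDist E).continuousAt.smul
    ((ht.contDiffAt x hx).gradient (m := 1) (by norm_num)).continuousAt)

theorem continuousAt_normalMap (ht : IsTube E r) {p : R3} (hp : p ∈ frontier E) (t : ℝ) :
    ContinuousAt (normalMap E) (p, t) := by
  have h1 : ContinuousAt (∇ (sgnDist E)) p :=
    ((ht.contDiffAt p (ht.abs_lt_of_mem hp)).gradient (m := 1) (by norm_num)).continuousAt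
  exact continuousAt_fst.add (continuousAt_snd.smul
    (ContinuousAt.comp (f := fun q : R3 × ℝ => q.1) (x := (p, t)) h1 continuousAt_fst))

end IsTube

/-- The straightening of the normal coordinates at the boundary point `p₀`. -/
def straighten (E : Set R3) (p₀ x : R3) : R3 :=
  foot E x - inner ℝ (∇ (sgnDist E) p₀) (foot E x - p₀) • ∇ (sgnDist E) p₀ +
    sgnDist E x • ∇ (sgnDist E) p₀

namespace IsTube

variable {E : Set R3} {r : ℝ}

/-- At `p₀` the foot map differentiates to the projection on the tangent plane, the correction term
to `0`, and the last term to the projection on the normal: they add up to the identity. -/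
theorem hasStrictFDerivAt_straighten (ht : IsTube E r) {p₀ : R3} (hp₀ : p₀ ∈ frontier E) :
    HasStrictFDerivAt (straighten E p₀) (ContinuousLinearMap.id ℝ R3) p₀ := by
  have h0 := ht.abs_lt_of_mem hp₀
  have hd0 : sgnDist E p₀ = 0 := (sgnDist_eq_zero_iff ⟨p₀, hp₀⟩).2 hp₀
  have hC := ht.contDiffAt p₀ h0
  have hd : HasStrictFDerivAt (sgnDist E)
      (InnerProductSpace.toDual ℝ R3 (∇ (sgnDist E) p₀)) p₀ := by
    rw [toDual_gradient]
    exact hC.hasStrictFDerivAt two_ne_zero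
  have hn : HasStrictFDerivAt (∇ (sgnDist E)) (hessian (sgnDist E) p₀) p₀ :=
    (hC.gradient (m := 1) (by norm_num)).hasStrictFDerivAt one_ne_zero
  have hf : HasStrictFDerivAt (foot E) _ p₀ := (hasStrictFDerivAt_id p₀).sub (hd.smul hn)
  have hi : HasStrictFDerivAt (fun x => inner ℝ (∇ (sgnDist E) p₀) (foot E x - p₀)) _ p₀ :=
    (innerSL ℝ (∇ (sgnDist E) p₀)).hasStrictFDerivAt.comp p₀ (hf.sub_const p₀)
  have hS : HasStrictFDerivAt (straighten E p₀) _ p₀ :=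
    (hf.sub (hi.smul_const (∇ (sgnDist E) p₀))).add (hd.smul_const (∇ (sgnDist E) p₀))
  refine hS.congr_fderiv ?_
  have hnn : inner ℝ (∇ (sgnDist E) p₀) (∇ (sgnDist E) p₀) = (1 : ℝ) := by
    rw [real_inner_self_eq_norm_sq, ht.norm_gradient p₀ h0, one_pow]
  refine ContinuousLinearMap.ext fun h => ?_
  simp only [add_apply, sub_apply, ContinuousLinearMap.id_apply,
    ContinuousLinearMap.smulRight_apply, ContinuousLinearMap.comp_apply, innerSL_apply_apply,
    InnerProductSpace.toDual_apply_apply, hd0, zero_smul, zero_add, inner_sub_right,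
    inner_smul_right, hnn, mul_one, sub_self, sub_zero, sub_add_cancel]

/-- Motion along the varying normals becomes translation along one fixed vector, so slices at
different distances are carried to translates. -/
theorem straighten_normalMap (ht : IsTube E r) (p₀ : R3) {p : R3} (hp : p ∈ frontier E) {t : ℝ}
    (h : |t| < r) : straighten E p₀ (normalMap E (p, t)) =
      t • ∇ (sgnDist E) p₀ + straighten E p₀ p := by
  have h1 := ht.foot_normalMap hp (t := 0) (by simpa using ht.pos)
  have h2 : normalMap E (p, 0) = p := by simp [normalMap]
  rw [h2] at h1
  rw [straighten, straighten, ht.foot_normalMap hp h, ht.sgnDist_normalMap hp h, h1,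
    (sgnDist_eq_zero_iff ⟨p, hp⟩).2 hp, zero_smul, add_zero, add_comm]

/-- Level sets of the signed distance become parallel planes, to which slicing of volume applies;
the subtracted normal component in `straighten` serves this purpose. -/
theorem inner_straighten (ht : IsTube E r) {p₀ : R3} (hp₀ : p₀ ∈ frontier E) (x : R3) :
    inner ℝ (∇ (sgnDist E) p₀) (straighten E p₀ x - p₀) = sgnDist E x := by
  have hnn : inner ℝ (∇ (sgnDist E) p₀) (∇ (sgnDist E) p₀) = (1 : ℝ) := by
    rw [real_inner_self_eq_norm_sq, ht.norm_gradient p₀ (ht.abs_lt_of_mem hp₀), one_pow]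
  rw [straighten, add_sub_right_comm, sub_right_comm, inner_add_right, inner_sub_right,
    inner_smul_right, inner_smul_right, hnn]
  ring

/-- Near a boundary point, the volume of a set and the integral of the areas of its slices,
projected to the boundary along the normals, are almost the same. -/
theorem exists_patch (ht : IsTube E r) {p₀ : R3} (hp₀ : p₀ ∈ frontier E) {K : ℝ≥0} (hK : 1 < K) :
    ∃ U, IsOpen U ∧ p₀ ∈ U ∧ ∀ B ⊆ U, MeasurableSet B →
      volume B ≤ (K : ℝ≥0∞) ^ 5 * ∫⁻ t in Set.Ioo (-r) r,
        (μHE[2] : Measure R3) {p | p ∈ frontier E ∧ normalMap E (p, t) ∈ B} ∧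
      ∫⁻ t in Set.Ioo (-r) r, (μHE[2] : Measure R3) {p | p ∈ frontier E ∧ normalMap E (p, t) ∈ B} ≤
        (K : ℝ≥0∞) ^ 5 * volume B := by
  set e := ∇ (sgnDist E) p₀ with he
  have hen : ‖e‖ = 1 := ht.norm_gradient p₀ (ht.abs_lt_of_mem hp₀)
  have he0 : e ≠ 0 := fun h => by simp [h] at hen
  obtain ⟨V, hV, hVL, hVA⟩ := (ht.hasStrictFDerivAt_straighten hp₀).exists_biLipschitz hK
  have hfoot : foot E p₀ = p₀ := by
    rw [foot, (sgnDist_eq_zero_iff ⟨p₀, hp₀⟩).2 hp₀, zero_smul, sub_zero]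
  have hfV : foot E ⁻¹' V ∈ 𝓝 p₀ := by
    refine (ht.continuousAt_foot (ht.abs_lt_of_mem hp₀)).preimage_mem_nhds ?_
    rwa [hfoot]
  have hr : {x | |sgnDist E x| < r} ∈ 𝓝 p₀ := ht.eventually_abs_lt (ht.abs_lt_of_mem hp₀)
  obtain ⟨U, hU, hUo, hpU⟩ := mem_nhds_iff.1 (inter_mem (inter_mem hV hfV) hr)
  refine ⟨U, hUo, hpU, fun B hB hBm => ?_⟩
  have hBV : B ⊆ V := fun x hx => (hU (hB hx)).1.1
  have hBr : ∀ x ∈ B, |sgnDist E x| < r := fun x hx => (hU (hB hx)).2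
  set S := straighten E p₀ with hS
  have hinj : Set.InjOn S B := fun x hx y hy hxy => by
    have := hVA x (hBV hx) y (hBV hy)
    rwa [hxy, edist_self, mul_zero, nonpos_iff_eq_zero, edist_eq_zero] at this
  have hSm : MeasurableSet (S '' B) :=
    hBm.image_of_continuousOn_injOn (hVL.continuousOn.mono hBV) hinj
  have hvol : ∀ A : Set R3, (μHE[3] : Measure R3) A = volume A := fun A => by
    rw [EuclideanSpace.euclideanHausdorffMeasure_eq_volume]
  set A : ℝ → Set R3 := fun t => {p | p ∈ frontier E ∧ normalMap E (p, t) ∈ B} with hA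
  have hslice : ∀ t, S '' B ∩ AffineSubspace.mk' (t • e +ᵥ p₀) (ℝ ∙ e)ᗮ =
      S '' (B ∩ {x | sgnDist E x = t}) := by
    intro t
    have : ∀ x, S x ∈ (AffineSubspace.mk' (t • e +ᵥ p₀) (ℝ ∙ e)ᗮ : Set R3) ↔
        sgnDist E x = t := by
      intro x
      rw [SetLike.mem_coe, AffineSubspace.mem_mk', Submodule.mem_orthogonal_singleton_iff_inner_right,
        vsub_eq_sub, vadd_eq_add, add_comm, sub_add_eq_sub_sub, inner_sub_right,
        ht.inner_straighten hp₀, inner_smul_right, real_inner_self_eq_norm_sq, hen, one_pow,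
        mul_one, sub_eq_zero]
    ext y
    constructor
    · rintro ⟨⟨x, hx, rfl⟩, hy⟩
      exact ⟨x, ⟨hx, (this x).1 hy⟩, rfl⟩
    · rintro ⟨x, ⟨hx, hxt⟩, rfl⟩
      exact ⟨⟨x, hx, rfl⟩, (this x).2 hxt⟩
  have hslice' : ∀ t ∈ Set.Ioo (-r) r, S '' (B ∩ {x | sgnDist E x = t}) =
      (fun y => t • e + y) '' (S '' A t) := by
    intro t htr
    have htr' : |t| < r := abs_lt.2 htr
    ext y
    constructor
    · rintro ⟨x, ⟨hx, rfl⟩, rfl⟩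
      have h1 := ht.normalMap_foot (hBr x hx)
      have h2 : foot E x ∈ frontier E := ht.foot_mem x (hBr x hx)
      refine ⟨_, ⟨foot E x, ⟨h2, ?_⟩, rfl⟩, ?_⟩
      · rwa [h1]
      · simp only
        rw [hS, he, ← ht.straighten_normalMap p₀ h2 (hBr x hx), h1]
    · rintro ⟨_, ⟨p, ⟨hp, hpB⟩, rfl⟩, rfl⟩
      exact ⟨_, ⟨hpB, ht.sgnDist_normalMap hp htr'⟩, ht.straighten_normalMap p₀ hp htr'⟩
  have harea : ∀ t ∈ Set.Ioo (-r) r, (μHE[2] : Measure R3)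
      (S '' B ∩ AffineSubspace.mk' (t • e +ᵥ p₀) (ℝ ∙ e)ᗮ) = (μHE[2] : Measure R3) (S '' A t) := by
    intro t htr
    rw [hslice, hslice' t htr]
    exact (IsometryEquiv.addLeft (t • e)).isometry.euclideanHausdorffMeasure_image _
  have hzero : ∀ t ∉ Set.Ioo (-r) r, (μHE[2] : Measure R3)
      (S '' B ∩ AffineSubspace.mk' (t • e +ᵥ p₀) (ℝ ∙ e)ᗮ) = 0 := by
    intro t htr
    rw [hslice]
    have : B ∩ {x | sgnDist E x = t} = ∅ := by
      refine Set.eq_empty_iff_forall_notMem.2 fun x hx => htr ?_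
      have := hBr x hx.1
      rw [hx.2] at this
      exact abs_lt.1 this
    rw [this, Set.image_empty, measure_empty]
  -- Slicing of the straightened set by the planes orthogonal to the unit vector `e`.
  have hint : volume (S '' B) = ∫⁻ t in Set.Ioo (-r) r, (μHE[2] : Measure R3) (S '' A t) := by
    have h1 := EuclideanGeometry.euclideanHausdorffMeasure_eq_lintegral p₀ he0 hSm
    rw [finrank_euclideanSpace_fin, hvol] at h1
    rw [h1, ← ofReal_norm, hen, ENNReal.ofReal_one, one_mul, ← lintegral_indicator measurableSet_Ioo]
    refine lintegral_congr fun t => ?_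
    by_cases htr : t ∈ Set.Ioo (-r) r
    · rw [Set.indicator_of_mem htr]
      exact harea t htr
    · rw [Set.indicator_of_notMem htr]
      exact hzero t htr
  have hAV : ∀ t ∈ Set.Ioo (-r) r, A t ⊆ V := by
    rintro t htr p ⟨hp, hpB⟩
    have := (hU (hB hpB)).1.2
    rwa [Set.mem_preimage, ht.foot_normalMap hp (abs_lt.2 htr)] at this
  -- Three factors `K` come from the distortion of volume and two from that of the area of the
  -- slices.
  have hK5 : (K : ℝ≥0∞) ^ 5 = (K : ℝ≥0∞) ^ 3 * (K : ℝ≥0∞) ^ 2 := by ring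
  have hK5' : (K : ℝ≥0∞) ^ 5 = (K : ℝ≥0∞) ^ 2 * (K : ℝ≥0∞) ^ 3 := by ring
  have hKt : (K : ℝ≥0∞) ^ 2 ≠ ⊤ := by simp
  constructor
  · rw [hK5, mul_assoc]
    calc volume B ≤ (K : ℝ≥0∞) ^ 3 * volume (S '' B) := by
          rw [← hvol, ← hvol]
          exact euclideanHausdorffMeasure_le_image
            (fun x hx y hy => hVA x (hBV hx) y (hBV hy)) 3
      _ ≤ _ := by
          gcongr
          rw [hint, ← lintegral_const_mul' _ _ hKt]
          refine setLIntegral_mono' measurableSet_Ioo fun t htr => ?_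
          exact (hVL.mono (hAV t htr)).euclideanHausdorffMeasure_image_le 2
  · rw [hK5', mul_assoc]
    calc _ ≤ (K : ℝ≥0∞) ^ 2 * volume (S '' B) := by
          rw [hint, ← lintegral_const_mul' _ _ hKt]
          refine setLIntegral_mono' measurableSet_Ioo fun t htr => ?_
          exact euclideanHausdorffMeasure_le_image
            (fun x hx y hy => hVA x (hAV t htr hx) y (hAV t htr hy)) 2
      _ ≤ _ := by
          gcongr
          rw [← hvol, ← hvol]
          exact (hVL.mono hBV).euclideanHausdorffMeasure_image_le 3

/-- A small boundary patch, pushed by all small `t` along the normals, stays in a bounded set. Area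
times length is then bounded by a multiple of a finite volume. -/
theorem area_frontier_lt_top (ht : IsTube E r) (hK : IsCompact (frontier E)) :
    (μHE[2] : Measure R3) (frontier E) < ⊤ := by
  refine hK.measure_lt_top_of_nhdsWithin fun p₀ hp₀ => ?_
  obtain ⟨U, hUo, hpU, hU⟩ := ht.exists_patch hp₀ (K := 2) (by norm_num)
  set B := U ∩ Metric.ball p₀ 1 with hB
  have hBo : IsOpen B := hUo.inter Metric.isOpen_ball
  have hBv : volume B < ⊤ := (measure_mono Set.inter_subset_right).trans_lt measure_ball_lt_top
  have h1 := (hU B Set.inter_subset_left hBo.measurableSet).2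
  have h2 : ∀ᶠ q in 𝓝 (p₀, (0 : ℝ)), normalMap E q ∈ B := by
    refine (ht.continuousAt_normalMap hp₀ 0).eventually_mem (hBo.mem_nhds ?_)
    simp [normalMap, hB, hpU]
  rw [nhds_prod_eq] at h2
  obtain ⟨P, hP, Q, hQ, hPQ⟩ := eventually_prod_iff.1 h2
  obtain ⟨s, hs, hsQ⟩ := Metric.eventually_nhds_iff.1 hQ
  set s' := min s r with hs'
  have hs'0 : 0 < s' := lt_min hs ht.pos
  refine ⟨{p | P p} ∩ frontier E, ?_, ?_⟩
  · rw [Set.inter_comm]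
    exact inter_mem_nhdsWithin _ hP
  · have h3 : ∫⁻ _ in Set.Ioo (-s') s', (μHE[2] : Measure R3) ({p | P p} ∩ frontier E) ≤
        (2 : ℝ≥0) ^ 5 * volume B := by
      refine le_trans ?_ h1
      refine le_trans ?_ (lintegral_mono_set (s := Set.Ioo (-s') s') fun t ht' => ?_)
      · refine setLIntegral_mono' measurableSet_Ioo fun t ht' => measure_mono ?_
        rintro p ⟨hp, hpE⟩
        refine ⟨hpE, hPQ hp (hsQ ?_)⟩
        rw [Real.dist_eq, sub_zero]
        exact (abs_lt.2 ht').trans_le (min_le_left _ _)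
      · exact abs_lt.1 ((abs_lt.2 ht').trans_le (min_le_right _ _))
    rw [setLIntegral_const] at h3
    have h4 : volume (Set.Ioo (-s') s') ≠ 0 := by
      simp [Real.volume_Ioo, hs'0]
    have h5 : ((2 : ℝ≥0) : ℝ≥0∞) ^ 5 * volume B < ⊤ := ENNReal.mul_lt_top (by simp) hBv
    by_contra h
    rw [not_lt, top_le_iff] at h
    rw [h, ENNReal.top_mul h4, top_le_iff] at h3
    exact h5.ne h3

end IsTube

end Helfrich

end

/-! ### Integrals over thin layers converge to surface integrals. -/

noncomputable section

namespace Helfrich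

open scoped NNReal ENNReal

/-- If two measures agree up to a factor close to `1`, so do the integrals against them. -/
theorem abs_integral_sub_integral_le {X : Type*} [MeasurableSpace X] {μ ν : Measure X} {C : ℝ≥0}
    (h1 : μ ≤ C • ν) (h2 : ν ≤ C • μ) (hC : 1 ≤ C) {F : X → ℝ} (hF : Integrable F ν) :
    |∫ x, F x ∂μ - ∫ x, F x ∂ν| ≤ 3 * (C - 1) * ∫ x, |F x| ∂ν := by
  have hν : ∀ f : X → ℝ, Integrable f ν → Integrable f μ := fun f hf =>
    (hf.smul_measure (c := (C : ℝ≥0∞)) ENNReal.coe_ne_top).mono_measure h1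
  have hC' : (1 : ℝ) ≤ C := by exact_mod_cast hC
  have key : ∀ f : X → ℝ, (∀ x, 0 ≤ f x) → Integrable f ν →
      |∫ x, f x ∂μ - ∫ x, f x ∂ν| ≤ (C - 1) * ∫ x, f x ∂ν := by
    intro f hf0 hf
    have a1 : ∫ x, f x ∂μ ≤ C * ∫ x, f x ∂ν := by
      have := integral_mono_measure h1 (Eventually.of_forall hf0)
        (hf.smul_measure (c := (C : ℝ≥0∞)) ENNReal.coe_ne_top)
      rwa [integral_smul_nnreal_measure, NNReal.smul_def, smul_eq_mul] at this
    have a2 : ∫ x, f x ∂ν ≤ C * ∫ x, f x ∂μ := by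
      have := integral_mono_measure h2 (Eventually.of_forall hf0)
        ((hν f hf).smul_measure (c := (C : ℝ≥0∞)) ENNReal.coe_ne_top)
      rwa [integral_smul_nnreal_measure, NNReal.smul_def, smul_eq_mul] at this
    have b1 : 0 ≤ ∫ x, f x ∂μ := integral_nonneg hf0
    have b2 : 0 ≤ ∫ x, f x ∂ν := integral_nonneg hf0
    rw [abs_le]
    constructor
    · by_cases h : ∫ x, f x ∂μ ≤ ∫ x, f x ∂ν
      · nlinarith
      · nlinarith
    · nlinarith
  have hA : Integrable (fun x => |F x|) ν := hF.abs
  -- Write `F` as the difference of the non-negative functions `|F| + F` and `|F|`. Their integrals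
  -- are at most two and one times that of `|F|`, whence the factor `3`.
  have hS : Integrable (fun x => |F x| + F x) ν := hA.add hF
  have k1 := key _ (fun x => abs_nonneg (F x)) hA
  have k2 := key _ (fun x => by linarith [neg_abs_le (F x)]) hS
  rw [integral_add hA hF, integral_add (hν _ hA) (hν _ hF)] at k2
  have k3 : ∫ x, F x ∂ν ≤ ∫ x, |F x| ∂ν := integral_mono hF hA fun x => le_abs_self _
  rw [abs_le] at k1 k2 ⊢
  constructor <;> nlinarith

/-- The measure on a tube around the boundary of `E` given by the product of the area of the
boundary and the length of the normals. -/
def tubeMeasure (E : Set R3) (r : ℝ) : Measure R3 :=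
  (((μHE[2] : Measure R3).restrict (frontier E)).prod (volume.restrict (Set.Ioo (-r) r))).map
    (normalMap E)

namespace IsTube

variable {E : Set R3} {r : ℝ}

theorem mono (ht : IsTube E r) {s : ℝ} (hs : 0 < s) (hsr : s ≤ r) : IsTube E s where
  pos := hs
  contDiffAt x hx := ht.contDiffAt x (hx.trans_le hsr)
  norm_gradient x hx := ht.norm_gradient x (hx.trans_le hsr)
  foot_mem x hx := ht.foot_mem x (hx.trans_le hsr)
  gradient_foot x hx := ht.gradient_foot x (hx.trans_le hsr)
  sgnDist_normal p hp t h := ht.sgnDist_normal p hp t (h.trans_le hsr)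
  gradient_normal p hp t h := ht.gradient_normal p hp t (h.trans_le hsr)

theorem isFiniteMeasure (ht : IsTube E r) (hK : IsCompact (frontier E)) :
    IsFiniteMeasure ((μHE[2] : Measure R3).restrict (frontier E)) :=
  isFiniteMeasure_restrict.2 (ht.area_frontier_lt_top hK).ne

theorem tubeMeasure_apply (ht : IsTube E r) (hK : IsCompact (frontier E)) {B : Set R3}
    (hB : MeasurableSet B) : tubeMeasure E r B = ∫⁻ t in Set.Ioo (-r) r,
      (μHE[2] : Measure R3) {p | p ∈ frontier E ∧ normalMap E (p, t) ∈ B} := by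
  have := ht.isFiniteMeasure hK
  rw [tubeMeasure, Measure.map_apply (measurable_normalMap E) hB,
    Measure.prod_apply_symm (measurable_normalMap E hB)]
  refine lintegral_congr fun t => ?_
  rw [Measure.restrict_apply' isClosed_frontier.measurableSet, Set.inter_comm]
  rfl

/-- Compactness extends the patch estimate to a neighbourhood of the whole boundary: a set in a
union of two patches is cut into its part in the first one and the rest, and both estimates are
additive. -/
theorem exists_comparison (ht : IsTube E r) (hK : IsCompact (frontier E))
    (hne : (frontier E).Nonempty) {κ : ℝ≥0} (hκ : 1 < κ) :
    ∃ s > 0, volume.restrict {x | |sgnDist E x| < s} ≤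
        κ ^ 5 • (tubeMeasure E r).restrict {x | |sgnDist E x| < s} ∧
      (tubeMeasure E r).restrict {x | |sgnDist E x| < s} ≤
        κ ^ 5 • volume.restrict {x | |sgnDist E x| < s} := by
  set P := tubeMeasure E r with hP
  have hind : ∃ U, IsOpen U ∧ frontier E ⊆ U ∧ ∀ B ⊆ U, MeasurableSet B →
      volume B ≤ (κ : ℝ≥0∞) ^ 5 * P B ∧ P B ≤ (κ : ℝ≥0∞) ^ 5 * volume B := by
    refine hK.induction_on (p := fun s => ∃ U, IsOpen U ∧ s ⊆ U ∧ ∀ B ⊆ U, MeasurableSet B →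
      volume B ≤ (κ : ℝ≥0∞) ^ 5 * P B ∧ P B ≤ (κ : ℝ≥0∞) ^ 5 * volume B) ?_ ?_ ?_ ?_
    · refine ⟨∅, isOpen_empty, subset_rfl, fun B hB _ => ?_⟩
      rw [Set.subset_empty_iff.1 hB]
      simp
    · rintro s t hst ⟨U, hU, htU, h⟩
      exact ⟨U, hU, hst.trans htU, h⟩
    · rintro s t ⟨U, hU, hsU, h⟩ ⟨V, hV, htV, h'⟩
      refine ⟨U ∪ V, hU.union hV, Set.union_subset_union hsU htV, fun B hB hBm => ?_⟩
      have h1 := h (B ∩ U) Set.inter_subset_right (hBm.inter hU.measurableSet)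
      have h2 := h' (B \ U) (fun x hx => (hB hx.1).resolve_left hx.2)
        (hBm.diff hU.measurableSet)
      rw [← measure_inter_add_sdiff (μ := volume) B hU.measurableSet,
        ← measure_inter_add_sdiff (μ := P) B hU.measurableSet, mul_add, mul_add]
      exact ⟨add_le_add h1.1 h2.1, add_le_add h1.2 h2.2⟩
    · intro p hp
      obtain ⟨U, hU, hpU, h⟩ := ht.exists_patch hp hκ
      refine ⟨U, mem_nhdsWithin_of_mem_nhds (hU.mem_nhds hpU), U, hU, subset_rfl,
        fun B hB hBm => ?_⟩
      rw [hP, ht.tubeMeasure_apply hK hBm]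
      exact h B hB hBm
  obtain ⟨U, hU, hKU, h⟩ := hind
  obtain ⟨s, hs, hsU⟩ := exists_tube_subset hK hne hU hKU
  have hNm : MeasurableSet {x | |sgnDist E x| < s} :=
    (isOpen_lt (continuous_sgnDist E).abs continuous_const).measurableSet
  refine ⟨s, hs, Measure.le_iff.2 fun B hB => ?_, Measure.le_iff.2 fun B hB => ?_⟩
  · rw [Measure.smul_apply, Measure.restrict_apply hB, Measure.restrict_apply hB]
    have := (h (B ∩ {x | |sgnDist E x| < s}) (fun x hx => hsU x hx.2) (hB.inter hNm)).1
    simpa [ENNReal.smul_def] using this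
  · rw [Measure.smul_apply, Measure.restrict_apply hB, Measure.restrict_apply hB]
    have := (h (B ∩ {x | |sgnDist E x| < s}) (fun x hx => hsU x hx.2) (hB.inter hNm)).2
    simpa [ENNReal.smul_def] using this

end IsTube

/-- A family of kernels on the line that concentrates at `0` from the left, with total mass
converging to `c`. -/
structure IsLayerKernel (k : ℝ → ℝ → ℝ) (c : ℝ) : Prop where
  measurable : ∀ ε, Measurable (k ε)
  integrable : ∀ᶠ ε in 𝓝[>] 0, Integrable (k ε)
  bounded : ∃ C, ∀ᶠ ε in 𝓝[>] 0, ∫ t, |k ε t| ≤ C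
  tendsto : Tendsto (fun ε => ∫ t, k ε t) (𝓝[>] 0) (𝓝 c)
  support : ∀ ρ > 0, ∀ᶠ ε in 𝓝[>] 0, ∀ t, k ε t ≠ 0 → -ρ < t ∧ t < 0

theorem IsLayerKernel.setIntegral_eq {k : ℝ → ℝ → ℝ} {c : ℝ} (hk : IsLayerKernel k c) {r : ℝ}
    (hr : 0 < r) (h : ℝ → ℝ) :
    ∀ᶠ ε in 𝓝[>] 0, ∫ t in Set.Ioo (-r) r, k ε t * h t = ∫ t, k ε t * h t := by
  filter_upwards [hk.support r hr] with ε hε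
  refine setIntegral_eq_integral_of_forall_compl_eq_zero fun t ht => ?_
  by_contra h0
  obtain ⟨h1, h2⟩ := hε t (left_ne_zero_of_mul h0)
  exact ht ⟨h1, h2.trans hr⟩

/-- Kernels live on `t < 0`, so only the limit of `h` from the left matters. This lets `h` be an
indicator that jumps at a contact point. -/
theorem IsLayerKernel.tendsto_setIntegral {k : ℝ → ℝ → ℝ} {c : ℝ} (hk : IsLayerKernel k c) {r : ℝ}
    (hr : 0 < r) {h : ℝ → ℝ} {h₀ : ℝ} (hh : Tendsto h (𝓝[<] 0) (𝓝 h₀)) (hm : Measurable h) :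
    Tendsto (fun ε => ∫ t in Set.Ioo (-r) r, k ε t * h t) (𝓝[>] 0) (𝓝 (c * h₀)) := by
  refine Tendsto.congr' ((hk.setIntegral_eq hr h).mono fun ε hε => hε.symm) ?_
  obtain ⟨C, hC⟩ := hk.bounded
  have hC0 : 0 ≤ C := by
    obtain ⟨ε, hε⟩ := hC.exists
    exact (integral_nonneg fun t => abs_nonneg _).trans hε
  have h1 : Tendsto (fun ε => ∫ t, k ε t * (h t - h₀)) (𝓝[>] 0) (𝓝 0) := by
    rw [Metric.tendsto_nhds]
    intro η hη
    have hη' : 0 < η / (C + 1) := by positivity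
    have h2 : ∀ᶠ t in 𝓝[<] (0 : ℝ), |h t - h₀| < η / (C + 1) := by
      simpa [Real.dist_eq] using (Metric.tendsto_nhds.1 hh) _ hη'
    obtain ⟨a, ha, h2⟩ := mem_nhdsLT_iff_exists_Ioo_subset.1 h2
    filter_upwards [hk.support (-a) (by simpa using ha), hk.integrable, hC] with ε hε hi hCε
    rw [Real.dist_eq, sub_zero]
    have h3 : ∀ t, |k ε t * (h t - h₀)| ≤ η / (C + 1) * |k ε t| := by
      intro t
      by_cases h0 : k ε t = 0
      · simp [h0]
      · obtain ⟨h4, h5⟩ := hε t h0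
        rw [neg_neg] at h4
        rw [abs_mul, mul_comm]
        exact mul_le_mul_of_nonneg_right (h2 ⟨h4, h5⟩).le (abs_nonneg _)
    calc |∫ t, k ε t * (h t - h₀)| ≤ ∫ t, η / (C + 1) * |k ε t| := by
          rw [← Real.norm_eq_abs]
          exact norm_integral_le_of_norm_le (hi.abs.const_mul _) (Eventually.of_forall h3)
      _ = η / (C + 1) * ∫ t, |k ε t| := integral_const_mul _ _
      _ ≤ η / (C + 1) * C := by gcongr
      _ < η := by
          rw [div_mul_eq_mul_div, div_lt_iff₀ (by positivity)]
          nlinarith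
  have h2 : Tendsto (fun ε => (∫ t, k ε t * (h t - h₀)) + (∫ t, k ε t) * h₀) (𝓝[>] 0)
      (𝓝 (0 + c * h₀)) := h1.add (hk.tendsto.mul_const h₀)
  rw [zero_add] at h2
  refine h2.congr' ?_
  have h2' : ∀ᶠ t in 𝓝[<] (0 : ℝ), |h t - h₀| < 1 := by
    simpa [Real.dist_eq] using (Metric.tendsto_nhds.1 hh) _ one_pos
  obtain ⟨a, ha, h3⟩ := mem_nhdsLT_iff_exists_Ioo_subset.1 h2'
  filter_upwards [hk.integrable, hk.support (-a) (by simpa using ha)] with ε hi hε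
  have h4 : Integrable fun t => k ε t * (h t - h₀) := by
    refine hi.abs.mono' ((hk.measurable ε).mul (hm.sub_const _)).aestronglyMeasurable
      (Eventually.of_forall fun t => ?_)
    by_cases h0 : k ε t = 0
    · simp [h0]
    · obtain ⟨h5, h6⟩ := hε t h0
      rw [neg_neg] at h5
      rw [Real.norm_eq_abs, abs_mul]
      exact mul_le_of_le_one_right (abs_nonneg _) (h3 ⟨h5, h6⟩).le
  rw [← integral_mul_const, ← integral_add h4 (hi.mul_const _)]
  refine integral_congr_ae (Eventually.of_forall fun t => ?_)
  ring

/-- Integrals over thin layers on the outer side of the boundary of `E` converge to integrals over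
the boundary. -/
theorem IsTube.tendsto_layer {E Ω : Set R3} {r : ℝ} (ht : IsTube E r)
    (hK : IsCompact (frontier E)) (hne : (frontier E).Nonempty) (hΩ : MeasurableSet Ω)
    (hΩE : ∀ p ∈ frontier E, ∀ᶠ t in 𝓝[<] (0 : ℝ), (normalMap E (p, t) ∈ Ω ↔ p ∈ Ω))
    {k : ℝ → ℝ → ℝ} {c : ℝ} (hk : IsLayerKernel k c) {g : R3 → ℝ} (hg : Measurable g)
    (hgc : ∀ p ∈ frontier E, ContinuousAt g p) {M : ℝ}
    (hM : ∀ x, |sgnDist E x| < r → |g x| ≤ M) :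
    (∀ᶠ ε in 𝓝[>] 0, IntegrableOn (fun x => k ε (sgnDist E x) * g x) Ω) ∧
    Tendsto (fun ε => ∫ x in Ω, k ε (sgnDist E x) * g x) (𝓝[>] 0)
      (𝓝 (c * ∫ p in Ω ∩ frontier E, g p ∂(μHE[2] : Measure R3))) := by
  have hfin := ht.isFiniteMeasure hK
  set μ := (μHE[2] : Measure R3).restrict (frontier E) with hμ
  set L := volume.restrict (Set.Ioo (-r) r) with hL
  set d := sgnDist E with hd
  obtain ⟨C, hC⟩ := hk.bounded
  have hM0 : 0 ≤ M := by
    obtain ⟨p, hp⟩ := hne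
    exact (abs_nonneg _).trans (hM p (ht.abs_lt_of_mem hp))
  let F : ℝ → R3 → ℝ := fun ε => Ω.indicator fun x => k ε (d x) * g x
  have hFm : ∀ ε, Measurable (F ε) := fun ε =>
    (((hk.measurable ε).comp (continuous_sgnDist E).measurable).mul hg).indicator hΩ
  have hq : ∀ᵐ q ∂(μ.prod L), q.1 ∈ frontier E ∧ |q.2| < r := by
    have h1 : ∀ᵐ p ∂μ, p ∈ frontier E := ae_restrict_mem isClosed_frontier.measurableSet
    have h2 : ∀ᵐ t ∂L, |t| < r := by
      filter_upwards [ae_restrict_mem measurableSet_Ioo] with t ht using abs_lt.2 ht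
    have h3 := (Measure.quasiMeasurePreserving_fst (μ := μ) (ν := L)).ae h1
    have h4 := (Measure.quasiMeasurePreserving_snd (μ := μ) (ν := L)).ae h2
    exact h3.and h4
  -- The bound does not depend on `p`: it gives integrability on the product and the dominating
  -- constant `M * C` after integration in `t`.
  have hbound : ∀ ε p t, p ∈ frontier E → |t| < r →
      |F ε (normalMap E (p, t))| ≤ M * |k ε t| := by
    intro ε p t hp htr
    have h1 : d (normalMap E (p, t)) = t := ht.sgnDist_normalMap hp htr
    by_cases hx : normalMap E (p, t) ∈ Ω
    · simp only [F, Set.indicator_of_mem hx, h1, abs_mul]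
      rw [mul_comm]
      exact mul_le_mul_of_nonneg_right (hM _ (by rw [h1]; exact htr)) (abs_nonneg _)
    · simp only [F, Set.indicator_of_notMem hx, abs_zero]
      positivity
  have hFi : ∀ᶠ ε in 𝓝[>] 0, Integrable (fun q => F ε (normalMap E q)) (μ.prod L) := by
    filter_upwards [hk.integrable] with ε hi
    have h1 : Integrable (fun q : R3 × ℝ => M * |k ε q.2|) (μ.prod L) :=
      (integrable_const M).mul_prod (hi.abs.restrict (s := Set.Ioo (-r) r))
    refine h1.mono' ((hFm ε).comp (measurable_normalMap E)).aestronglyMeasurable ?_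
    filter_upwards [hq] with q hq using hbound ε q.1 q.2 hq.1 hq.2
  have hFP : ∀ᶠ ε in 𝓝[>] 0, Integrable (F ε) (tubeMeasure E r) := by
    filter_upwards [hFi] with ε hi
    exact (integrable_map_measure (hFm ε).aestronglyMeasurable
      (measurable_normalMap E).aemeasurable).2 hi
  have hFabs : ∀ᶠ ε in 𝓝[>] 0, ∫ x, |F ε x| ∂(tubeMeasure E r) ≤ μ.real Set.univ * (M * C) := by
    filter_upwards [hFi, hk.integrable, hC] with ε hi hki hCε
    rw [tubeMeasure, integral_map (measurable_normalMap E).aemeasurable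
      (hFm ε).abs.aestronglyMeasurable]
    have h1 : Integrable (fun q : R3 × ℝ => (1 : ℝ) * (M * |k ε q.2|)) (μ.prod L) :=
      (integrable_const (1 : ℝ)).mul_prod ((hki.abs.const_mul M).restrict (s := Set.Ioo (-r) r))
    have h2 : ∫ q, |F ε (normalMap E q)| ∂(μ.prod L) ≤
        ∫ q : R3 × ℝ, (1 : ℝ) * (M * |k ε q.2|) ∂(μ.prod L) := by
      refine integral_mono_ae hi.abs h1 ?_
      filter_upwards [hq] with q hq
      rw [one_mul]
      exact hbound ε q.1 q.2 hq.1 hq.2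
    refine h2.trans ?_
    rw [integral_prod_mul (fun _ : R3 => (1 : ℝ)) (fun t => M * |k ε t|), integral_const,
      smul_eq_mul, mul_one, integral_const_mul]
    gcongr
    exact (setIntegral_le_integral hki.abs (Eventually.of_forall fun t => abs_nonneg _)).trans hCε
  have hlim : Tendsto (fun ε => ∫ x, F ε x ∂(tubeMeasure E r)) (𝓝[>] 0)
      (𝓝 (c * ∫ p in Ω ∩ frontier E, g p ∂(μHE[2] : Measure R3))) := by
    have h1 : ∀ᶠ ε in 𝓝[>] 0, ∫ x, F ε x ∂(tubeMeasure E r) =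
        ∫ p, (∫ t, F ε (normalMap E (p, t)) ∂L) ∂μ := by
      filter_upwards [hFi] with ε hi
      rw [tubeMeasure, integral_map (measurable_normalMap E).aemeasurable
        (hFm ε).aestronglyMeasurable]
      exact integral_prod _ hi
    refine Tendsto.congr' (h1.mono fun ε h => h.symm) ?_
    have h2 : c * ∫ p in Ω ∩ frontier E, g p ∂(μHE[2] : Measure R3) =
        ∫ p, c * Ω.indicator g p ∂μ := by
      rw [integral_const_mul, integral_indicator hΩ, hμ, Measure.restrict_restrict hΩ]
    rw [h2]
    refine tendsto_integral_filter_of_dominated_convergence (fun _ => M * C) ?_ ?_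
      (integrable_const _) ?_
    · filter_upwards [hFi] with ε hi using hi.aestronglyMeasurable.integral_prod_right'
    · filter_upwards [hk.integrable, hC] with ε hki hCε
      filter_upwards [ae_restrict_mem isClosed_frontier.measurableSet] with p hp
      calc ‖∫ t, F ε (normalMap E (p, t)) ∂L‖ ≤ ∫ t, M * |k ε t| ∂L := by
            refine norm_integral_le_of_norm_le (hki.abs.const_mul M).restrict ?_
            filter_upwards [ae_restrict_mem measurableSet_Ioo] with t htr
            exact hbound ε p t hp (abs_lt.2 htr)
        _ ≤ M * C := by
            rw [integral_const_mul]
            gcongr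
            exact (setIntegral_le_integral hki.abs
              (Eventually.of_forall fun t => abs_nonneg _)).trans hCε
    · filter_upwards [ae_restrict_mem isClosed_frontier.measurableSet] with p hp
      have hcont : Tendsto (fun t : ℝ => normalMap E (p, t)) (𝓝[<] 0) (𝓝 p) := by
        have : Continuous fun t : ℝ => normalMap E (p, t) := by
          change Continuous fun t : ℝ => p + t • ∇ (sgnDist E) p
          exact continuous_const.add (continuous_id.smul continuous_const)
        have := this.tendsto 0
        simp only [normalMap, zero_smul, add_zero] at this
        exact this.mono_left nhdsWithin_le_nhds
      have hm : Measurable fun t : ℝ => normalMap E (p, t) :=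
        (measurable_normalMap E).comp measurable_prodMk_left
      -- At `p ∉ Ω` the hypothesis `hΩE` makes the indicator vanish along the outer normal, so the
      -- limit there is `0` and contact points drop out.
      have h3 : Tendsto (fun t : ℝ => Ω.indicator g (normalMap E (p, t))) (𝓝[<] 0)
          (𝓝 (Ω.indicator g p)) := by
        by_cases hpΩ : p ∈ Ω
        · rw [Set.indicator_of_mem hpΩ]
          refine Tendsto.congr' ?_ ((hgc p hp).tendsto.comp hcont)
          filter_upwards [hΩE p hp] with t h
          rw [Set.indicator_of_mem (h.2 hpΩ), Function.comp_apply]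
        · rw [Set.indicator_of_notMem hpΩ]
          refine Tendsto.congr' ?_ tendsto_const_nhds
          filter_upwards [hΩE p hp] with t h
          rw [Set.indicator_of_notMem (fun h' => hpΩ (h.1 h'))]
      refine (hk.tendsto_setIntegral ht.pos h3 ((hg.indicator hΩ).comp hm)).congr fun ε => ?_
      refine setIntegral_congr_fun measurableSet_Ioo fun t htr => ?_
      have h4 : d (normalMap E (p, t)) = t := ht.sgnDist_normalMap hp (abs_lt.2 htr)
      by_cases hx : normalMap E (p, t) ∈ Ω
      · simp only [F, Set.indicator_of_mem hx, h4]
      · simp only [F, Set.indicator_of_notMem hx, mul_zero]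
  -- For small `ε` the integrand is supported in the narrow tube where volume and `tubeMeasure`
  -- agree up to `κ ^ 5`.
  have hcomp : ∀ κ : ℝ≥0, 1 < κ → ∀ᶠ ε in 𝓝[>] 0, Integrable (F ε) ∧
      |(∫ x, F ε x) - ∫ x, F ε x ∂(tubeMeasure E r)| ≤
        3 * ((κ : ℝ) ^ 5 - 1) * (μ.real Set.univ * (M * C)) := by
    intro κ hκ
    obtain ⟨s, hs, h1, h2⟩ := ht.exists_comparison hK hne hκ
    have hκ1 : 1 ≤ κ ^ 5 := one_le_pow₀ hκ.le
    filter_upwards [hFP, hFabs, hk.support s hs] with ε hi hab hsupp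
    have hzero : ∀ x, x ∉ {x | |sgnDist E x| < s} → F ε x = 0 := by
      intro x hx
      by_contra h0
      have h3 : k ε (d x) ≠ 0 := by
        intro h
        apply h0
        change Ω.indicator (fun x => k ε (d x) * g x) x = 0
        exact Set.indicator_apply_eq_zero.2 fun _ => by rw [h, zero_mul]
      obtain ⟨h4, h5⟩ := hsupp _ h3
      exact hx (abs_lt.2 ⟨h4, h5.trans hs⟩)
    have hi' : Integrable (F ε) (volume.restrict {x | |sgnDist E x| < s}) :=
      ((hi.restrict).smul_measure (c := ((κ ^ 5 : ℝ≥0) : ℝ≥0∞))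
        ENNReal.coe_ne_top).mono_measure h1
    have hsub : Function.support (F ε) ⊆ {x | |sgnDist E x| < s} := fun x hx => by
      by_contra h
      exact hx (hzero x h)
    refine ⟨(integrableOn_iff_integrable_of_support_subset hsub).1 hi', ?_⟩
    have h3 := abs_integral_sub_integral_le h1 h2 hκ1 hi.restrict
    rw [setIntegral_eq_integral_of_forall_compl_eq_zero hzero,
      setIntegral_eq_integral_of_forall_compl_eq_zero hzero,
      setIntegral_eq_integral_of_forall_compl_eq_zero (fun x hx => by rw [hzero x hx, abs_zero])]
      at h3
    refine h3.trans ?_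
    push_cast
    have : (0 : ℝ) ≤ 3 * ((κ : ℝ) ^ 5 - 1) := by
      have : (1 : ℝ) ≤ (κ : ℝ) ^ 5 := by exact_mod_cast hκ1
      linarith
    exact mul_le_mul_of_nonneg_left hab this
  constructor
  · filter_upwards [hcomp 2 (by norm_num)] with ε h
    exact (integrable_indicator_iff hΩ).1 h.1
  · have h1 : ∀ ε, ∫ x in Ω, k ε (d x) * g x = ∫ x, F ε x := fun ε =>
      (integral_indicator hΩ).symm
    simp only [h1]
    rw [Metric.tendsto_nhds] at hlim ⊢
    intro η hη
    -- The comparison error is not tied to `ε`; it is made small by taking `κ` close to `1`, before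
    -- `ε` tends to `0`.
    obtain ⟨κ, hκ, hκη⟩ : ∃ κ : ℝ≥0, 1 < κ ∧
        3 * ((κ : ℝ) ^ 5 - 1) * (μ.real Set.univ * (M * C)) < η / 2 := by
      have hcont : Continuous fun κ : ℝ≥0 =>
        3 * ((κ : ℝ) ^ 5 - 1) * (μ.real Set.univ * (M * C)) := by fun_prop
      have h2 : ∀ᶠ κ : ℝ≥0 in 𝓝[>] 1,
          3 * ((κ : ℝ) ^ 5 - 1) * (μ.real Set.univ * (M * C)) < η / 2 := by
        refine ((hcont.tendsto 1).eventually_lt_const ?_).filter_mono nhdsWithin_le_nhds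
        simpa using hη
      obtain ⟨κ, h3, h4⟩ := (h2.and self_mem_nhdsWithin).exists
      exact ⟨κ, h4, h3⟩
    filter_upwards [hcomp κ hκ, hlim (η / 2) (by positivity)] with ε h2 h3
    rw [Real.dist_eq] at h3 ⊢
    calc _ ≤ |(∫ x, F ε x) - ∫ x, F ε x ∂(tubeMeasure E r)| + _ := abs_sub_le _ _ _
      _ < η / 2 + η / 2 := add_lt_add (h2.2.trans_lt hκη) h3
      _ = η := by ring

end Helfrich

end

/-! ### Contact with the boundary of the container, and the profile. -/

noncomputable section

namespace Helfrich

/-- Just outside `E`, the normal at a boundary point `p` stays in `Ω` if `p ∈ Ω`, and leaves `Ω`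
if `p` is a contact point of the two boundaries. -/
theorem IsTube.eventually_normalMap_mem_iff {E Ω : Set R3} {r : ℝ} (ht : IsTube E r)
    (hEo : IsOpen E) (hΩo : IsOpen Ω) (hΩ : HasBoundaryOfClass ∞ Ω) (hsub : E ⊆ Ω) {p : R3}
    (hp : p ∈ frontier E) : ∀ᶠ t in 𝓝[<] (0 : ℝ), (normalMap E (p, t) ∈ Ω ↔ p ∈ Ω) := by
  have hcont : Tendsto (fun t : ℝ => normalMap E (p, t)) (𝓝[<] 0) (𝓝 p) := by
    have h1 : Continuous fun t : ℝ => p + t • ∇ (sgnDist E) p := by fun_prop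
    have := h1.tendsto 0
    simp only [zero_smul, add_zero] at this
    exact this.mono_left nhdsWithin_le_nhds
  by_cases hpΩ : p ∈ Ω
  · filter_upwards [hcont.eventually_mem (hΩo.mem_nhds hpΩ)] with t h
    exact iff_of_true h hpΩ
  · have hpf : p ∈ frontier Ω := by
      rw [hΩo.frontier_eq]
      exact ⟨closure_mono hsub (frontier_subset_closure hp), hpΩ⟩
    have hne : (frontier E).Nonempty := ⟨p, hp⟩
    obtain ⟨b, hb, hbg, hbΩ⟩ := hΩ.exists_contDiff (by simp) hpf
    have hbp : b p = 0 := hbΩ.self_of_nhds.2.1 hpf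
    have hd0 : sgnDist E p = 0 := (sgnDist_eq_zero_iff hne).2 hp
    have hloc := ht.isLocalDefiningFunction hEo hp
    have dd := (hloc.contDiffAt.differentiableAt two_ne_zero).hasGradientAt
    have db := (hb.differentiable (by simp) p).hasGradientAt
    -- `E ⊆ Ω` nests the positivity sets of the defining functions, so at a common zero the two
    -- normals point the same way.
    obtain ⟨c, hc0, hc⟩ := exists_gradient_eq_smul dd db hd0 hbp hloc.gradient_ne_zero
      (hbΩ.mono fun y hy h => hy.1.1 (hsub ((sgnDist_pos_iff hEo hne).1 h)))
    have hcpos : 0 < c := lt_of_le_of_ne hc0 fun h => hbg (by rw [hc, ← h, zero_smul])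
    -- The defining function `b` of `Ω` decreases at rate `c > 0` along the exterior normal of `E`,
    -- hence becomes negative.
    have h1 := (db.hasDerivAt_comp_line (-∇ (sgnDist E) p)).neg
    have h2 := eventually_pos_of_hasDerivAt_pos h1 (by simp [hbp]) (by
      rw [hc, inner_neg_right, neg_neg, inner_smul_left, real_inner_self_eq_norm_sq,
        ht.norm_gradient p (ht.abs_lt_of_mem hp)]
      simpa using hcpos)
    have h3 : Tendsto (fun t : ℝ => -t) (𝓝[<] 0) (𝓝[>] 0) := by
      have := tendsto_neg_nhdsLT (a := (0 : ℝ))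
      rwa [neg_zero] at this
    filter_upwards [h3.eventually h2, hcont.eventually hbΩ] with t h4 h5
    refine iff_of_false (fun h => ?_) hpΩ
    have h6 := h5.1.1 h
    simp only [Pi.neg_apply, smul_neg, neg_smul, neg_neg] at h4
    simp only [normalMap] at h6
    linarith

/-! ### The optimal profile and its truncation -/

/-- The optimal profile `tanh (s / √2)`. -/
def optimalProfile (s : ℝ) : ℝ := 1 - 2 / (1 + Real.exp (√2 * s))

theorem hasDerivAt_doubleWell (s : ℝ) : HasDerivAt doubleWell (s ^ 3 - s) s := by
  have h := ((((hasDerivAt_id s).pow 2).const_sub 1).pow 2).div_const 4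
  refine h.congr_deriv ?_
  simp
  ring

theorem deriv_doubleWell (s : ℝ) : deriv doubleWell s = s ^ 3 - s := (hasDerivAt_doubleWell s).deriv

theorem one_sub_optimalProfile (s : ℝ) : 1 - optimalProfile s = 2 / (1 + Real.exp (√2 * s)) := by
  simp [optimalProfile]

theorem optimalProfile_lt_one (s : ℝ) : optimalProfile s < 1 := by
  rw [← sub_pos, one_sub_optimalProfile]
  positivity

theorem optimalProfile_neg (s : ℝ) : optimalProfile (-s) = -optimalProfile s := by
  have := Real.exp_pos (√2 * s)
  rw [optimalProfile, optimalProfile, mul_neg, Real.exp_neg]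
  field_simp
  ring

theorem neg_one_lt_optimalProfile (s : ℝ) : -1 < optimalProfile s := by
  have := optimalProfile_lt_one (-s)
  rw [optimalProfile_neg] at this
  linarith

theorem one_sub_optimalProfile_le {s : ℝ} (hs : 0 ≤ s) :
    1 - optimalProfile s ≤ 2 * Real.exp (-s) := by
  rw [one_sub_optimalProfile, Real.exp_neg, ← div_eq_mul_inv]
  have h1 : (1 : ℝ) ≤ √2 := by
    rw [Real.one_le_sqrt]
    norm_num
  have h2 : Real.exp s ≤ 1 + Real.exp (√2 * s) := by
    have : Real.exp s ≤ Real.exp (√2 * s) := Real.exp_le_exp.2 (by nlinarith)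
    linarith
  gcongr

/-- The right-hand side is `√(2 W)` evaluated at the profile: equipartition of energy. -/
theorem hasDerivAt_optimalProfile (s : ℝ) :
    HasDerivAt optimalProfile ((1 - optimalProfile s ^ 2) / √2) s := by
  have h1 : HasDerivAt (fun s => 1 + Real.exp (√2 * s)) (Real.exp (√2 * s) * √2) s := by
    have := ((hasDerivAt_id s).const_mul √2).exp.const_add 1
    simpa using this
  have hpos : 1 + Real.exp (√2 * s) ≠ 0 := by positivity
  have h2 := ((hasDerivAt_const s (2 : ℝ)).div h1 hpos).const_sub 1
  refine h2.congr_deriv ?_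
  have h3 : √2 ≠ 0 := by positivity
  have h4 : √2 ^ 2 = 2 := Real.sq_sqrt (by norm_num)
  rw [optimalProfile]
  field_simp
  linear_combination (2 * Real.exp (√2 * s)) * h4

theorem contDiff_optimalProfile : ContDiff ℝ 2 optimalProfile := by
  unfold optimalProfile
  refine contDiff_const.sub (contDiff_const.div ?_ fun s => by positivity)
  exact contDiff_const.add (contDiff_const.mul contDiff_id).exp

/-- This is the equation `q'' = W'(q)`, thanks to which the untruncated profile has no defect. -/
theorem hasDerivAt_deriv_optimalProfile (s : ℝ) :
    HasDerivAt (fun s => (1 - optimalProfile s ^ 2) / √2)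
      (optimalProfile s ^ 3 - optimalProfile s) s := by
  have h := (((hasDerivAt_optimalProfile s).pow 2).const_sub 1).div_const √2
  refine h.congr_deriv ?_
  have h3 : √2 ≠ 0 := by positivity
  have h4 : √2 ^ 2 = 2 := Real.sq_sqrt (by norm_num)
  field_simp
  rw [h4]
  simp
  ring

/-- The derivatives are continuous and supported in `[0, 1]`. -/
theorem exists_bound_smoothTransition : ∃ C, 0 ≤ C ∧ ∀ s, |deriv Real.smoothTransition s| ≤ C ∧
    |deriv (deriv Real.smoothTransition) s| ≤ C := by
  have hT : ContDiff ℝ 2 Real.smoothTransition := Real.smoothTransition.contDiff (n := 2)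
  have h1 : ContDiff ℝ 1 (deriv Real.smoothTransition) := by
    have := (contDiff_succ_iff_deriv (n := 1)).1 (by simpa [one_add_one_eq_two] using hT)
    exact this.2.2
  have hsupp : HasCompactSupport (deriv Real.smoothTransition) := by
    refine HasCompactSupport.intro (isCompact_Icc (a := (0 : ℝ)) (b := 1)) fun s hs => ?_
    rw [Set.mem_Icc, not_and_or, not_le, not_le] at hs
    rcases hs with hs | hs
    · have : Real.smoothTransition =ᶠ[𝓝 s] fun _ => 0 := by
        filter_upwards [Iio_mem_nhds hs] with y hy
        exact Real.smoothTransition.zero_of_nonpos (le_of_lt hy)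
      rw [this.deriv_eq, deriv_const]
    · have : Real.smoothTransition =ᶠ[𝓝 s] fun _ => 1 := by
        filter_upwards [Ioi_mem_nhds hs] with y hy
        exact Real.smoothTransition.one_of_one_le (le_of_lt hy)
      rw [this.deriv_eq, deriv_const]
  obtain ⟨C₁, hC₁⟩ := h1.continuous.bounded_above_of_compact_support hsupp
  obtain ⟨C₂, hC₂⟩ := (h1.continuous_deriv le_rfl).bounded_above_of_compact_support hsupp.deriv
  refine ⟨max C₁ C₂, ?_, fun s => ⟨(hC₁ s).trans (le_max_left _ _),
    (hC₂ s).trans (le_max_right _ _)⟩⟩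
  exact (norm_nonneg _).trans ((hC₁ 0).trans (le_max_left _ _))

/-- The optimal profile, modified so that it is constant where `|s| ≥ 2 R`. -/
def truncatedProfile (R s : ℝ) : ℝ :=
  optimalProfile s + Real.smoothTransition (s / R - 1) * (1 - optimalProfile s) -
    Real.smoothTransition (-s / R - 1) * (1 + optimalProfile s)

theorem contDiff_truncatedProfile (R : ℝ) : ContDiff ℝ 2 (truncatedProfile R) := by
  have hT : ContDiff ℝ 2 Real.smoothTransition := Real.smoothTransition.contDiff (n := 2)
  have hq := contDiff_optimalProfile
  refine (hq.add ((hT.comp ?_).mul (contDiff_const.sub hq))).sub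
    ((hT.comp ?_).mul (contDiff_const.add hq))
  · exact (contDiff_id.div_const R).sub contDiff_const
  · exact (contDiff_id.neg.div_const R).sub contDiff_const

theorem truncatedProfile_neg (R s : ℝ) : truncatedProfile R (-s) = -truncatedProfile R s := by
  rw [truncatedProfile, truncatedProfile, optimalProfile_neg, neg_neg]
  ring

/-- For `s ≥ -R` only the cutoff at `+∞` is active. Together with oddness in `s`, this formula
suffices everywhere. -/
theorem truncatedProfile_eq {R s : ℝ} (hR : 0 < R) (hs : -R ≤ s) :
    truncatedProfile R s =
      1 - (1 - Real.smoothTransition (s / R - 1)) * (1 - optimalProfile s) := by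
  have : Real.smoothTransition (-s / R - 1) = 0 := by
    refine Real.smoothTransition.zero_of_nonpos ?_
    rw [sub_nonpos, div_le_one hR]
    linarith
  rw [truncatedProfile, this]
  ring

theorem abs_truncatedProfile_le {R : ℝ} (hR : 0 < R) (s : ℝ) : |truncatedProfile R s| ≤ 1 := by
  wlog hs : 0 ≤ s generalizing s
  · have := this (-s) (by linarith)
    rwa [truncatedProfile_neg, abs_neg] at this
  rw [truncatedProfile_eq hR (by linarith), abs_le]
  have h1 := Real.smoothTransition.nonneg (s / R - 1)
  have h2 := Real.smoothTransition.le_one (s / R - 1)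
  have h3 := optimalProfile_lt_one s
  have h4 := neg_one_lt_optimalProfile s
  constructor <;> nlinarith

theorem truncatedProfile_of_le {R s : ℝ} (hR : 0 < R) (hs : 2 * R ≤ s) :
    truncatedProfile R s = 1 := by
  rw [truncatedProfile_eq hR (by linarith), Real.smoothTransition.one_of_one_le]
  · ring
  · rw [le_sub_iff_add_le, le_div_iff₀ hR]
    linarith

theorem truncatedProfile_of_le_neg {R s : ℝ} (hR : 0 < R) (hs : s ≤ -(2 * R)) :
    truncatedProfile R s = -1 := by
  have := truncatedProfile_of_le hR (s := -s) (by linarith)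
  rw [truncatedProfile_neg] at this
  linarith

theorem truncatedProfile_eq_optimalProfile {R s : ℝ} (hR : 0 < R) (hs : |s| ≤ R) :
    truncatedProfile R s = optimalProfile s := by
  rw [abs_le] at hs
  rw [truncatedProfile_eq hR hs.1, Real.smoothTransition.zero_of_nonpos]
  · ring
  · rw [sub_nonpos, div_le_one hR]
    exact hs.2

theorem hasDerivAt_truncatedProfile {R s : ℝ} (hR : 0 < R) (hs : -R < s) :
    HasDerivAt (truncatedProfile R)
      ((1 - Real.smoothTransition (s / R - 1)) * ((1 - optimalProfile s ^ 2) / √2) +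
        deriv Real.smoothTransition (s / R - 1) / R * (1 - optimalProfile s)) s := by
  have hT : Differentiable ℝ Real.smoothTransition :=
    (Real.smoothTransition.contDiff (n := 1)).differentiable (by simp)
  have h1 : HasDerivAt (fun s => s / R - 1) (1 / R) s := ((hasDerivAt_id s).div_const R).sub_const 1
  have h2 := (hT _).hasDerivAt.comp s h1
  have h3 := ((h2.const_sub 1).mul ((hasDerivAt_optimalProfile s).const_sub 1)).const_sub 1
  refine (h3.congr_of_eventuallyEq ?_).congr_deriv ?_
  · filter_upwards [Ioi_mem_nhds hs] with y hy
    exact truncatedProfile_eq hR (le_of_lt hy)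
  · simp only [Function.comp_apply]
    ring

theorem hasDerivAt_deriv_truncatedProfile {R s : ℝ} (hR : 0 < R) (hs : -R < s) :
    HasDerivAt (deriv (truncatedProfile R))
      ((1 - Real.smoothTransition (s / R - 1)) * (optimalProfile s ^ 3 - optimalProfile s) -
        2 * (deriv Real.smoothTransition (s / R - 1) / R) * ((1 - optimalProfile s ^ 2) / √2) +
        deriv (deriv Real.smoothTransition) (s / R - 1) / R ^ 2 * (1 - optimalProfile s)) s := by
  have hTC : ContDiff ℝ 2 Real.smoothTransition := Real.smoothTransition.contDiff (n := 2)
  have hT : Differentiable ℝ Real.smoothTransition := hTC.differentiable two_ne_zero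
  have hT' : Differentiable ℝ (deriv Real.smoothTransition) := by
    have := (contDiff_succ_iff_deriv (n := 1)).1 (by simpa [one_add_one_eq_two] using hTC)
    exact this.2.2.differentiable one_ne_zero
  have h1 : HasDerivAt (fun s => s / R - 1) (1 / R) s := ((hasDerivAt_id s).div_const R).sub_const 1
  have h2 := (hT _).hasDerivAt.comp s h1
  have h2' := (hT' _).hasDerivAt.comp s h1
  have h3 := ((h2.const_sub 1).mul (hasDerivAt_deriv_optimalProfile s)).add
    ((h2'.div_const R).mul ((hasDerivAt_optimalProfile s).const_sub 1))
  refine (h3.congr_of_eventuallyEq ?_).congr_deriv ?_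
  · filter_upwards [Ioi_mem_nhds hs] with y hy
    exact (hasDerivAt_truncatedProfile hR hy).deriv
  · simp only [Function.comp_apply]
    field_simp
    ring

/-- The defect of the truncated profile in the equation `p'' = W'(p)`. -/
def profileDefect (R s : ℝ) : ℝ :=
  deriv (deriv (truncatedProfile R)) s - deriv doubleWell (truncatedProfile R s)

theorem deriv_truncatedProfile_neg (R s : ℝ) :
    deriv (truncatedProfile R) (-s) = deriv (truncatedProfile R) s := by
  have h : (fun s => truncatedProfile R (-s)) = fun s => -truncatedProfile R s :=
    funext fun s => truncatedProfile_neg R s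
  have h1 := deriv_comp_neg (truncatedProfile R) s
  rw [h, deriv.fun_neg] at h1
  linarith

theorem profileDefect_neg (R s : ℝ) : profileDefect R (-s) = -profileDefect R s := by
  have h : (fun s => deriv (truncatedProfile R) (-s)) = deriv (truncatedProfile R) :=
    funext fun s => deriv_truncatedProfile_neg R s
  have h1 := deriv_comp_neg (deriv (truncatedProfile R)) s
  rw [h] at h1
  rw [profileDefect, profileDefect, truncatedProfile_neg, deriv_doubleWell, deriv_doubleWell, h1]
  ring

theorem deriv_truncatedProfile_of_lt {R s : ℝ} (hs : |s| < R) :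
    deriv (truncatedProfile R) s = (1 - optimalProfile s ^ 2) / √2 := by
  have hR : 0 < R := (abs_nonneg s).trans_lt hs
  have : truncatedProfile R =ᶠ[𝓝 s] optimalProfile := by
    filter_upwards [continuous_abs.continuousAt.eventually_lt_const hs] with y hy
    exact truncatedProfile_eq_optimalProfile hR hy.le
  rw [this.deriv_eq, (hasDerivAt_optimalProfile s).deriv]

theorem profileDefect_of_lt {R s : ℝ} (hs : |s| < R) : profileDefect R s = 0 := by
  have hR : 0 < R := (abs_nonneg s).trans_lt hs
  have : deriv (truncatedProfile R) =ᶠ[𝓝 s] fun s => (1 - optimalProfile s ^ 2) / √2 := by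
    filter_upwards [continuous_abs.continuousAt.eventually_lt_const hs] with y hy
    exact deriv_truncatedProfile_of_lt hy
  rw [profileDefect, this.deriv_eq, (hasDerivAt_deriv_optimalProfile s).deriv,
    truncatedProfile_eq_optimalProfile hR hs.le, deriv_doubleWell, sub_self]

/-- For `s ≥ 0` each quantity is at most a constant times `1 - q ≤ 2 exp (-s)`; `R ≥ 1` keeps the
derivatives of the cutoff bounded uniformly. -/
theorem exists_profile_bounds : ∃ C, 0 ≤ C ∧ ∀ R, 1 ≤ R → ∀ s,
    |deriv (truncatedProfile R) s| ≤ C * Real.exp (-|s|) ∧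
    |profileDefect R s| ≤ C * Real.exp (-|s|) ∧
    |doubleWell (truncatedProfile R s)| ≤ C * Real.exp (-|s|) := by
  obtain ⟨C, hC0, hC⟩ := exists_bound_smoothTransition
  -- The defect needs the largest constant: `2` for `q ^ 3 - q`, `4 C` and `C` for the two terms
  -- with derivatives of the cutoff, and `2` for `W'` of the truncated profile. The outer `2` comes
  -- from `1 - q ≤ 2 exp (-s)`.
  refine ⟨2 * (4 + 5 * C), by positivity, fun R hR1 s => ?_⟩
  wlog hs : 0 ≤ s generalizing s
  · have := this (-s) (by linarith)
    rwa [deriv_truncatedProfile_neg, profileDefect_neg, abs_neg, abs_neg, truncatedProfile_neg,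
      show doubleWell (-truncatedProfile R s) = doubleWell (truncatedProfile R s) by
        simp [doubleWell]] at this
  have hR : 0 < R := by linarith
  have hsR : -R < s := by linarith
  set q := optimalProfile s with hq
  set a := Real.smoothTransition (s / R - 1) with ha
  have h1 := Real.smoothTransition.nonneg (s / R - 1)
  have h2 := Real.smoothTransition.le_one (s / R - 1)
  have h3 := optimalProfile_lt_one s
  have h4 := neg_one_lt_optimalProfile s
  have hexp := one_sub_optimalProfile_le hs
  rw [← ha] at h1 h2
  rw [← hq] at h3 h4 hexp
  have hq0 : 0 ≤ 1 - q := by linarith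
  set b := deriv Real.smoothTransition (s / R - 1) / R with hb
  set c := deriv (deriv Real.smoothTransition) (s / R - 1) / R ^ 2 with hc
  have hbC : |b| ≤ C := by
    rw [hb, abs_div, abs_of_pos hR]
    exact (div_le_self (abs_nonneg _) hR1).trans (hC _).1
  have hcC : |c| ≤ C := by
    rw [hc, abs_div, abs_of_pos (show (0 : ℝ) < R ^ 2 by positivity)]
    exact (div_le_self (abs_nonneg _) (one_le_pow₀ hR1)).trans (hC _).2
  have hD : |(1 - q ^ 2) / √2| ≤ 2 * (1 - q) := by
    have h5 : (1 : ℝ) ≤ √2 := by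
      rw [Real.one_le_sqrt]
      norm_num
    have h6 : 0 ≤ 1 - q ^ 2 := by nlinarith
    rw [abs_div, abs_of_nonneg h6, abs_of_pos (by positivity)]
    refine (div_le_self h6 h5).trans ?_
    nlinarith
  have ha1 : |1 - a| ≤ 1 := by
    rw [abs_le]
    constructor <;> linarith
  -- From the factorization `y ^ 3 - y = -y (1 + y) (1 - y)`.
  have hcub : ∀ y : ℝ, |y| ≤ 1 → |y ^ 3 - y| ≤ 2 * (1 - y) := by
    intro y hy
    rw [abs_le] at hy ⊢
    constructor <;> nlinarith [mul_nonneg (sub_nonneg.2 hy.2) (by linarith : 0 ≤ 1 + y),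
      mul_nonneg (mul_nonneg (sub_nonneg.2 hy.2) (by linarith : 0 ≤ 1 + y))
        (by linarith : 0 ≤ 1 + y), sq_nonneg y,
      mul_nonneg (mul_nonneg (sub_nonneg.2 hy.2) (by linarith : 0 ≤ 1 + y))
        (by linarith : 0 ≤ 1 - y)]
  have hp1 := abs_truncatedProfile_le hR s
  have hp : 1 - truncatedProfile R s = (1 - a) * (1 - q) := by
    rw [truncatedProfile_eq hR hsR.le]
    ring
  have hpq : 1 - truncatedProfile R s ≤ 1 - q := by
    rw [hp]
    nlinarith
  have hp0 : 0 ≤ 1 - truncatedProfile R s := by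
    rw [hp]
    exact mul_nonneg (by linarith) hq0
  rw [abs_of_nonneg hs]
  have hfin : ∀ z, z ≤ (4 + 5 * C) * (1 - q) → z ≤ 2 * (4 + 5 * C) * Real.exp (-s) := by
    intro z hz
    refine hz.trans ?_
    nlinarith
  have m1 : ∀ x y : ℝ, |x| ≤ 1 → |y| ≤ 2 * (1 - q) → |x * y| ≤ 2 * (1 - q) := fun x y hx hy => by
    rw [abs_mul]
    nlinarith [abs_nonneg x, abs_nonneg y]
  have m2 : ∀ x : ℝ, |x| ≤ C → |x * (1 - q)| ≤ C * (1 - q) := fun x hx => by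
    rw [abs_mul, abs_of_nonneg hq0]
    exact mul_le_mul_of_nonneg_right hx hq0
  have hCq : 0 ≤ C * (1 - q) := mul_nonneg hC0 hq0
  refine ⟨hfin _ ?_, hfin _ ?_, hfin _ ?_⟩
  · rw [(hasDerivAt_truncatedProfile hR hsR).deriv]
    refine (abs_add_le _ _).trans ?_
    have := m1 _ _ ha1 hD
    have := m2 _ hbC
    linarith
  · rw [profileDefect, (hasDerivAt_deriv_truncatedProfile hR hsR).deriv, deriv_doubleWell]
    refine (abs_sub _ _).trans ?_
    have e1 := m1 _ _ ha1 (hcub q (abs_le.2 ⟨h4.le, h3.le⟩))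
    have e2 := m2 _ hcC
    have e3 : |2 * b * ((1 - q ^ 2) / √2)| ≤ 4 * (C * (1 - q)) := by
      rw [abs_mul, abs_mul, abs_two]
      nlinarith [abs_nonneg b, abs_nonneg ((1 - q ^ 2) / √2)]
    have e4 := hcub _ hp1
    have e5 := abs_add_le ((1 - a) * (q ^ 3 - q) - 2 * b * ((1 - q ^ 2) / √2)) (c * (1 - q))
    have e6 := abs_sub ((1 - a) * (q ^ 3 - q)) (2 * b * ((1 - q ^ 2) / √2))
    linarith
  · rw [doubleWell, abs_of_nonneg (by positivity)]
    set p := truncatedProfile R s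
    rw [abs_le] at hp1
    have e1 : (1 - p ^ 2) ^ 2 / 4 ≤ (1 - p) * 2 := by
      have : (1 - p ^ 2) ^ 2 = (1 - p) * ((1 - p) * (1 + p) ^ 2) := by ring
      rw [this]
      have : (1 - p) * (1 + p) ^ 2 ≤ 8 := by
        have : (1 + p) ^ 2 ≤ 4 := by nlinarith
        nlinarith
      nlinarith
    nlinarith

/-- Where the gradient of the recovery function vanishes inside the tube, the conventional value of
the unit normal is multiplied by `W'(u) = 0` and does no harm. -/
theorem deriv_doubleWell_eq_zero_of_deriv_eq_zero {R : ℝ} (hR : 0 < R) {s : ℝ}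
    (h : deriv (truncatedProfile R) s = 0) : deriv doubleWell (truncatedProfile R s) = 0 := by
  wlog hs : 0 ≤ s generalizing s
  · have := this (s := -s) (by rwa [deriv_truncatedProfile_neg]) (by linarith)
    rw [truncatedProfile_neg, deriv_doubleWell] at this
    rw [deriv_doubleWell]
    linarith
  have hsR : -R < s := by linarith
  rw [(hasDerivAt_truncatedProfile hR hsR).deriv] at h
  have h1 := Real.smoothTransition.le_one (s / R - 1)
  have h3 := optimalProfile_lt_one s
  have h4 := neg_one_lt_optimalProfile s
  have h5 : 0 ≤ deriv Real.smoothTransition (s / R - 1) := Real.smoothTransition.monotone.deriv_nonneg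
  have h6 : 0 < (1 - optimalProfile s ^ 2) / √2 := div_pos (by nlinarith) (by positivity)
  have h7 : 0 ≤ deriv Real.smoothTransition (s / R - 1) / R * (1 - optimalProfile s) :=
    mul_nonneg (div_nonneg h5 hR.le) (by linarith)
  -- The derivative is a sum of non-negative terms, and the first vanishes only when the cutoff has
  -- reached `1`.
  have h8 : 1 - Real.smoothTransition (s / R - 1) = 0 := by
    by_contra h9
    have : 0 < 1 - Real.smoothTransition (s / R - 1) :=
      lt_of_le_of_ne (by linarith) (Ne.symm h9)
    have := mul_pos this h6
    linarith
  rw [truncatedProfile_eq hR hsR.le, h8, deriv_doubleWell]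
  norm_num

end Helfrich

end

noncomputable section

namespace Helfrich

/-! ### Rescaled layer kernels -/

theorem integrable_exp_neg_abs : Integrable fun s : ℝ => Real.exp (-|s|) := by
  by_contra h
  -- A non-integrable function has integral `0` by convention, while this integral evaluates to `2`.
  have h1 := integral_undef h
  rw [integral_comp_abs (f := fun s => Real.exp (-s)), integral_exp_neg_Ioi_zero] at h1
  norm_num at h1

theorem eventually_nhdsGT_zero_pos : ∀ᶠ ε : ℝ in 𝓝[>] 0, 0 < ε := eventually_mem_nhdsWithin

theorem tendsto_sqrt_nhdsGT_zero : Tendsto Real.sqrt (𝓝[>] 0) (𝓝[>] 0) := by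
  refine tendsto_nhdsWithin_iff.2 ⟨?_, ?_⟩
  · have := Real.continuous_sqrt.tendsto (0 : ℝ)
    rw [Real.sqrt_zero] at this
    exact this.mono_left nhdsWithin_le_nhds
  · filter_upwards [eventually_nhdsGT_zero_pos] with ε hε
    exact Real.sqrt_pos.2 hε

theorem eventually_mul_sqrt_lt (c : ℝ) {ρ : ℝ} (hρ : 0 < ρ) :
    ∀ᶠ ε : ℝ in 𝓝[>] 0, c * √ε < ρ := by
  have := (tendsto_sqrt_nhdsGT_zero.mono_right nhdsWithin_le_nhds).const_mul c
  rw [mul_zero] at this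
  exact this.eventually_lt_const hρ

theorem tendsto_inv_sqrt_nhdsGT_zero :
    Tendsto (fun ε : ℝ => (√ε)⁻¹) (𝓝[>] 0) atTop :=
  tendsto_inv_nhdsGT_zero.comp tendsto_sqrt_nhdsGT_zero

/-- The argument of the profile at signed distance `t`: the profile is centred at signed distance
`-3√ε` and stretched by `1 / ε`. -/
def layerVar (ε t : ℝ) : ℝ := (t + 3 * √ε) / ε

/-- The profile is constant beyond `2 R = 2 / √ε`, which is distance `2 √ε` after rescaling. Centred
at `-3 √ε`, the layer runs from `-5 √ε` to `-√ε`. -/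
theorem two_mul_inv_sqrt_le_layerVar {ε t : ℝ} (hε : 0 < ε) (ht : -√ε ≤ t) :
    2 * (√ε)⁻¹ ≤ layerVar ε t := by
  have h : 0 < √ε := Real.sqrt_pos.2 hε
  have h2 : √ε * √ε = ε := Real.mul_self_sqrt hε.le
  rw [layerVar, le_div_iff₀ hε]
  have : 2 * (√ε)⁻¹ * ε = 2 * √ε := by
    nth_rw 2 [← h2]
    field_simp
  rw [this]
  linarith

theorem layerVar_le_neg {ε t : ℝ} (hε : 0 < ε) (ht : t ≤ -(5 * √ε)) :
    layerVar ε t ≤ -(2 * (√ε)⁻¹) := by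
  have h : 0 < √ε := Real.sqrt_pos.2 hε
  have h2 : √ε * √ε = ε := Real.mul_self_sqrt hε.le
  rw [layerVar, div_le_iff₀ hε]
  have : -(2 * (√ε)⁻¹) * ε = -(2 * √ε) := by
    nth_rw 2 [← h2]
    field_simp
  rw [this]
  linarith

theorem integral_inv_mul_comp_layerVar {ε : ℝ} (hε : 0 < ε) (f : ℝ → ℝ) :
    ∫ t, ε⁻¹ * f (layerVar ε t) = ∫ s, f s := by
  rw [integral_const_mul]
  simp only [layerVar]
  rw [integral_add_right_eq_self (fun t => f (t / ε)) (3 * √ε), Measure.integral_comp_div,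
    abs_of_pos hε, smul_eq_mul, inv_mul_cancel_left₀ hε.ne']

theorem integrable_comp_layerVar {ε : ℝ} (hε : 0 < ε) {f : ℝ → ℝ} (hf : Integrable f) :
    Integrable fun t => f (layerVar ε t) :=
  (hf.comp_div hε.ne').comp_add_right (3 * √ε)

/-- The change of variable `s = layerVar ε t` removes `ε⁻¹`, leaving dominated convergence in `s`
under one exponential; the support condition becomes concentration at `0` from the left. -/
theorem isLayerKernel_comp_layerVar {κ : ℝ → ℝ → ℝ} {κ₀ : ℝ → ℝ} {C : ℝ}
    (hm : ∀ ε, Measurable (κ ε))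
    (hb : ∀ᶠ ε in 𝓝[>] 0, ∀ s, |κ ε s| ≤ C * Real.exp (-|s|))
    (hs : ∀ᶠ ε in 𝓝[>] 0, ∀ s, 2 * (√ε)⁻¹ ≤ |s| → κ ε s = 0)
    (hl : ∀ s, Tendsto (fun ε => κ ε s) (𝓝[>] 0) (𝓝 (κ₀ s))) :
    IsLayerKernel (fun ε t => ε⁻¹ * κ ε (layerVar ε t)) (∫ s, κ₀ s) := by
  have hbi : Integrable fun s : ℝ => C * Real.exp (-|s|) := integrable_exp_neg_abs.const_mul C
  have hint : ∀ᶠ ε in 𝓝[>] 0, Integrable (κ ε) := by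
    filter_upwards [hb] with ε hε
    exact hbi.mono' (hm ε).aestronglyMeasurable (ae_of_all _ hε)
  refine ⟨fun ε => ?_, ?_, ⟨∫ s : ℝ, C * Real.exp (-|s|), ?_⟩, ?_, fun ρ hρ => ?_⟩
  · refine ((hm ε).comp ?_).const_mul _
    unfold layerVar
    fun_prop
  · filter_upwards [hint, eventually_nhdsGT_zero_pos] with ε h hε
    exact (integrable_comp_layerVar hε h).const_mul _
  · filter_upwards [hint, hb, eventually_nhdsGT_zero_pos] with ε h h1 hε
    simp_rw [abs_mul, abs_of_pos (inv_pos.2 hε)]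
    rw [integral_inv_mul_comp_layerVar hε fun s => |κ ε s|]
    exact integral_mono h.abs hbi h1
  · have h1 : Tendsto (fun ε => ∫ s, κ ε s) (𝓝[>] 0) (𝓝 (∫ s, κ₀ s)) := by
      refine tendsto_integral_filter_of_dominated_convergence (fun s => C * Real.exp (-|s|))
        (Eventually.of_forall fun ε => (hm ε).aestronglyMeasurable) ?_ hbi (ae_of_all _ hl)
      filter_upwards [hb] with ε hε
      exact ae_of_all _ hε
    refine h1.congr' ?_
    filter_upwards [eventually_nhdsGT_zero_pos] with ε hε
    rw [integral_inv_mul_comp_layerVar hε]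
  · filter_upwards [hs, eventually_nhdsGT_zero_pos, eventually_mul_sqrt_lt 5 hρ]
      with ε h1 hε hlt t ht
    have h : 0 < √ε := Real.sqrt_pos.2 hε
    have ht0 : κ ε (layerVar ε t) ≠ 0 := right_ne_zero_of_mul ht
    constructor
    · by_contra! hle
      refine ht0 (h1 _ ?_)
      have := layerVar_le_neg hε (t := t) (by linarith)
      rw [abs_of_nonpos]
      · linarith
      · have : 0 < 2 * (√ε)⁻¹ := by positivity
        linarith
    · by_contra! hle
      refine ht0 (h1 _ ?_)
      exact (two_mul_inv_sqrt_le_layerVar hε (t := t) (by linarith)).trans (le_abs_self _)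

theorem measurable_deriv_truncatedProfile (R : ℝ) : Measurable (deriv (truncatedProfile R)) :=
  measurable_deriv _

theorem measurable_profileDefect (R : ℝ) : Measurable (profileDefect R) := by
  unfold profileDefect
  simp_rw [deriv_doubleWell]
  have := (contDiff_truncatedProfile R).continuous.measurable
  exact (measurable_deriv _).sub ((this.pow_const 3).sub this)

theorem measurable_doubleWell_truncatedProfile (R : ℝ) :
    Measurable fun s => doubleWell (truncatedProfile R s) := by
  have := (contDiff_truncatedProfile R).continuous.measurable
  unfold doubleWell
  fun_prop

/-- The value `1` is the maximum of the profile, so the derivative vanishes even at the endpoint `s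
= 2 R`. -/
theorem deriv_truncatedProfile_of_two_mul_le {R s : ℝ} (hR : 0 < R) (hs : 2 * R ≤ |s|) :
    deriv (truncatedProfile R) s = 0 := by
  wlog h0 : 0 ≤ s generalizing s
  · have := this (s := -s) (by rwa [abs_neg]) (by linarith)
    rwa [deriv_truncatedProfile_neg] at this
  rw [abs_of_nonneg h0] at hs
  have h1 : IsLocalMax (truncatedProfile R) s := Eventually.of_forall fun y => by
    rw [truncatedProfile_of_le hR hs]
    exact (abs_le.1 (abs_truncatedProfile_le hR y)).2
  exact h1.deriv_eq_zero

theorem doubleWell_truncatedProfile_of_two_mul_le {R s : ℝ} (hR : 0 < R) (hs : 2 * R ≤ |s|) :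
    doubleWell (truncatedProfile R s) = 0 := by
  rcases le_abs.1 hs with h | h
  · rw [truncatedProfile_of_le hR h]
    norm_num [doubleWell]
  · rw [truncatedProfile_of_le_neg hR (by linarith)]
    norm_num [doubleWell]

theorem profileDefect_of_two_mul_le {R s : ℝ} (hR : 0 < R) (hs : 2 * R ≤ |s|) :
    profileDefect R s = 0 := by
  wlog h0 : 0 ≤ s generalizing s
  · have := this (s := -s) (by rwa [abs_neg]) (by linarith)
    rw [profileDefect_neg] at this
    linarith
  rw [abs_of_nonneg h0] at hs
  have hd : Differentiable ℝ (deriv (truncatedProfile R)) :=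
    ((contDiff_succ_iff_deriv (n := 1)).1 (contDiff_truncatedProfile R)).2.2.differentiable
      (by norm_num)
  -- A one-sided derivative covers the endpoint `s = 2 R`, to the left of which the profile need not
  -- be constant.
  have h1 : HasDerivWithinAt (deriv (truncatedProfile R)) (deriv (deriv (truncatedProfile R)) s)
      (Set.Ici s) s := (hd s).hasDerivAt.hasDerivWithinAt
  have h2 : HasDerivWithinAt (deriv (truncatedProfile R)) 0 (Set.Ici s) s := by
    refine (hasDerivWithinAt_const s (Set.Ici s) (0 : ℝ)).congr (fun y hy => ?_) ?_
    · exact deriv_truncatedProfile_of_two_mul_le hR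
        (hs.trans ((Set.mem_Ici.1 hy).trans (le_abs_self _)))
    · exact deriv_truncatedProfile_of_two_mul_le hR (hs.trans (le_abs_self _))
  rw [profileDefect, (uniqueDiffWithinAt_Ici s).eq_deriv _ h1 h2, truncatedProfile_of_le hR hs,
    deriv_doubleWell]
  norm_num

theorem doubleWell_optimalProfile (s : ℝ) :
    doubleWell (optimalProfile s) = ((1 - optimalProfile s ^ 2) / √2) ^ 2 / 2 := by
  rw [doubleWell, div_pow, Real.sq_sqrt (by norm_num)]
  ring

/-- The substitution `y = q(s)`, as `q' = √(2 W(q))`. It is carried out with the explicit primitive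
`(q - q ^ 3 / 3) / √2` and the limits `±1`. -/
theorem integral_optimalProfile : ∫ s, ((1 - optimalProfile s ^ 2) / √2) ^ 2 = c₀ := by
  obtain ⟨C, hC0, hC⟩ := exists_profile_bounds
  have hb : ∀ s, |(1 - optimalProfile s ^ 2) / √2| ≤ C * Real.exp (-|s|) := fun s => by
    have := (hC (|s| + 1) (by linarith [abs_nonneg s]) s).1
    rwa [deriv_truncatedProfile_of_lt (by linarith)] at this
  have hcont : Continuous optimalProfile := contDiff_optimalProfile.continuous
  have hint : Integrable fun s => ((1 - optimalProfile s ^ 2) / √2) ^ 2 := by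
    refine (integrable_exp_neg_abs.const_mul (C ^ 2)).mono'
      (by fun_prop) (ae_of_all _ fun s => ?_)
    rw [Real.norm_eq_abs, abs_pow]
    have h1 : Real.exp (-|s|) ≤ 1 := Real.exp_le_one_iff.2 (by simp)
    have h0 := Real.exp_pos (-|s|)
    calc _ ≤ (C * Real.exp (-|s|)) ^ 2 := pow_le_pow_left₀ (abs_nonneg _) (hb s) 2
      _ = C ^ 2 * (Real.exp (-|s|) * Real.exp (-|s|)) := by ring
      _ ≤ C ^ 2 * (Real.exp (-|s|) * 1) := by gcongr
      _ = _ := by ring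
  have htop : Tendsto optimalProfile atTop (𝓝 1) := by
    have h : Tendsto (fun s : ℝ => 1 - (2 : ℝ) / (1 + Real.exp (√2 * s))) atTop (𝓝 (1 - 0)) := by
      refine tendsto_const_nhds.sub (tendsto_const_nhds.div_atTop ?_)
      refine tendsto_atTop_add_const_left _ _ (Real.tendsto_exp_atTop.comp ?_)
      exact tendsto_id.const_mul_atTop (by positivity)
    rwa [sub_zero] at h
  have hbot : Tendsto optimalProfile atBot (𝓝 (-1)) := by
    have := (htop.comp tendsto_neg_atBot_atTop).neg
    refine this.congr fun s => ?_
    simp [optimalProfile_neg]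
  have hder : ∀ s, HasDerivAt (fun s => (optimalProfile s - optimalProfile s ^ 3 / 3) / √2)
      (((1 - optimalProfile s ^ 2) / √2) ^ 2) s := fun s => by
    have h := hasDerivAt_optimalProfile s
    refine ((h.sub ((h.pow 3).div_const 3)).div_const √2).congr_deriv ?_
    push_cast
    field_simp
  rw [integral_of_hasDerivAt_of_tendsto hder hint
    ((hbot.sub ((hbot.pow 3).div_const 3)).div_const √2)
    ((htop.sub ((htop.pow 3).div_const 3)).div_const √2), c₀]
  have h1 : ∀ s ∈ Set.uIcc (-1 : ℝ) 1, √(2 * doubleWell s) = (1 - s ^ 2) / √2 := fun s hs => by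
    rw [Set.uIcc_of_le (by norm_num)] at hs
    have h2 : 0 ≤ 1 - s ^ 2 := by nlinarith [hs.1, hs.2]
    rw [Real.sqrt_eq_iff_mul_self_eq (by unfold doubleWell; positivity) (by positivity),
      ← pow_two, div_pow, Real.sq_sqrt (by norm_num), doubleWell]
    ring
  rw [intervalIntegral.integral_congr h1, intervalIntegral.integral_div]
  rw [intervalIntegral.integral_sub (by simp) (by simp)]
  simp only [integral_pow, intervalIntegral.integral_const, smul_eq_mul]
  ring

theorem pow_mul_exp_neg_le {s : ℝ} (hs : 0 ≤ s) (n : ℕ) :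
    s ^ n * Real.exp (-s) ≤ n.factorial := by
  have h := Real.pow_div_factorial_le_exp s hs n
  rw [div_le_iff₀ (by positivity)] at h
  rw [Real.exp_neg, ← div_eq_mul_inv, div_le_iff₀ (Real.exp_pos s)]
  linarith

theorem eventually_lt_inv_sqrt (s : ℝ) : ∀ᶠ ε : ℝ in 𝓝[>] 0, s < (√ε)⁻¹ :=
  tendsto_inv_sqrt_nhdsGT_zero.eventually_gt_atTop s

/-- The layer kernel of the energy density. -/
def energyKernel (ε t : ℝ) : ℝ := ε⁻¹ * (deriv (truncatedProfile (√ε)⁻¹) (layerVar ε t) ^ 2 / 2 +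
  doubleWell (truncatedProfile (√ε)⁻¹ (layerVar ε t)))

/-- The layer kernel that multiplies the curvatures. -/
def curvatureKernel (ε t : ℝ) : ℝ := ε⁻¹ * deriv (truncatedProfile (√ε)⁻¹) (layerVar ε t) ^ 2

/-- The layer kernel of the product of the derivative of the profile and the defect. -/
def mixedKernel (ε t : ℝ) : ℝ := ε⁻¹ * (deriv (truncatedProfile (√ε)⁻¹) (layerVar ε t) *
  profileDefect (√ε)⁻¹ (layerVar ε t) / ε ^ 1)

/-- The layer kernel of the square of the defect. -/
def defectKernel (ε t : ℝ) : ℝ := ε⁻¹ * (profileDefect (√ε)⁻¹ (layerVar ε t) *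
  profileDefect (√ε)⁻¹ (layerVar ε t) / ε ^ 2)

theorem isLayerKernel_energyKernel : IsLayerKernel energyKernel c₀ := by
  obtain ⟨C, hC0, hC⟩ := exists_profile_bounds
  rw [← integral_optimalProfile]
  refine isLayerKernel_comp_layerVar (C := C ^ 2 / 2 + C) (κ := fun ε s =>
    deriv (truncatedProfile (√ε)⁻¹) s ^ 2 / 2 + doubleWell (truncatedProfile (√ε)⁻¹ s))
    (fun ε => ?_) ?_ ?_ fun s => ?_
  · exact (((measurable_deriv_truncatedProfile _).pow_const 2).div_const 2).add
      (measurable_doubleWell_truncatedProfile _)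
  · filter_upwards [eventually_lt_inv_sqrt 1] with ε hε s
    obtain ⟨h1, -, h3⟩ := hC _ hε.le s
    refine (abs_add_le _ _).trans ?_
    rw [abs_div, abs_pow, abs_of_pos (by norm_num : (0 : ℝ) < 2), add_mul]
    refine add_le_add ?_ h3
    have h4 : Real.exp (-|s|) ≤ 1 := Real.exp_le_one_iff.2 (by simp)
    have h0 := Real.exp_pos (-|s|)
    calc _ ≤ (C * Real.exp (-|s|)) ^ 2 / 2 := by gcongr
      _ = C ^ 2 / 2 * (Real.exp (-|s|) * Real.exp (-|s|)) := by ring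
      _ ≤ C ^ 2 / 2 * (Real.exp (-|s|) * 1) := by gcongr
      _ = _ := by ring
  · filter_upwards [eventually_lt_inv_sqrt 1] with ε hε s hs
    have hR : 0 < (√ε)⁻¹ := by linarith
    rw [deriv_truncatedProfile_of_two_mul_le hR hs, doubleWell_truncatedProfile_of_two_mul_le hR hs]
    norm_num
  · refine tendsto_const_nhds.congr' ?_
    filter_upwards [eventually_lt_inv_sqrt |s|] with ε hε
    rw [deriv_truncatedProfile_of_lt hε, truncatedProfile_eq_optimalProfile
      ((abs_nonneg s).trans_lt hε) hε.le, doubleWell_optimalProfile]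
    ring

theorem isLayerKernel_curvatureKernel : IsLayerKernel curvatureKernel c₀ := by
  obtain ⟨C, hC0, hC⟩ := exists_profile_bounds
  rw [← integral_optimalProfile]
  refine isLayerKernel_comp_layerVar (C := C ^ 2) (κ := fun ε s =>
    deriv (truncatedProfile (√ε)⁻¹) s ^ 2) (fun ε => ?_) ?_ ?_ fun s => ?_
  · exact (measurable_deriv_truncatedProfile _).pow_const 2
  · filter_upwards [eventually_lt_inv_sqrt 1] with ε hε s
    obtain ⟨h1, -, -⟩ := hC _ hε.le s
    rw [abs_pow]
    have h4 : Real.exp (-|s|) ≤ 1 := Real.exp_le_one_iff.2 (by simp)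
    have h0 := Real.exp_pos (-|s|)
    calc _ ≤ (C * Real.exp (-|s|)) ^ 2 := by gcongr
      _ = C ^ 2 * (Real.exp (-|s|) * Real.exp (-|s|)) := by ring
      _ ≤ C ^ 2 * (Real.exp (-|s|) * 1) := by gcongr
      _ = _ := by ring
  · filter_upwards [eventually_lt_inv_sqrt 1] with ε hε s hs
    rw [deriv_truncatedProfile_of_two_mul_le (by linarith) hs]
    norm_num
  · refine tendsto_const_nhds.congr' ?_
    filter_upwards [eventually_lt_inv_sqrt |s|] with ε hε
    rw [deriv_truncatedProfile_of_lt hε]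

/-- Kernels that contain the defect of the truncated profile vanish in the limit, even when they
are divided by a power of `ε`. -/
theorem isLayerKernel_of_profileDefect {f : ℝ → ℝ → ℝ} (hf : ∀ ε, Measurable (f ε)) {A : ℝ}
    (hfb : ∀ᶠ ε in 𝓝[>] 0, ∀ s, |f ε s| ≤ A * Real.exp (-|s|)) (n : ℕ) :
    IsLayerKernel (fun ε t => ε⁻¹ * (f ε (layerVar ε t) *
      profileDefect (√ε)⁻¹ (layerVar ε t) / ε ^ n)) 0 := by
  obtain ⟨C, hC0, hC⟩ := exists_profile_bounds
  rw [show (0 : ℝ) = ∫ s : ℝ, (0 : ℝ) by simp]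
  refine isLayerKernel_comp_layerVar (C := A * C * (2 * n).factorial) (κ := fun ε s =>
    f ε s * profileDefect (√ε)⁻¹ s / ε ^ n) (fun ε => ?_) ?_ ?_ fun s => ?_
  · exact ((hf ε).mul (measurable_profileDefect _)).div_const _
  · filter_upwards [eventually_lt_inv_sqrt 1, hfb, eventually_nhdsGT_zero_pos] with ε hε hf1 h0 s
    have hA : 0 ≤ A := by
      have := (abs_nonneg _).trans (hf1 s)
      exact nonneg_of_mul_nonneg_left this (Real.exp_pos _)
    rcases lt_or_ge |s| (√ε)⁻¹ with hs | hs
    · rw [profileDefect_of_lt hs]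
      simp only [mul_zero, zero_div, abs_zero]
      positivity
    obtain ⟨-, h1, -⟩ := hC _ hε.le s
    -- The defect is nonzero only for `|s| ≥ ε ^ (-1/2)`, where powers of `1 / ε` are powers of
    -- `|s|`. One of the two exponentials absorbs them and the other remains as the dominating
    -- function.
    have h2 : (ε ^ n)⁻¹ ≤ |s| ^ (2 * n) := by
      rw [pow_mul, ← inv_pow]
      refine pow_le_pow_left₀ (by positivity) ?_ n
      calc ε⁻¹ = ((√ε)⁻¹) ^ 2 := by rw [inv_pow, Real.sq_sqrt h0.le]
        _ ≤ |s| ^ 2 := by gcongr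
    have h3 := pow_mul_exp_neg_le (abs_nonneg s) (2 * n)
    rw [div_eq_mul_inv, abs_mul, abs_mul, abs_of_pos (by positivity : 0 < (ε ^ n)⁻¹)]
    calc _ ≤ A * Real.exp (-|s|) * (C * Real.exp (-|s|)) * |s| ^ (2 * n) := by
          gcongr
          exact hf1 s
      _ = A * C * (|s| ^ (2 * n) * Real.exp (-|s|)) * Real.exp (-|s|) := by ring
      _ ≤ _ := by gcongr
  · filter_upwards [eventually_lt_inv_sqrt 1] with ε hε s hs
    rw [profileDefect_of_two_mul_le (by linarith) hs]
    simp
  · refine tendsto_const_nhds.congr' ?_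
    filter_upwards [eventually_lt_inv_sqrt |s|] with ε hε
    rw [profileDefect_of_lt hε]
    simp

/-- The case `n = 1` of the general lemma, whose shape explains the `ε ^ 1` in `mixedKernel`. -/
theorem isLayerKernel_mixedKernel : IsLayerKernel mixedKernel 0 := by
  obtain ⟨C, hC0, hC⟩ := exists_profile_bounds
  refine isLayerKernel_of_profileDefect (f := fun ε => deriv (truncatedProfile (√ε)⁻¹))
    (fun ε => measurable_deriv_truncatedProfile _) (A := C) ?_ 1
  filter_upwards [eventually_lt_inv_sqrt 1] with ε hε s
  exact (hC _ hε.le s).1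

theorem isLayerKernel_defectKernel : IsLayerKernel defectKernel 0 := by
  obtain ⟨C, hC0, hC⟩ := exists_profile_bounds
  refine isLayerKernel_of_profileDefect (f := fun ε => profileDefect (√ε)⁻¹)
    (fun ε => measurable_profileDefect _) (A := C) ?_ 2
  filter_upwards [eventually_lt_inv_sqrt 1] with ε hε s
  exact (hC _ hε.le s).2.1

/-- For convergence in `L¹`: the recovery function differs from its limit only in this strip, and by
at most `2`. -/
theorem isLayerKernel_indicator :
    IsLayerKernel (fun ε => (Set.Ioo (-(5 * √ε)) 0).indicator fun _ => (2 : ℝ)) 0 := by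
  have hI : ∀ ε : ℝ, Integrable ((Set.Ioo (-(5 * √ε)) 0).indicator fun _ => (2 : ℝ)) := fun ε =>
    (integrable_indicator_iff measurableSet_Ioo).2 (integrableOn_const measure_Ioo_lt_top.ne)
  have hval : ∀ ε : ℝ, ∫ t, (Set.Ioo (-(5 * √ε)) 0).indicator (fun _ => (2 : ℝ)) t = 10 * √ε :=
    fun ε => by
      rw [integral_indicator measurableSet_Ioo, setIntegral_const, measureReal_def,
        Real.volume_Ioo, ENNReal.toReal_ofReal (by linarith [Real.sqrt_nonneg ε]), smul_eq_mul]
      ring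
  refine ⟨fun ε => measurable_const.indicator measurableSet_Ioo, Eventually.of_forall hI,
    ⟨1, ?_⟩, ?_, fun ρ hρ => ?_⟩
  · filter_upwards [eventually_mul_sqrt_lt 10 one_pos] with ε hε
    have : ∀ t, |(Set.Ioo (-(5 * √ε)) 0).indicator (fun _ => (2 : ℝ)) t| =
        (Set.Ioo (-(5 * √ε)) 0).indicator (fun _ => (2 : ℝ)) t := fun t =>
      abs_of_nonneg (Set.indicator_nonneg (fun _ _ => by norm_num) t)
    simp_rw [this]
    rw [hval]
    exact hε.le
  · simp_rw [hval]
    have := (tendsto_sqrt_nhdsGT_zero.mono_right nhdsWithin_le_nhds).const_mul (10 : ℝ)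
    rwa [mul_zero] at this
  · filter_upwards [eventually_mul_sqrt_lt 5 hρ] with ε hε t ht
    have := Set.mem_of_indicator_ne_zero ht
    exact ⟨by linarith [this.1], this.2⟩

end Helfrich

end

noncomputable section

namespace Helfrich

/-! ### Differential operators of a composition with a function of one variable -/

theorem laplacian_eq_trace_hessianMatrix {u : R3 → ℝ} {x : R3} (hu : ContDiffAt ℝ 2 u x) :
    Laplacian.laplacian u x = (hessianMatrix u x).trace := by
  rw [InnerProductSpace.laplacian_eq_iteratedFDeriv_orthonormalBasis u
    (EuclideanSpace.basisFun (Fin 3) ℝ), Matrix.trace]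
  refine Finset.sum_congr rfl fun i _ => ?_
  rw [iteratedFDeriv_two_apply]
  simp only [Matrix.cons_val_zero, Matrix.cons_val_one, EuclideanSpace.basisFun_apply]
  rw [← inner_hessian hu]
  simp [hessianMatrix, EuclideanSpace.inner_single_right]

theorem gradient_comp {φ : ℝ → ℝ} {v : R3 → ℝ} {x : R3} (hφ : DifferentiableAt ℝ φ (v x))
    (hv : DifferentiableAt ℝ v x) : ∇ (fun y => φ (v y)) x = deriv φ (v x) • ∇ v x := by
  have h := hφ.hasDerivAt.comp_hasFDerivAt x hv.hasFDerivAt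
  rw [gradient, gradient, show fderiv ℝ (fun y => φ (v y)) x = _ from h.fderiv, map_smul]

theorem hessian_comp {φ : ℝ → ℝ} {v : R3 → ℝ} {x : R3} (hφ : ContDiff ℝ 2 φ)
    (hv : ContDiffAt ℝ 2 v x) (h : R3) : hessian (fun y => φ (v y)) x h =
      deriv φ (v x) • hessian v x h + (deriv (deriv φ) (v x) * inner ℝ (∇ v x) h) • ∇ v x := by
  have hφ' : Differentiable ℝ (deriv φ) :=
    ((contDiff_succ_iff_deriv (n := 1)).1 hφ).2.2.differentiable (by norm_num)
  have h1 : ∇ (fun y => φ (v y)) =ᶠ[𝓝 x] fun y => deriv φ (v y) • ∇ v y := by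
    filter_upwards [hv.eventually (by simp)] with y hy
    exact gradient_comp (hφ.differentiable (by norm_num) _) (hy.differentiableAt (by norm_num))
  have h2 := (hφ' (v x)).hasDerivAt.comp_hasFDerivAt x
    (hv.differentiableAt (by norm_num)).hasFDerivAt
  have h3 := h2.smul (hasFDerivAt_gradient hv)
  rw [hessian, h1.fderiv_eq, show fderiv ℝ (fun y => deriv φ (v y) • ∇ v y) x = _ from h3.fderiv]
  simp [inner_gradient_left]

theorem hessianMatrix_comp {φ : ℝ → ℝ} {v : R3 → ℝ} {x : R3} (hφ : ContDiff ℝ 2 φ)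
    (hv : ContDiffAt ℝ 2 v x) (i j : Fin 3) : hessianMatrix (fun y => φ (v y)) x i j =
      deriv φ (v x) * hessianMatrix v x i j + deriv (deriv φ) (v x) * (∇ v x i * ∇ v x j) := by
  simp only [hessianMatrix, Matrix.of_apply, hessian_comp hφ hv, EuclideanSpace.inner_single_right]
  simp
  ring

theorem sum_hessianMatrix_mul {v : R3 → ℝ} {x a : R3} (hv : ContDiffAt ℝ 2 v x)
    (ha : hessian v x a = 0) (i : Fin 3) : ∑ j, hessianMatrix v x j i * a j = 0 := by
  have h := inner_hessian_comm hv a (EuclideanSpace.single i 1)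
  rw [ha, inner_zero_left, PiLp.inner_apply] at h
  rw [h]
  refine Finset.sum_congr rfl fun j _ => ?_
  simp [hessianMatrix]

theorem normSq_eq_sum (M : Matrix (Fin 3) (Fin 3) ℝ) : normSq M = ∑ j, ∑ i, M i j ^ 2 := by
  simp [normSq, Matrix.trace, Matrix.mul_apply, pow_two]

/-- The cross term is a multiple of `⟪n, H n⟫ = 0`, and `n ⊗ n` has norm `1`. -/
theorem normSq_add_of_apply_eq_zero {H M : Matrix (Fin 3) (Fin 3) ℝ} {n : R3} (hn : ‖n‖ = 1)
    (hH : ∀ i, ∑ j, H j i * n j = 0) (a b : ℝ)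
    (hM : ∀ i j, M i j = a * H i j + b * (n i * n j)) : normSq M = a ^ 2 * normSq H + b ^ 2 := by
  have h1 : n 0 ^ 2 + n 1 ^ 2 + n 2 ^ 2 = 1 := by
    have := EuclideanSpace.real_norm_sq_eq n
    rw [hn, Fin.sum_univ_three] at this
    linarith
  have h0 := hH 0
  have h2 := hH 1
  have h3 := hH 2
  simp only [normSq_eq_sum, hM, Fin.sum_univ_three] at *
  linear_combination 2 * a * b * (n 0 * h0 + n 1 * h2 + n 2 * h3) +
    b ^ 2 * (n 0 ^ 2 + n 1 ^ 2 + n 2 ^ 2 + 1) * h1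

/-! ### The recovery sequence -/

/-- The optimal profile, truncated and rescaled, across the level surface of the signed distance
at level `-3√ε`. -/
def recovery (E : Set R3) (ε : ℝ) (x : R3) : ℝ :=
  truncatedProfile (√ε)⁻¹ (layerVar ε (sgnDist E x))

theorem recovery_eq_one {E : Set R3} {ε : ℝ} (hε : 0 < ε) {x : R3} (hx : -√ε ≤ sgnDist E x) :
    recovery E ε x = 1 :=
  truncatedProfile_of_le (by positivity) (two_mul_inv_sqrt_le_layerVar hε hx)

theorem recovery_eq_neg_one {E : Set R3} {ε : ℝ} (hε : 0 < ε) {x : R3}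
    (hx : sgnDist E x ≤ -(5 * √ε)) : recovery E ε x = -1 :=
  truncatedProfile_of_le_neg (by positivity) (layerVar_le_neg hε hx)

theorem eventually_recovery_eq {E : Set R3} {ε : ℝ} (hε : 0 < ε) {x : R3}
    (hx : 5 * √ε < |sgnDist E x|) : ∃ c : ℝ, c ^ 2 = 1 ∧ recovery E ε =ᶠ[𝓝 x] fun _ => c := by
  have h0 : 0 < √ε := Real.sqrt_pos.2 hε
  rcases lt_abs.1 hx with h | h
  · refine ⟨1, by norm_num, ?_⟩
    filter_upwards [(continuous_sgnDist E).continuousAt.eventually_const_lt h] with y hy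
    exact recovery_eq_one hε (by linarith)
  · refine ⟨-1, by norm_num, ?_⟩
    filter_upwards [(continuous_sgnDist E).continuousAt.eventually_lt_const
      (show sgnDist E x < -(5 * √ε) by linarith)] with y hy
    exact recovery_eq_neg_one hε hy.le

theorem two_mul_inv_sqrt_le_abs_layerVar {ε t : ℝ} (hε : 0 < ε) (ht : 5 * √ε < |t|) :
    2 * (√ε)⁻¹ ≤ |layerVar ε t| := by
  have h0 : 0 < √ε := Real.sqrt_pos.2 hε
  rcases lt_abs.1 ht with h | h
  · exact (two_mul_inv_sqrt_le_layerVar hε (by linarith)).trans (le_abs_self _)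
  · exact (le_neg.1 (layerVar_le_neg hε (t := t) (by linarith))).trans (neg_le_abs _)

theorem contDiff_comp_layerVar (R ε : ℝ) :
    ContDiff ℝ 2 fun t => truncatedProfile R (layerVar ε t) :=
  (contDiff_truncatedProfile R).comp (by unfold layerVar; fun_prop)

theorem hasDerivAt_layerVar (ε t : ℝ) : HasDerivAt (layerVar ε) (1 / ε) t :=
  ((hasDerivAt_id t).add_const (3 * √ε)).div_const ε

theorem deriv_comp_layerVar (R ε : ℝ) : deriv (fun t => truncatedProfile R (layerVar ε t)) =
    fun t => deriv (truncatedProfile R) (layerVar ε t) / ε := by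
  funext t
  have h := (((contDiff_truncatedProfile R).differentiable (by norm_num)
    (layerVar ε t)).hasDerivAt.comp t (hasDerivAt_layerVar ε t)).deriv
  rw [← mul_one_div]
  exact h

theorem deriv_deriv_comp_layerVar (R ε t : ℝ) :
    deriv (deriv fun t => truncatedProfile R (layerVar ε t)) t =
      deriv (deriv (truncatedProfile R)) (layerVar ε t) / ε ^ 2 := by
  have hφ' : Differentiable ℝ (deriv (truncatedProfile R)) :=
    ((contDiff_succ_iff_deriv (n := 1)).1 (contDiff_truncatedProfile R)).2.2.differentiable
      (by norm_num)
  have h := (((hφ' (layerVar ε t)).hasDerivAt.comp t (hasDerivAt_layerVar ε t)).div_const ε).deriv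
  rw [deriv_comp_layerVar]
  refine Eq.trans h ?_
  rw [pow_two, ← div_div, mul_one_div]

section

variable {E : Set R3} {r ε : ℝ}

/-- The signed distance need not be regular outside the tube, but there the function is locally
constant as soon as the layer fits inside. -/
theorem IsTube.contDiff_recovery (ht : IsTube E r) (hε : 0 < ε) (hr : 5 * √ε < r) :
    ContDiff ℝ 2 (recovery E ε) := by
  refine contDiff_iff_contDiffAt.2 fun x => ?_
  rcases lt_or_ge |sgnDist E x| r with h | h
  · exact (contDiff_comp_layerVar _ ε).contDiffAt.comp x (ht.contDiffAt x h)
  · obtain ⟨c, -, hc⟩ := eventually_recovery_eq hε (hr.trans_le h)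
    exact contDiffAt_const.congr_of_eventuallyEq hc

theorem IsTube.gradient_recovery (ht : IsTube E r) {x : R3} (hx : |sgnDist E x| < r) :
    ∇ (recovery E ε) x =
      (deriv (truncatedProfile (√ε)⁻¹) (layerVar ε (sgnDist E x)) / ε) • ∇ (sgnDist E) x := by
  have := gradient_comp ((contDiff_comp_layerVar (√ε)⁻¹ ε).differentiable (by norm_num) _)
    ((ht.contDiffAt x hx).differentiableAt (by norm_num))
  rwa [deriv_comp_layerVar] at this

theorem IsTube.hessianMatrix_recovery (ht : IsTube E r) {x : R3} (hx : |sgnDist E x| < r)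
    (i j : Fin 3) : hessianMatrix (recovery E ε) x i j =
      deriv (truncatedProfile (√ε)⁻¹) (layerVar ε (sgnDist E x)) / ε *
        hessianMatrix (sgnDist E) x i j +
      deriv (deriv (truncatedProfile (√ε)⁻¹)) (layerVar ε (sgnDist E x)) / ε ^ 2 *
        (∇ (sgnDist E) x i * ∇ (sgnDist E) x j) := by
  have := hessianMatrix_comp (contDiff_comp_layerVar (√ε)⁻¹ ε) (ht.contDiffAt x hx) i j
  rwa [deriv_deriv_comp_layerVar, deriv_comp_layerVar] at this

theorem hessian_of_eventuallyEq_const {u : R3 → ℝ} {c : ℝ} {x : R3} (h : u =ᶠ[𝓝 x] fun _ => c) :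
    ∇ u x = 0 ∧ hessian u x = 0 := by
  have h1 : ∇ u =ᶠ[𝓝 x] fun _ => 0 := by
    filter_upwards [h.eventuallyEq_nhds] with y hy
    rw [gradient, hy.fderiv_eq]
    simp
  exact ⟨h1.eq_of_nhds, by rw [hessian, h1.fderiv_eq]; simp⟩

theorem energies_of_eventuallyEq_const {u : R3 → ℝ} {c : ℝ} (hc : c ^ 2 = 1) {x : R3}
    (h : u =ᶠ[𝓝 x] fun _ => c) (ε : ℝ) : chemicalPotential 0 ε u x = 0 ∧
      diffuseMatrix ε u x = 0 ∧ ε / 2 * ‖∇ u x‖ ^ 2 + doubleWell (u x) / ε = 0 := by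
  obtain ⟨h1, h2⟩ := hessian_of_eventuallyEq_const h
  have h3 : deriv doubleWell (u x) = 0 := by
    rw [h.eq_of_nhds, deriv_doubleWell]
    linear_combination c * hc
  have h4 : ContDiffAt ℝ 2 u x := contDiffAt_const.congr_of_eventuallyEq h
  refine ⟨?_, ?_, ?_⟩
  · rw [chemicalPotential, laplacian_eq_trace_hessianMatrix h4, h3]
    simp [hessianMatrix, h2, Matrix.trace]
  · ext i j
    simp [diffuseMatrix, h2, h3]
  · rw [h1, h.eq_of_nhds, doubleWell, hc]
    simp

theorem IsTube.chemicalPotential_recovery (ht : IsTube E r) (hε : 0 < ε) {x : R3}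
    (hx : |sgnDist E x| < r) : chemicalPotential 0 ε (recovery E ε) x =
      deriv (truncatedProfile (√ε)⁻¹) (layerVar ε (sgnDist E x)) *
        (hessianMatrix (sgnDist E) x).trace +
      profileDefect (√ε)⁻¹ (layerVar ε (sgnDist E x)) / ε := by
  have h4 : ContDiffAt ℝ 2 (recovery E ε) x :=
    (contDiff_comp_layerVar _ ε).contDiffAt.comp x (ht.contDiffAt x hx)
  have h1 : ∇ (sgnDist E) x 0 ^ 2 + ∇ (sgnDist E) x 1 ^ 2 + ∇ (sgnDist E) x 2 ^ 2 = 1 := by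
    have := EuclideanSpace.real_norm_sq_eq (∇ (sgnDist E) x)
    rw [ht.norm_gradient x hx, Fin.sum_univ_three] at this
    linarith
  rw [chemicalPotential, laplacian_eq_trace_hessianMatrix h4, Matrix.trace_fin_three,
    Matrix.trace_fin_three, ht.hessianMatrix_recovery hx, ht.hessianMatrix_recovery hx,
    ht.hessianMatrix_recovery hx, profileDefect, recovery]
  set a := deriv (deriv (truncatedProfile (√ε)⁻¹)) (layerVar ε (sgnDist E x))
  field_simp
  linear_combination a * h1

theorem IsTube.normSq_diffuseMatrix_recovery (ht : IsTube E r) (hε : 0 < ε) {x : R3}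
    (hx : |sgnDist E x| < r) : normSq (diffuseMatrix ε (recovery E ε) x) =
      deriv (truncatedProfile (√ε)⁻¹) (layerVar ε (sgnDist E x)) ^ 2 *
        normSq (hessianMatrix (sgnDist E) x) +
      (profileDefect (√ε)⁻¹ (layerVar ε (sgnDist E x)) / ε) ^ 2 := by
  refine normSq_add_of_apply_eq_zero (ht.norm_gradient x hx)
    (sum_hessianMatrix_mul (ht.contDiffAt x hx) (ht.hessian_apply_gradient hx)) _ _ fun i j => ?_
  have h1 : diffuseMatrix ε (recovery E ε) x i j = ε * hessianMatrix (recovery E ε) x i j -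
      deriv doubleWell (recovery E ε x) / ε *
        (unitNormal (recovery E ε) x i * unitNormal (recovery E ε) x j) := rfl
  have h2 : deriv doubleWell (recovery E ε x) *
        (unitNormal (recovery E ε) x i * unitNormal (recovery E ε) x j) =
      deriv doubleWell (recovery E ε x) * (∇ (sgnDist E) x i * ∇ (sgnDist E) x j) := by
    set a := deriv (truncatedProfile (√ε)⁻¹) (layerVar ε (sgnDist E x)) with ha
    -- If `a ≠ 0`, the unit normal is `∇ d` up to the sign of `a`, which the tensor square forgets;
    -- if `a = 0`, the factor `W'(u)` vanishes.
    by_cases h0 : a = 0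
    · rw [recovery, deriv_doubleWell_eq_zero_of_deriv_eq_zero (by positivity) h0, zero_mul,
        zero_mul]
    · have hn := ht.norm_gradient x hx
      have hg : ∇ (recovery E ε) x = (a / ε) • ∇ (sgnDist E) x := ht.gradient_recovery hx
      have hg0 : ∇ (recovery E ε) x ≠ 0 := by
        rw [hg]
        refine smul_ne_zero (div_ne_zero h0 hε.ne') fun h => ?_
        rw [h, norm_zero] at hn
        exact zero_ne_one hn
      congr 1
      rw [unitNormal, if_neg hg0, hg, norm_smul, hn, mul_one, Real.norm_eq_abs]
      have h3 : |a / ε| ≠ 0 := abs_ne_zero.2 (div_ne_zero h0 hε.ne')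
      simp only [PiLp.smul_apply, smul_eq_mul]
      have h5 : |a / ε|⁻¹ * |a / ε|⁻¹ * (a / ε * (a / ε)) = 1 := by
        rw [← abs_mul_abs_self (a / ε)]
        field_simp
      linear_combination (∇ (sgnDist E) x i * ∇ (sgnDist E) x j) * h5
  have h6 : deriv doubleWell (recovery E ε x) / ε *
        (unitNormal (recovery E ε) x i * unitNormal (recovery E ε) x j) =
      deriv doubleWell (recovery E ε x) / ε * (∇ (sgnDist E) x i * ∇ (sgnDist E) x j) := by
    rw [div_mul_eq_mul_div, h2, div_mul_eq_mul_div]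
  rw [h1, ht.hessianMatrix_recovery hx, h6, profileDefect, recovery]
  field_simp
  ring

theorem IsTube.energyDensity_recovery (ht : IsTube E r) (hε : 0 < ε) {x : R3}
    (hx : |sgnDist E x| < r) :
    ε / 2 * ‖∇ (recovery E ε) x‖ ^ 2 + doubleWell (recovery E ε x) / ε =
      ε⁻¹ * (deriv (truncatedProfile (√ε)⁻¹) (layerVar ε (sgnDist E x)) ^ 2 / 2 +
        doubleWell (truncatedProfile (√ε)⁻¹ (layerVar ε (sgnDist E x)))) := by
  rw [ht.gradient_recovery hx, norm_smul, ht.norm_gradient x hx, mul_one, Real.norm_eq_abs,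
    sq_abs, recovery]
  field_simp

end

end Helfrich

end

noncomputable section

namespace Helfrich

/-! ### Convergence of the energies of the recovery sequence -/

theorem measurable_hessianMatrix (v : R3 → ℝ) (i j : Fin 3) :
    Measurable fun x => hessianMatrix v x i j :=
  (EuclideanSpace.proj (𝕜 := ℝ) i).continuous.measurable.comp
    (measurable_fderiv_apply_const ℝ (∇ v) (EuclideanSpace.single j 1))

theorem measurable_trace_hessianMatrix (v : R3 → ℝ) :
    Measurable fun x => (hessianMatrix v x).trace :=
  Finset.measurable_sum _ fun i _ => measurable_hessianMatrix v i i

theorem measurable_normSq_hessianMatrix (v : R3 → ℝ) :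
    Measurable fun x => normSq (hessianMatrix v x) := by
  simp_rw [normSq_eq_sum]
  exact Finset.measurable_sum _ fun j _ => Finset.measurable_sum _ fun i _ =>
    (measurable_hessianMatrix v i j).pow_const 2

theorem continuousAt_hessianMatrix {v : R3 → ℝ} {x : R3} (hv : ContDiffAt ℝ 2 v x)
    (i j : Fin 3) : ContinuousAt (fun x => hessianMatrix v x i j) x := by
  have h1 : ContinuousAt (hessian v) x :=
    ((hv.gradient (m := 1) (by norm_num)).fderiv_right (m := 0) (by norm_num)).continuousAt
  exact (EuclideanSpace.proj (𝕜 := ℝ) i).continuous.continuousAt.comp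
    (h1.clm_apply (continuousAt_const (y := EuclideanSpace.single j (1 : ℝ))))

theorem continuousAt_trace_hessianMatrix {v : R3 → ℝ} {x : R3} (hv : ContDiffAt ℝ 2 v x) :
    ContinuousAt (fun x => (hessianMatrix v x).trace) x :=
  tendsto_finsetSum _ fun i _ => continuousAt_hessianMatrix hv i i

theorem continuousAt_normSq_hessianMatrix {v : R3 → ℝ} {x : R3} (hv : ContDiffAt ℝ 2 v x) :
    ContinuousAt (fun x => normSq (hessianMatrix v x)) x := by
  simp_rw [normSq_eq_sum]
  exact tendsto_finsetSum _ fun j _ => tendsto_finsetSum _ fun i _ =>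
    (continuousAt_hessianMatrix hv i j).pow 2

/-- The closed tube of radius `s` is compact and lies in the open tube where `g` is continuous. -/
theorem exists_bound_of_continuousAt {E : Set R3} {r s : ℝ} (hK : IsCompact (frontier E))
    (hne : (frontier E).Nonempty) (hsr : s < r) {g : R3 → ℝ}
    (hg : ∀ x, |sgnDist E x| < r → ContinuousAt g x) : ∃ M, ∀ x, |sgnDist E x| < s → |g x| ≤ M := by
  have hS : IsCompact {x | |sgnDist E x| ≤ s} := by
    refine (hK.cthickening (r := s)).of_isClosed_subset
      (isClosed_le (continuous_sgnDist E).abs continuous_const) fun x hx => ?_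
    obtain ⟨p, hp, hd⟩ := exists_sgnDist_eq_infDist hK hne x
    exact Metric.mem_cthickening_of_dist_le _ p _ _ hp (hd ▸ hx)
  obtain ⟨M, hM⟩ := hS.exists_bound_of_continuousOn (f := g) fun x hx =>
    (hg x (lt_of_le_of_lt hx hsr)).continuousWithinAt
  exact ⟨M, fun x hx => hM x hx.le⟩

section

variable {E Ω : Set R3} {r : ℝ}

/-- A set of finite two-dimensional measure is null in dimension three. -/
theorem volume_frontier_eq_zero (ht : IsTube E r) (hK : IsCompact (frontier E)) :
    volume (frontier E) = 0 := by
  rw [← EuclideanSpace.euclideanHausdorffMeasure_eq_volume]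
  rcases Measure.euclideanHausdorffMeasure_zero_or_top (by norm_num : 2 < 3) (frontier E)
    with h | h
  · exact h
  · exact absurd h (ht.area_frontier_lt_top hK).ne

theorem kernels_eq_zero {ε t : ℝ} (hε : 0 < ε) (ht : 5 * √ε < |t|) : energyKernel ε t = 0 ∧
    curvatureKernel ε t = 0 ∧ mixedKernel ε t = 0 ∧ defectKernel ε t = 0 := by
  have h := two_mul_inv_sqrt_le_abs_layerVar hε ht
  have hR : 0 < (√ε)⁻¹ := by positivity
  simp [energyKernel, curvatureKernel, mixedKernel, defectKernel,
    deriv_truncatedProfile_of_two_mul_le hR h, doubleWell_truncatedProfile_of_two_mul_le hR h,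
    profileDefect_of_two_mul_le hR h]

theorem IsTube.energyDensity_eq (ht : IsTube E r) {ε : ℝ} (hε : 0 < ε) (hr : 5 * √ε < r) (x : R3) :
    ε / 2 * ‖∇ (recovery E ε) x‖ ^ 2 + doubleWell (recovery E ε x) / ε =
      energyKernel ε (sgnDist E x) := by
  rcases lt_or_ge |sgnDist E x| r with h | h
  · exact ht.energyDensity_recovery hε h
  · obtain ⟨c, hc1, hc⟩ := eventually_recovery_eq hε (hr.trans_le h)
    rw [(energies_of_eventuallyEq_const hc1 hc ε).2.2, (kernels_eq_zero hε (hr.trans_le h)).1]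

/-- The factor `ε` cancels the prefactor of the energy. The identity holds at all points: outside
the tube the kernels vanish, whatever the Hessian of the distance is there. -/
theorem IsTube.sq_chemicalPotential_eq (ht : IsTube E r) {ε : ℝ} (hε : 0 < ε) (hr : 5 * √ε < r)
    (x : R3) : chemicalPotential 0 ε (recovery E ε) x ^ 2 =
      ε * (curvatureKernel ε (sgnDist E x) * (hessianMatrix (sgnDist E) x).trace ^ 2 +
        2 * (mixedKernel ε (sgnDist E x) * (hessianMatrix (sgnDist E) x).trace) +
        defectKernel ε (sgnDist E x) * 1) := by
  rcases lt_or_ge |sgnDist E x| r with h | h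
  · rw [ht.chemicalPotential_recovery hε h, curvatureKernel, mixedKernel, defectKernel]
    field_simp
    ring
  · obtain ⟨c, hc1, hc⟩ := eventually_recovery_eq hε (hr.trans_le h)
    obtain ⟨-, h1, h2, h3⟩ := kernels_eq_zero hε (hr.trans_le h)
    rw [(energies_of_eventuallyEq_const hc1 hc ε).1, h1, h2, h3]
    ring

theorem IsTube.normSq_diffuseMatrix_eq (ht : IsTube E r) {ε : ℝ} (hε : 0 < ε) (hr : 5 * √ε < r)
    (x : R3) : normSq (diffuseMatrix ε (recovery E ε) x) =
      ε * (curvatureKernel ε (sgnDist E x) * normSq (hessianMatrix (sgnDist E) x) +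
        defectKernel ε (sgnDist E x) * 1) := by
  rcases lt_or_ge |sgnDist E x| r with h | h
  · rw [ht.normSq_diffuseMatrix_recovery hε h, curvatureKernel, defectKernel]
    field_simp
  · obtain ⟨c, hc1, hc⟩ := eventually_recovery_eq hε (hr.trans_le h)
    obtain ⟨-, h1, h2, h3⟩ := kernels_eq_zero hε (hr.trans_le h)
    rw [(energies_of_eventuallyEq_const hc1 hc ε).2.1, h1, h3]
    simp [normSq]

theorem c₀_nonneg : 0 ≤ c₀ :=
  intervalIntegral.integral_nonneg (by norm_num) fun _ _ => Real.sqrt_nonneg _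

theorem abs_recovery_sub_le {ε : ℝ} (hε : 0 < ε) (hEo : IsOpen E) (hne : (frontier E).Nonempty)
    {x : R3} (hx : x ∉ frontier E) : |recovery E ε x - (2 * E.indicator 1 x - 1)| ≤
      (Set.Ioo (-(5 * √ε)) 0).indicator (fun _ => (2 : ℝ)) (sgnDist E x) := by
  have h0 : 0 ≤ (Set.Ioo (-(5 * √ε)) 0).indicator (fun _ => (2 : ℝ)) (sgnDist E x) :=
    Set.indicator_nonneg (fun _ _ => by norm_num) _
  have hs : 0 < √ε := Real.sqrt_pos.2 hε
  by_cases hxE : x ∈ E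
  · have := (sgnDist_pos_iff hEo hne).2 hxE
    rw [recovery_eq_one hε (by linarith), Set.indicator_of_mem hxE, Pi.one_apply]
    norm_num
    exact h0
  · have h1 : sgnDist E x < 0 := by
      refine lt_of_le_of_ne (not_lt.1 fun h => hxE ((sgnDist_pos_iff hEo hne).1 h)) fun h => ?_
      exact hx ((sgnDist_eq_zero_iff hne).1 h)
    rw [Set.indicator_of_notMem hxE]
    rcases le_or_gt (sgnDist E x) (-(5 * √ε)) with h | h
    · rw [recovery_eq_neg_one hε h]
      norm_num
      exact h0
    · rw [Set.indicator_of_mem (Set.mem_Ioo.2 ⟨h, h1⟩)]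
      have := abs_le.1 (abs_truncatedProfile_le (inv_pos.2 hs) (layerVar ε (sgnDist E x)))
      rw [recovery, abs_le]
      constructor <;> linarith

theorem IsTube.tendsto_eLpNorm_recovery (ht : IsTube E r) (hEo : IsOpen E)
    (hK : IsCompact (frontier E)) (hne : (frontier E).Nonempty) (hΩ : MeasurableSet Ω)
    (hΩE : ∀ p ∈ frontier E, ∀ᶠ t in 𝓝[<] (0 : ℝ), (normalMap E (p, t) ∈ Ω ↔ p ∈ Ω)) :
    Tendsto (fun ε => eLpNorm (fun x => recovery E ε x - (2 * E.indicator 1 x - 1)) 1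
      (volume.restrict Ω)) (𝓝[>] 0) (𝓝 0) := by
  obtain ⟨h1, h2⟩ := ht.tendsto_layer hK hne hΩ hΩE isLayerKernel_indicator
    (g := fun _ => 1) measurable_const (fun _ _ => continuousAt_const) (M := 1) (by simp)
  have h3 := ENNReal.tendsto_ofReal h2
  rw [zero_mul, ENNReal.ofReal_zero] at h3
  refine tendsto_of_tendsto_of_tendsto_of_le_of_le' tendsto_const_nhds h3
    (Eventually.of_forall fun _ => zero_le) ?_
  filter_upwards [h1, eventually_nhdsGT_zero_pos] with ε hi hε
  have h4 : ∀ x : R3, ‖(Set.Ioo (-(5 * √ε)) 0).indicator (fun _ => (2 : ℝ)) (sgnDist E x) * 1‖ =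
      (Set.Ioo (-(5 * √ε)) 0).indicator (fun _ => (2 : ℝ)) (sgnDist E x) * 1 := fun x =>
    Real.norm_of_nonneg (mul_nonneg (Set.indicator_nonneg (fun _ _ => by norm_num) _) zero_le_one)
  have h5 := ofReal_integral_norm_eq_lintegral_enorm hi
  simp_rw [h4] at h5
  rw [h5, ← eLpNorm_one_eq_lintegral_enorm]
  refine eLpNorm_mono_ae (ae_restrict_of_ae ?_)
  -- On the boundary itself the recovery function is `1` while the limit is `-1`, with the strip
  -- indicator equal to `0`; these points are negligible.
  have h6 : ∀ᵐ x, x ∉ frontier E := measure_eq_zero_iff_ae_notMem.1 (volume_frontier_eq_zero ht hK)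
  filter_upwards [h6] with x hx
  rw [h4, mul_one]
  exact abs_recovery_sub_le hε hEo hne hx

theorem measurable_energyKernel (ε : ℝ) : Measurable (energyKernel ε) :=
  isLayerKernel_energyKernel.measurable ε

theorem energyKernel_nonneg {ε : ℝ} (hε : 0 < ε) (t : ℝ) : 0 ≤ energyKernel ε t := by
  unfold energyKernel doubleWell
  positivity

theorem IsTube.integral_energyMeasure_recovery (ht : IsTube E r) {ε : ℝ} (hε : 0 < ε)
    (hr : 5 * √ε < r) (φ : R3 → ℝ) : ∫ x, φ x ∂(energyMeasure Ω ε (recovery E ε)) =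
      ∫ x in Ω, energyKernel ε (sgnDist E x) * φ x := by
  rw [energyMeasure]
  simp_rw [ht.energyDensity_eq hε hr]
  have hm : Measurable fun x => ENNReal.ofReal (energyKernel ε (sgnDist E x)) :=
    ((measurable_energyKernel ε).comp (continuous_sgnDist E).measurable).ennreal_ofReal
  rw [integral_withDensity_eq_integral_toReal_smul hm
    (ae_of_all _ fun _ => ENNReal.ofReal_lt_top)]
  refine integral_congr_ae (ae_of_all _ fun x => ?_)
  simp only [smul_eq_mul]
  rw [ENNReal.toReal_ofReal (energyKernel_nonneg hε _)]

theorem IsTube.tendstoAsRadonMeasures_recovery (ht : IsTube E r)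
    (hK : IsCompact (frontier E)) (hne : (frontier E).Nonempty) (hΩ : MeasurableSet Ω)
    (hΩE : ∀ p ∈ frontier E, ∀ᶠ t in 𝓝[<] (0 : ℝ), (normalMap E (p, t) ∈ Ω ↔ p ∈ Ω)) :
    TendstoAsRadonMeasures Ω (fun ε => energyMeasure Ω ε (recovery E ε))
      (ENNReal.ofReal c₀ • (μHE[2] : Measure R3).restrict (frontier E)) := by
  intro φ hφ hφc hφΩ
  obtain ⟨M, hM⟩ := hφ.bounded_above_of_compact_support hφc
  obtain ⟨-, h2⟩ := ht.tendsto_layer hK hne hΩ hΩE isLayerKernel_energyKernel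
    hφ.measurable (fun _ _ => hφ.continuousAt) (M := M) fun x _ => hM x
  -- The support of `φ` lies in `Ω`, so integrating over the boundary or over its part in `Ω` is the
  -- same.
  rw [integral_smul_measure, ENNReal.toReal_ofReal c₀_nonneg, smul_eq_mul,
    setIntegral_eq_of_subset_of_forall_sdiff_eq_zero (s := Ω ∩ frontier E)
      isClosed_frontier.measurableSet Set.inter_subset_right]
  · refine h2.congr' ?_
    filter_upwards [eventually_nhdsGT_zero_pos, eventually_mul_sqrt_lt 5 ht.pos] with ε hε hr
    exact (ht.integral_energyMeasure_recovery hε hr φ).symm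
  · intro x hx
    exact image_eq_zero_of_notMem_tsupport fun h => hx.2 ⟨hφΩ h, hx.1⟩

theorem IsTube.tendsto_diffuseHelfrich_recovery (ht : IsTube E r) (hEo : IsOpen E)
    (hK : IsCompact (frontier E)) (hne : (frontier E).Nonempty) (hΩ : MeasurableSet Ω)
    (hΩE : ∀ p ∈ frontier E, ∀ᶠ t in 𝓝[<] (0 : ℝ), (normalMap E (p, t) ∈ Ω ↔ p ∈ Ω))
    (κb κG : ℝ) : (∀ᶠ ε in 𝓝[>] 0, HasFiniteEnergy Ω ε (recovery E ε)) ∧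
    Tendsto (fun ε => diffuseHelfrich κb κG Ω ε (recovery E ε)) (𝓝[>] 0)
      (𝓝 (c₀ * helfrichEnergy κb κG 0 Ω E)) := by
  set d := sgnDist E with hd
  set T : R3 → ℝ := fun x => (hessianMatrix d x).trace with hT
  set N : R3 → ℝ := fun x => normSq (hessianMatrix d x) with hN
  -- On the smaller tube the second derivatives of the distance are bounded, as `tendsto_layer`
  -- requires.
  have hr2 : r / 2 < r := half_lt_self ht.pos
  have ht2 := ht.mono (half_pos ht.pos) hr2.le
  have hTc : ∀ x, |d x| < r → ContinuousAt T x := fun x hx =>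
    continuousAt_trace_hessianMatrix (ht.contDiffAt x hx)
  have hNc : ∀ x, |d x| < r → ContinuousAt N x := fun x hx =>
    continuousAt_normSq_hessianMatrix (ht.contDiffAt x hx)
  have hTm : Measurable T := measurable_trace_hessianMatrix d
  have hNm : Measurable N := measurable_normSq_hessianMatrix d
  have key : ∀ {k : ℝ → ℝ → ℝ} {c : ℝ}, IsLayerKernel k c → ∀ {g : R3 → ℝ}, Measurable g →
      (∀ x, |d x| < r → ContinuousAt g x) →
      (∀ᶠ ε in 𝓝[>] 0, IntegrableOn (fun x => k ε (d x) * g x) Ω) ∧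
      Tendsto (fun ε => ∫ x in Ω, k ε (d x) * g x) (𝓝[>] 0)
        (𝓝 (c * ∫ p in Ω ∩ frontier E, g p ∂(μHE[2] : Measure R3))) := by
    intro k c hk g hg hgc
    obtain ⟨M, hM⟩ := exists_bound_of_continuousAt hK hne hr2 hgc
    refine ht2.tendsto_layer hK hne hΩ hΩE hk hg (fun p hp => hgc p ?_) hM
    rw [hd, (sgnDist_eq_zero_iff hne).2 hp, abs_zero]
    exact ht.pos
  obtain ⟨i1, -⟩ := key isLayerKernel_curvatureKernel (hTm.pow_const 2) fun x hx => (hTc x hx).pow 2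
  obtain ⟨i2, t2⟩ := key isLayerKernel_mixedKernel hTm hTc
  obtain ⟨i3, t3⟩ := key isLayerKernel_defectKernel (measurable_const (a := (1 : ℝ)))
    fun x _ => continuousAt_const
  obtain ⟨i4, -⟩ := key isLayerKernel_curvatureKernel hNm hNc
  obtain ⟨i5, t5⟩ := key isLayerKernel_curvatureKernel
    (g := fun x => κb / 2 * T x ^ 2 + κG * ((T x ^ 2 - N x) / 2))
    (((hTm.pow_const 2).const_mul _).add ((((hTm.pow_const 2).sub hNm).div_const 2).const_mul _))
    fun x hx => (((hTc x hx).pow 2).const_mul _).add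
      (((((hTc x hx).pow 2).sub (hNc x hx)).div_const 2).const_mul _)
  have hfin : ∀ᶠ ε in 𝓝[>] 0, HasFiniteEnergy Ω ε (recovery E ε) := by
    filter_upwards [i1, i2, i3, i4, eventually_nhdsGT_zero_pos, eventually_mul_sqrt_lt 5 ht.pos]
      with ε j1 j2 j3 j4 hε hr
    refine ⟨?_, ?_⟩
    · simp_rw [ht.sq_chemicalPotential_eq hε hr]
      exact ((j1.add (j2.const_mul 2)).add j3).const_mul ε
    · simp_rw [ht.normSq_diffuseMatrix_eq hε hr]
      exact (j4.add j3).const_mul ε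
  refine ⟨hfin, ?_⟩
  -- The mixed term enters with `κb / 2 * 2 + κG / 2 * 2`. The squared defect enters only through
  -- `κb / 2`, for it cancels in the Gauss term.
  have hlim := (t5.add (t2.const_mul (κb + κG))).add (t3.const_mul (κb / 2))
  have hH : helfrichEnergy κb κG 0 Ω E = ∫ p in Ω ∩ frontier E,
      (κb / 2 * T p ^ 2 + κG * ((T p ^ 2 - N p) / 2)) ∂(μHE[2] : Measure R3) := by
    refine setIntegral_congr_ae₀ ?_ (ae_of_all _ fun x hx => ?_)
    · exact (hΩ.inter isClosed_frontier.measurableSet).nullMeasurableSet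
    · rw [ht.meanCurvature_eq hEo hx.2, ht.gaussCurvature_eq hEo hx.2]
      simp only [hT, hN, hd]
      ring
  rw [hH]
  simp only [zero_mul, mul_zero, add_zero] at hlim
  refine hlim.congr' ?_
  filter_upwards [hfin, i2, i3, i5, eventually_nhdsGT_zero_pos, eventually_mul_sqrt_lt 5 ht.pos]
    with ε hf j2 j3 j5 hε hr
  have hf2 : IntegrableOn (fun x => chemicalPotential 0 ε (recovery E ε) x ^ 2 -
    normSq (diffuseMatrix ε (recovery E ε) x)) Ω := hf.1.sub hf.2
  have j4 : IntegrableOn (fun x => curvatureKernel ε (d x) *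
      (κb / 2 * T x ^ 2 + κG * ((T x ^ 2 - N x) / 2)) +
    (κb + κG) * (mixedKernel ε (d x) * T x)) Ω := j5.add (j2.const_mul _)
  rw [diffuseHelfrich, diffuseBending, diffuseGauss, ← mul_assoc, ← mul_assoc,
    ← integral_const_mul, ← integral_const_mul, ← integral_const_mul, ← integral_const_mul,
    ← integral_add (hf.1.const_mul _) (hf2.const_mul _),
    ← integral_add j5 (j2.const_mul _), ← integral_add j4 (j3.const_mul _)]
  refine integral_congr_ae (ae_of_all _ fun x => ?_)
  simp only []
  rw [ht.sq_chemicalPotential_eq hε hr, ht.normSq_diffuseMatrix_eq hε hr]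
  simp only [hT, hN, hd]
  field_simp
  ring

end

/-! ### Constant functions -/

theorem hasFiniteEnergy_const (Ω : Set R3) (ε : ℝ) {c : ℝ} (hc : c ^ 2 = 1) :
    HasFiniteEnergy Ω ε fun _ => c := by
  have h := fun x => energies_of_eventuallyEq_const hc
    (EventuallyEq.refl (𝓝 x) fun _ : R3 => c) ε
  constructor
  · simp only [fun x => (h x).1]
    simp
  · simp only [fun x => (h x).2.1]
    simp [normSq]

theorem energyMeasure_const (Ω : Set R3) (ε : ℝ) {c : ℝ} (hc : c ^ 2 = 1) :
    energyMeasure Ω ε (fun _ => c) = 0 := by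
  have h := fun x => energies_of_eventuallyEq_const hc
    (EventuallyEq.refl (𝓝 x) fun _ : R3 => c) ε
  simp only [energyMeasure, fun x => (h x).2.2]
  simp

theorem diffuseHelfrich_const (κb κG : ℝ) (Ω : Set R3) (ε : ℝ) {c : ℝ} (hc : c ^ 2 = 1) :
    diffuseHelfrich κb κG Ω ε (fun _ => c) = 0 := by
  have h := fun x => energies_of_eventuallyEq_const hc
    (EventuallyEq.refl (𝓝 x) fun _ : R3 => c) ε
  simp only [diffuseHelfrich, diffuseBending, diffuseGauss, fun x => (h x).1, fun x => (h x).2.1]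
  simp [normSq]

theorem eq_empty_of_frontier_eq_empty {E : Set R3} (hE : Bornology.IsBounded E)
    (h : frontier E = ∅) : E = ∅ := by
  rcases isClopen_iff.1 (isClopen_iff_frontier_eq_empty.2 h) with h1 | h1
  · exact h1
  · exact absurd (h1 ▸ hE) (NormedSpace.unbounded_univ ℝ R3)

end Helfrich

end

/-! ### Assembly of the recovery family. -/

theorem mainTheorem2 (κb κG : ℝ) (Ω E : Set R3)
    (hΩ_open : IsOpen Ω) (hΩ_conn : IsConnected Ω) (hΩ_smooth : HasBoundaryOfClass ∞ Ω)
    (hE_open : IsOpen E) (hE_bdd : Bornology.IsBounded E) (hE_sub : E ⊆ Ω)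
    (hE_C2 : HasBoundaryOfClass 2 E) :
    ∃ u : ℝ → R3 → ℝ,
      (∀ ε > 0, ContDiffOn ℝ 2 (u ε) Ω ∧ HasFiniteEnergy Ω ε (u ε)) ∧
      Tendsto (fun ε => eLpNorm (fun x => u ε x - (2 * E.indicator 1 x - 1)) 1
        (volume.restrict Ω)) (𝓝[>] 0) (𝓝 0) ∧
      TendstoAsRadonMeasures Ω (fun ε => energyMeasure Ω ε (u ε))
        (ENNReal.ofReal c₀ • (μHE[2] : Measure R3).restrict (frontier E)) ∧
      Tendsto (fun ε => diffuseHelfrich κb κG Ω ε (u ε)) (𝓝[>] 0)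
        (𝓝 (c₀ * helfrichEnergy κb κG 0 Ω E)) := by
  rcases (frontier E).eq_empty_or_nonempty with hfr | hne
  -- A bounded set without boundary is empty, and the constant `-1` has zero energy.
  · have hE := eq_empty_of_frontier_eq_empty hE_bdd hfr
    have hc : (-1 : ℝ) ^ 2 = 1 := by norm_num
    refine ⟨fun _ _ => -1, fun ε _ => ⟨contDiffOn_const, hasFiniteEnergy_const Ω ε hc⟩, ?_,
      fun φ _ _ _ => ?_, ?_⟩
    · simp [hE]
    · simp [energyMeasure_const Ω _ hc, hfr]
    · simp [diffuseHelfrich_const κb κG Ω _ hc, helfrichEnergy, hfr]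
  have hK : IsCompact (frontier E) :=
    Metric.isCompact_of_isClosed_isBounded isClosed_frontier
      (hE_bdd.closure.subset frontier_subset_closure)
  classical
  obtain ⟨r, ht⟩ := exists_isTube hK hne hE_open hE_C2
  have hΩE := fun p (hp : p ∈ frontier E) =>
    ht.eventually_normalMap_mem_iff hE_open hΩ_open hΩ_smooth hE_sub hp
  have hΩm := hΩ_open.measurableSet
  obtain ⟨hfin, hlim⟩ :=
    ht.tendsto_diffuseHelfrich_recovery hE_open hK hne hΩm hΩE κb κG
  -- Regularity and finite energy are demanded for every `ε > 0`, whereas the layer fits in the tube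
  -- only for small `ε`; elsewhere a constant well value is substituted, which does not affect the
  -- limits.
  let u : ℝ → R3 → ℝ := fun ε =>
    if ContDiffOn ℝ 2 (recovery E ε) Ω ∧ HasFiniteEnergy Ω ε (recovery E ε) then recovery E ε
    else fun _ => 1
  have hu : ∀ᶠ ε in 𝓝[>] 0, recovery E ε = u ε := by
    filter_upwards [hfin, eventually_nhdsGT_zero_pos, eventually_mul_sqrt_lt 5 ht.pos]
      with ε h hε hr
    exact (if_pos ⟨(ht.contDiff_recovery hε hr).contDiffOn, h⟩).symm
  refine ⟨u, fun ε _ => ?_, ?_, fun φ h1 h2 h3 => ?_, ?_⟩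
  · by_cases h : ContDiffOn ℝ 2 (recovery E ε) Ω ∧ HasFiniteEnergy Ω ε (recovery E ε)
    · rw [show u ε = recovery E ε from if_pos h]
      exact h
    · rw [show u ε = fun _ => 1 from if_neg h]
      exact ⟨contDiffOn_const, hasFiniteEnergy_const Ω ε (by norm_num)⟩
  · refine (ht.tendsto_eLpNorm_recovery hE_open hK hne hΩm hΩE).congr' ?_
    filter_upwards [hu] with ε h
    rw [h]
  · refine (ht.tendstoAsRadonMeasures_recovery hK hne hΩm hΩE φ h1 h2 h3).congr' ?_
    filter_upwards [hu] with ε h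
    rw [h]
  · refine hlim.congr' ?_
    filter_upwards [hu] with ε h
    rw [h]
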